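/- For $n \ge 0$ let $\mathcal{C}_s$ denote the class of all submodular functions $g:\{0,1\}^n \to [0,1]$, that is, $g(x \vee y) + g(x \wedge y) \le g(x) + g(y)$ for all $x,y\in\{0,1\}^n$, and let $\|u\|_2 = (\mathbf{E}_{x}[u(x)^2])^{1/2}$ for $x$ uniform on $\{0,1\}^n$. There is a randomized algorithm $\mathcal{A}$ (a single program of a random access machine with real arithmetic and fair coins, whose steps are counted) with the following property. Given $n$, any $\epsilon > 0$, and access to value queries for an arbitrary function $f:\{0,1\}^n \to [0,1]$ (a query returns $f(x)$ for a point $x \in \{0,1\}^n$ of the algorithm's choice), $\mathcal{A}$ outputs, with probability at least $2/3$ over its coins, a function $h:\{0,1\}^n\to\mathbb{R}$, given as an explicit linear combination $h=\sum_j c_j\chi_{S_j}$ of parities $\chi_S(x) = (-1)^{\sum_{i\in S}x_i}$, such that $$\|f-h\|_2 \le \Delta + \epsilon, \qquad \text{where } \Delta = \min_{g \in \mathcal{C}_s} \|f-g\|_2$$ (the minimum is attained). For every outcome of its coins, $\mathcal{A}$ halts in time $\mathrm{poly}(n, 2^{1/\epsilon^2})$ and uses $\mathrm{poly}(\log n,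 2^{1/\epsilon^2})$ value queries. The polynomials do not depend on $n$, $\epsilon$ or $f$. -/

import Mathlib

/-! # Submodular functions on the cube, and a randomized machine with value queries -/

namespace SubmodLearn

noncomputable section

/-- The Boolean cube `{0,1}^n`. -/
abbrev Cube (n : ℕ) : Type := Fin n → Bool

/-! ### Analysis on the cube -/

/-- `‖f‖₂ = (E_{x ∼ U} [f(x)²])^{1/2}`, for the uniform distribution `U` on the cube. -/
def l2norm {n : ℕ} (f : Cube n → ℝ) : ℝ :=
  Real.sqrt ((∑ x : Cube n, f x ^ 2) / 2 ^ n)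

/-- The parity `χ_S(x) = (-1)^{∑_{i ∈ S} x_i}`. -/
def parity {n : ℕ} (S : Finset (Fin n)) (x : Cube n) : ℝ :=
  (-1) ^ (∑ i ∈ S, if x i then 1 else 0)

/-- The class of all submodular functions from `{0,1}^n` to `[0,1]`. On the cube, the coordinatewise
operations `⊔` and `⊓` are union and intersection of the corresponding sets. -/
def submodularClass (n : ℕ) : Set (Cube n → ℝ) :=
  {g | (∀ x, g x ∈ Set.Icc (0 : ℝ) 1) ∧ ∀ x y, g (x ⊔ y) + g (x ⊓ y) ≤ g x + g y}

/-! ### The machine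

A random access machine with a memory of natural numbers (`+` and truncated `-` only, so that numbers
gain at most one bit per step), a memory of real numbers (field operations and comparison, no
rounding), fair coins, value queries and an output tape. Programs are finite objects without real
constants. The output is a list of pairs `(S, c)` which stands for the function `∑ c · χ_S`. -/

/-- Basic instructions; `M` is the memory of natural numbers, `R` is the memory of reals. -/
inductive Instr : Type
  /-- no operation -/
  | skip
  /-- `M[d] := c` -/
  | const (d c : ℕ)
  /-- `M[d] := M[a] + M[b]` -/
  | add (d a b : ℕ)
  /-- `M[d] := max (M[a] - M[b]) 0` -/
  | sub (d a b : ℕ)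
  /-- `M[d] := M[M[a]]` -/
  | load (d a : ℕ)
  /-- `M[M[a]] := M[b]` -/
  | store (a b : ℕ)
  /-- `R[d] := M[a]` -/
  | rcast (d a : ℕ)
  /-- `R[d] := R[a] + R[b]` -/
  | radd (d a b : ℕ)
  /-- `R[d] := R[a] - R[b]` -/
  | rsub (d a b : ℕ)
  /-- `R[d] := R[a] * R[b]` -/
  | rmul (d a b : ℕ)
  /-- `R[d] := R[a] / R[b]` (and `0` if `R[b] = 0`) -/
  | rdiv (d a b : ℕ)
  /-- `R[d] := R[M[a]]` -/
  | rload (d a : ℕ)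
  /-- `R[M[a]] := R[b]` -/
  | rstore (a b : ℕ)
  /-- `M[d] :=` a fresh fair coin -/
  | flip (d : ℕ)
  /-- `R[d] := f(x)`, where `x` is the bit vector in the `n` cells of `M` from address `M[a]` on -/
  | query (d a : ℕ)
  /-- output `(S, R[b])`, where `S` is given by the `n` cells of `M` from address `M[a]` on -/
  | emit (a b : ℕ)

/-- The tests that control branches and loops. -/
inductive Test : Type
  /-- `M[a] < M[b]` -/
  | lt (a b : ℕ)
  /-- `R[a] < R[b]` -/
  | rlt (a b : ℕ)

/-- Programs: instructions, sequencing, branching and while loops. -/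
inductive Prog : Type
  | instr (i : Instr)
  | seq (p q : Prog)
  | ite (t : Test) (p q : Prog)
  | loop (t : Test) (p : Prog)

/-- Machine states. `coins`, `time` and `queries` count the coins flipped, the time spent and the
value queries asked so far; `out` is the content of the output tape (most recent entry first). -/
structure State (n : ℕ) : Type where
  mem : ℕ → ℕ
  reg : ℕ → ℝ
  coins : ℕ
  time : ℕ
  queries : ℕ
  out : List (Finset (Fin n) × ℝ)

/-- The initial state on input `(n, ε)`: `M[0] = n`, `R[0] = ε`, everything else is zero or empty. -/
def State.init (n : ℕ) (ε : ℝ) : State n where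
  mem := Function.update (fun _ => 0) 0 n
  reg := Function.update (fun _ => 0) 0 ε
  coins := 0
  time := 0
  queries := 0
  out := []

/-- Spend `k` units of time. -/
def State.tick {n : ℕ} (s : State n) (k : ℕ) : State n := { s with time := s.time + k }

/-- `M[d] := v`. -/
def State.setMem {n : ℕ} (s : State n) (d v : ℕ) : State n :=
  { s with mem := Function.update s.mem d v }

/-- `R[d] := v`. -/
def State.setReg {n : ℕ} (s : State n) (d : ℕ) (v : ℝ) : State n :=
  { s with reg := Function.update s.reg d v }

/-- The point of the cube that is stored in the `n` cells of `M` from address `a` on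
(`0` is read as the bit `0`, every other number as the bit `1`). -/
def State.point {n : ℕ} (s : State n) (a : ℕ) : Cube n := fun i => decide (s.mem (a + i) ≠ 0)

/-- The effect of an instruction, for the target function `f` and the coin sequence `ω`. An
instruction that handles a point of the cube costs `n + 1`, every other one costs `1`. -/
def Instr.exec {n : ℕ} (f : Cube n → ℝ) (ω : ℕ → Bool) (s : State n) : Instr → State n
  | .skip => s.tick 1
  | .const d c => (s.setMem d c).tick 1
  | .add d a b => (s.setMem d (s.mem a + s.mem b)).tick 1
  | .sub d a b => (s.setMem d (s.mem a - s.mem b)).tick 1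
  | .load d a => (s.setMem d (s.mem (s.mem a))).tick 1
  | .store a b => (s.setMem (s.mem a) (s.mem b)).tick 1
  | .rcast d a => (s.setReg d (s.mem a : ℝ)).tick 1
  | .radd d a b => (s.setReg d (s.reg a + s.reg b)).tick 1
  | .rsub d a b => (s.setReg d (s.reg a - s.reg b)).tick 1
  | .rmul d a b => (s.setReg d (s.reg a * s.reg b)).tick 1
  | .rdiv d a b => (s.setReg d (s.reg a / s.reg b)).tick 1
  | .rload d a => (s.setReg d (s.reg (s.mem a))).tick 1
  | .rstore a b => (s.setReg (s.mem a) (s.reg b)).tick 1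
  | .flip d =>
      { (s.setMem d (if ω s.coins then 1 else 0)).tick 1 with coins := s.coins + 1 }
  | .query d a =>
      { (s.setReg d (f (s.point (s.mem a)))).tick (n + 1) with queries := s.queries + 1 }
  | .emit a b =>
      { s.tick (n + 1) with
        out := (Finset.univ.filter (fun i => s.point (s.mem a) i = true), s.reg b) :: s.out }

/-- The outcome of a test. -/
def Test.holds {n : ℕ} (s : State n) : Test → Prop
  | .lt a b => s.mem a < s.mem b
  | .rlt a b => s.reg a < s.reg b

/-- `Exec f ω p s s'`: for the target function `f` and the coin sequence `ω`, the program `p` started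
in the state `s` halts in the state `s'`. Every evaluation of a test costs `1`. -/
inductive Exec {n : ℕ} (f : Cube n → ℝ) (ω : ℕ → Bool) : Prog → State n → State n → Prop
  | instr (i : Instr) (s : State n) : Exec f ω (.instr i) s (i.exec f ω s)
  | seq {p q : Prog} {s s' s'' : State n} :
      Exec f ω p s s' → Exec f ω q s' s'' → Exec f ω (.seq p q) s s''
  | ite_true {t : Test} {p q : Prog} {s s' : State n} :
      t.holds s → Exec f ω p (s.tick 1) s' → Exec f ω (.ite t p q) s s'
  | ite_false {t : Test} {p q : Prog} {s s' : State n} :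
      ¬ t.holds s → Exec f ω q (s.tick 1) s' → Exec f ω (.ite t p q) s s'
  | loop_true {t : Test} {p : Prog} {s s' s'' : State n} :
      t.holds s → Exec f ω p (s.tick 1) s' → Exec f ω (.loop t p) s' s'' →
      Exec f ω (.loop t p) s s''
  | loop_false {t : Test} {p : Prog} {s : State n} :
      ¬ t.holds s → Exec f ω (.loop t p) s (s.tick 1)

/-- Execution is deterministic once the coins are fixed: there is at most one final state. -/
theorem Exec.unique {n : ℕ} {f : Cube n → ℝ} {ω : ℕ → Bool} {p : Prog} {s s₁ s₂ : State n}
    (h₁ : Exec f ω p s s₁) (h₂ : Exec f ω p s s₂) : s₁ = s₂ := by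
  induction h₁ generalizing s₂ with
  | instr i s => cases h₂; rfl
  | seq _ _ ih₁ ih₂ =>
    cases h₂ with
    | seq k₁ k₂ => obtain rfl := ih₁ k₁; exact ih₂ k₂
  | ite_true ht _ ih =>
    cases h₂ with
    | ite_true _ k => exact ih k
    | ite_false hf _ => exact absurd ht hf
  | ite_false hf _ ih =>
    cases h₂ with
    | ite_true ht _ => exact absurd ht hf
    | ite_false _ k => exact ih k
  | loop_true ht _ _ ih₁ ih₂ =>
    cases h₂ with
    | loop_true _ k₁ k₂ => obtain rfl := ih₁ k₁; exact ih₂ k₂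
    | loop_false hf => exact absurd ht hf
  | loop_false hf =>
    cases h₂ with
    | loop_true ht _ _ => exact absurd ht hf
    | loop_false _ => rfl

/-- The hypothesis `h = ∑ c · χ_S` that an output tape represents. -/
def hypothesis {n : ℕ} (out : List (Finset (Fin n) × ℝ)) (x : Cube n) : ℝ :=
  (out.map fun e => e.2 * parity e.1 x).sum

/-- The law of an infinite sequence of independent fair coins. -/
def fairCoins : MeasureTheory.Measure (ℕ → Bool) :=
  MeasureTheory.Measure.infinitePi fun _ => (PMF.uniformOfFintype Bool).toMeasure

end

end SubmodLearn

open scoped BigOperators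

namespace SubmodLearn

noncomputable section

/-! ### Fourier analysis on the cube -/

/-- The sign `(-1)^b` of a bit. -/
def sgn (b : Bool) : ℝ := if b then -1 else 1

@[simp] theorem sgn_true : sgn true = -1 := rfl
@[simp] theorem sgn_false : sgn false = 1 := rfl

theorem sgn_mul_self (b : Bool) : sgn b * sgn b = 1 := by cases b <;> simp

theorem sgn_xor (a b : Bool) : sgn (a ^^ b) = sgn a * sgn b := by cases a <;> cases b <;> simp

theorem abs_sgn (b : Bool) : |sgn b| = 1 := by cases b <;> simp

theorem parity_eq_prod {n : ℕ} (S : Finset (Fin n)) (x : Cube n) :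
    parity S x = ∏ i ∈ S, sgn (x i) := by
  unfold parity
  rw [← Finset.prod_pow_eq_pow_sum]
  refine Finset.prod_congr rfl fun i _ => ?_
  cases x i <;> simp

theorem parity_mul_self {n : ℕ} (S : Finset (Fin n)) (x : Cube n) :
    parity S x * parity S x = 1 := by
  simp only [parity_eq_prod, ← Finset.prod_mul_distrib, sgn_mul_self, Finset.prod_const_one]

theorem abs_parity {n : ℕ} (S : Finset (Fin n)) (x : Cube n) : |parity S x| = 1 := by
  simp only [parity_eq_prod, Finset.abs_prod, abs_sgn, Finset.prod_const_one]

@[simp] theorem parity_empty {n : ℕ} (x : Cube n) : parity ∅ x = 1 := by simp [parity_eq_prod]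

/-- Coordinatewise sum modulo two. -/
def bxor {m : ℕ} (x y : Cube m) : Cube m := fun i => x i ^^ y i

theorem bxor_bxor {m : ℕ} (x y : Cube m) : bxor (bxor x y) y = x := by
  funext i; simp [bxor]

theorem bxor_comm {m : ℕ} (x y : Cube m) : bxor x y = bxor y x := by
  funext i; simp [bxor, Bool.xor_comm]

/-- Translation of the cube. -/
def bxorEquiv {m : ℕ} (y : Cube m) : Cube m ≃ Cube m where
  toFun x := bxor x y
  invFun x := bxor x y
  left_inv x := bxor_bxor x y
  right_inv x := bxor_bxor x y

theorem expect_bxor {m : ℕ} (F : Cube m → ℝ) (y : Cube m) :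
    𝔼 x, F (bxor x y) = 𝔼 x, F x :=
  Fintype.expect_equiv (bxorEquiv y) _ _ fun _ => rfl

theorem parity_bxor {n : ℕ} (S : Finset (Fin n)) (x y : Cube n) :
    parity S (bxor x y) = parity S x * parity S y := by
  simp only [parity_eq_prod, ← Finset.prod_mul_distrib, bxor, sgn_xor]

/-- The point with a single one in position `i`. -/
def unitVec {n : ℕ} (i : Fin n) : Cube n := fun j => decide (j = i)

theorem parity_unitVec {n : ℕ} (S : Finset (Fin n)) (i : Fin n) :
    parity S (unitVec i) = if i ∈ S then -1 else 1 := by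
  rw [parity_eq_prod]
  have : ∀ j, sgn (unitVec i j) = if j = i then (-1 : ℝ) else 1 := by
    intro j; by_cases h : j = i <;> simp [unitVec, h]
  simp only [this, Finset.prod_ite_eq']

theorem expect_parity {n : ℕ} (S : Finset (Fin n)) :
    𝔼 x : Cube n, parity S x = if S = ∅ then 1 else 0 := by
  split_ifs with h
  · subst h; simp
  · obtain ⟨i, hi⟩ := Finset.nonempty_iff_ne_empty.2 h
    have h1 := expect_bxor (parity S) (unitVec i)
    simp only [parity_bxor, parity_unitVec, if_pos hi, mul_neg, mul_one,
      Finset.expect_neg_distrib] at h1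
    linarith

theorem parity_mul_parity {n : ℕ} (S T : Finset (Fin n)) (x : Cube n) :
    parity S x * parity T x = parity (symmDiff S T) x := by
  have e : ∀ U : Finset (Fin n), parity U x = ∏ i, if i ∈ U then sgn (x i) else 1 := fun U => by
    rw [parity_eq_prod, Finset.prod_ite_mem, Finset.univ_inter]
  rw [e, e, e, ← Finset.prod_mul_distrib]
  refine Finset.prod_congr rfl fun i _ => ?_
  by_cases h1 : i ∈ S <;> by_cases h2 : i ∈ T <;>
    simp [Finset.mem_symmDiff, h1, h2, sgn_mul_self]

theorem expect_parity_mul {n : ℕ} (S T : Finset (Fin n)) :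
    𝔼 x : Cube n, parity S x * parity T x = if S = T then 1 else 0 := by
  simp only [parity_mul_parity, expect_parity]
  congr 1
  exact propext symmDiff_eq_bot

/-- Fourier coefficients. -/
def fc {n : ℕ} (f : Cube n → ℝ) (S : Finset (Fin n)) : ℝ := 𝔼 x, f x * parity S x

theorem fc_sub {n : ℕ} (f g : Cube n → ℝ) (S : Finset (Fin n)) :
    fc (fun x => f x - g x) S = fc f S - fc g S := by
  simp only [fc, sub_mul, Finset.expect_sub_distrib]

theorem fc_add {n : ℕ} (f g : Cube n → ℝ) (S : Finset (Fin n)) :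
    fc (fun x => f x + g x) S = fc f S + fc g S := by
  simp only [fc, add_mul, Finset.expect_add_distrib]

theorem fc_const_mul {n : ℕ} (c : ℝ) (f : Cube n → ℝ) (S : Finset (Fin n)) :
    fc (fun x => c * f x) S = c * fc f S := by
  simp only [fc, mul_assoc, Finset.mul_expect]

theorem sum_parity_mul {n : ℕ} (x y : Cube n) :
    ∑ S : Finset (Fin n), parity S x * parity S y = if x = y then 2 ^ n else 0 := by
  have h : ∀ S : Finset (Fin n), parity S x * parity S y = ∏ i ∈ S, sgn (x i ^^ y i) := by
    intro S; rw [← parity_bxor, parity_eq_prod]; rfl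
  simp only [h]
  have := Finset.prod_one_add (R := ℝ) (s := (Finset.univ : Finset (Fin n)))
    (f := fun i => sgn (x i ^^ y i))
  rw [Finset.powerset_univ] at this
  rw [← this]
  split_ifs with hxy
  · subst hxy; simp; norm_num
  · obtain ⟨i, hi⟩ := Function.ne_iff.1 hxy
    refine Finset.prod_eq_zero (Finset.mem_univ i) ?_
    have : (x i ^^ y i) = true := by
      revert hi; cases x i <;> cases y i <;> simp
    simp [this]

theorem card_cube (n : ℕ) : (Fintype.card (Cube n) : ℝ) = 2 ^ n := by simp

theorem expect_cube {n : ℕ} (f : Cube n → ℝ) : 𝔼 x, f x = (∑ x, f x) / 2 ^ n := by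
  rw [Fintype.expect_eq_sum_div_card, card_cube]

theorem sum_fc_mul_parity {n : ℕ} (f : Cube n → ℝ) (x : Cube n) :
    ∑ S, fc f S * parity S x = f x := by
  simp only [fc, expect_cube, div_mul_eq_mul_div, Finset.sum_mul]
  rw [← Finset.sum_div, Finset.sum_comm]
  simp only [mul_assoc, ← Finset.mul_sum, sum_parity_mul]
  simp

theorem parseval {n : ℕ} (f : Cube n → ℝ) : ∑ S, fc f S ^ 2 = 𝔼 x, f x ^ 2 := by
  have : ∀ x, f x ^ 2 = ∑ S, fc f S * (f x * parity S x) := fun x => by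
    rw [pow_two]
    nth_rw 2 [← sum_fc_mul_parity f x]
    rw [Finset.mul_sum]
    exact Finset.sum_congr rfl fun S _ => by ring
  simp only [this, Finset.expect_sum_comm, ← Finset.mul_expect, pow_two]
  rfl

theorem l2norm_eq {n : ℕ} (f : Cube n → ℝ) : l2norm f = Real.sqrt (𝔼 x, f x ^ 2) := by
  rw [l2norm, expect_cube]

theorem l2norm_nonneg {n : ℕ} (f : Cube n → ℝ) : 0 ≤ l2norm f := Real.sqrt_nonneg _

theorem l2norm_sq {n : ℕ} (f : Cube n → ℝ) : l2norm f ^ 2 = 𝔼 x, f x ^ 2 := by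
  rw [l2norm_eq, Real.sq_sqrt (Finset.expect_nonneg fun _ _ => sq_nonneg _)]

theorem expect_mul_le_l2norm {n : ℕ} (f g : Cube n → ℝ) :
    𝔼 x, f x * g x ≤ l2norm f * l2norm g := by
  have h := Finset.expect_mul_sq_le_sq_mul_sq (R := ℝ) Finset.univ f g
  rw [← l2norm_sq, ← l2norm_sq, ← mul_pow] at h
  exact le_of_abs_le (abs_le_of_sq_le_sq h (mul_nonneg (l2norm_nonneg _) (l2norm_nonneg _)))

theorem l2norm_add_le {n : ℕ} (f g : Cube n → ℝ) :
    l2norm (fun x => f x + g x) ≤ l2norm f + l2norm g := by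
  refine (sq_le_sq₀ (l2norm_nonneg _) (add_nonneg (l2norm_nonneg _) (l2norm_nonneg _))).1 ?_
  have h := expect_mul_le_l2norm f g
  have h2 : l2norm (fun x => f x + g x) ^ 2
      = l2norm f ^ 2 + 2 * (𝔼 x, f x * g x) + l2norm g ^ 2 := by
    simp only [l2norm_sq, Finset.mul_expect, ← Finset.expect_add_distrib]
    exact Finset.expect_congr rfl fun x _ => by ring
  nlinarith

/-- Efron-Stein inequality. -/
theorem variance_le {n : ℕ} (f : Cube n → ℝ) :
    𝔼 x, (f x - 𝔼 y, f y) ^ 2 ≤ (1 / 4) * ∑ i, 𝔼 x, (f x - f (bxor x (unitVec i))) ^ 2 := by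
  have h0 : ∀ S, fc (fun x => f x - 𝔼 y, f y) S = if S = ∅ then 0 else fc f S := by
    intro S
    rw [fc_sub f (fun _ => 𝔼 y, f y) S]
    have : fc (fun _ : Cube n => 𝔼 y, f y) S = (𝔼 y, f y) * if S = ∅ then 1 else 0 := by
      rw [fc, ← Finset.mul_expect, expect_parity]
    rw [this]
    split_ifs with h
    · subst h; simp [fc]
    · simp
  have h1 : ∀ i S, fc (fun x => f x - f (bxor x (unitVec i))) S
      = if i ∈ S then 2 * fc f S else 0 := by
    intro i S
    rw [fc_sub f (fun x => f (bxor x (unitVec i))) S]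
    have : fc (fun x => f (bxor x (unitVec i))) S = fc f S * parity S (unitVec i) := by
      rw [fc, ← expect_bxor _ (unitVec i)]
      simp only [bxor_bxor, parity_bxor, ← mul_assoc, ← Finset.expect_mul]
      rfl
    rw [this, parity_unitVec]
    split_ifs <;> ring
  simp only [← parseval, h0, h1]
  rw [Finset.sum_comm, Finset.mul_sum]
  refine Finset.sum_le_sum fun S _ => ?_
  have : ∑ i, (if i ∈ S then 2 * fc f S else 0) ^ 2 = S.card * (4 * fc f S ^ 2) := by
    have : ∀ i, (if i ∈ S then 2 * fc f S else 0) ^ 2 = if i ∈ S then 4 * fc f S ^ 2 else 0 := by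
      intro i; split_ifs <;> ring
    simp only [this, Finset.sum_ite_mem, Finset.univ_inter, Finset.sum_const, nsmul_eq_mul]
  rw [this]
  split_ifs with h
  · simp; positivity
  · have : (1 : ℝ) ≤ S.card := by
      exact_mod_cast Finset.card_pos.2 (Finset.nonempty_iff_ne_empty.2 h)
    nlinarith [sq_nonneg (fc f S)]

/-! ### Approximation of submodular functions by shallow decision trees -/

/-- Submodularity on the cube. -/
def Submodular {n : ℕ} (f : Cube n → ℝ) : Prop := ∀ x y, f (x ⊔ y) + f (x ⊓ y) ≤ f x + f y

/-- Fix the variable `i` to the value `b`. -/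
def fixVar {n : ℕ} (i : Fin n) (b : Bool) (f : Cube n → ℝ) : Cube n → ℝ :=
  fun x => f (Function.update x i b)

theorem Submodular.fixVar {n : ℕ} {f : Cube n → ℝ} (hf : Submodular f) (i : Fin n) (b : Bool) :
    Submodular (fixVar i b f) := by
  intro x y
  have h1 : Function.update (x ⊔ y) i b = Function.update x i b ⊔ Function.update y i b := by
    funext j; by_cases h : j = i
    · subst h; simp
    · simp [h]
  have h2 : Function.update (x ⊓ y) i b = Function.update x i b ⊓ Function.update y i b := by
    funext j; by_cases h : j = i
    · subst h; simp
    · simp [h]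
  simp only [SubmodLearn.fixVar, h1, h2]
  exact hf _ _

/-- All marginal increases are at most `α`. -/
def UpBounded {n : ℕ} (α : ℝ) (f : Cube n → ℝ) : Prop :=
  ∀ x i, f (Function.update x i true) - f (Function.update x i false) ≤ α

theorem UpBounded.fixVar {n : ℕ} {α : ℝ} (hα : 0 ≤ α) {f : Cube n → ℝ} (hf : UpBounded α f)
    (i : Fin n) (b : Bool) : UpBounded α (fixVar i b f) := by
  intro x j
  by_cases h : j = i
  · subst h; simpa [SubmodLearn.fixVar] using hα
  · simp only [SubmodLearn.fixVar, Function.update_comm h]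
    exact hf _ _

theorem Submodular.upBounded {n : ℕ} {α : ℝ} {f : Cube n → ℝ} (hf : Submodular f)
    (h : ∀ i, f (Function.update ⊥ i true) - f ⊥ ≤ α) : UpBounded α f := by
  intro x i
  have h1 := hf (Function.update x i false) (Function.update ⊥ i true)
  have e1 : Function.update x i false ⊔ Function.update ⊥ i true = Function.update x i true := by
    funext j; by_cases hj : j = i
    · subst hj; simp
    · simp [hj]
  have e2 : Function.update x i false ⊓ Function.update ⊥ i true = ⊥ := by
    funext j; by_cases hj : j = i
    · subst hj; simp
    · simp [hj]
  rw [e1, e2] at h1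
  linarith [h i]

theorem Submodular.downBounded {n : ℕ} {α : ℝ} {f : Cube n → ℝ} (hf : Submodular f)
    (h : ∀ i, f (Function.update ⊤ i false) - f ⊤ ≤ α) (x : Cube n) (i : Fin n) :
    f (Function.update x i false) - f (Function.update x i true) ≤ α := by
  have h1 := hf (Function.update x i true) (Function.update ⊤ i false)
  have e1 : Function.update x i true ⊔ Function.update ⊤ i false = ⊤ := by
    funext j; by_cases hj : j = i
    · subst hj; simp
    · simp [hj]
  have e2 : Function.update x i true ⊓ Function.update ⊤ i false = Function.update x i false := by
    funext j; by_cases hj : j = i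
    · subst hj; simp
    · simp [hj]
  rw [e1, e2] at h1
  linarith [h i]

theorem Submodular.sum_decrease_le {n : ℕ} {f : Cube n → ℝ} (hf : Submodular f) (x : Cube n)
    (B : Finset (Fin n)) (b : Bool) :
    ∑ i ∈ B, (f x - f (Function.update x i b)) ≤ f x - f (fun j => if j ∈ B then b else x j) := by
  induction B using Finset.induction_on with
  | empty => simp
  | insert a B ha ih =>
    rw [Finset.sum_insert ha]
    have h := hf (fun j => if j ∈ B then b else x j) (Function.update x a b)
    have key : f x + f (fun j => if j ∈ insert a B then b else x j)
        ≤ f (fun j => if j ∈ B then b else x j) + f (Function.update x a b) := by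
      cases b
      · convert h using 3
        · funext j
          by_cases hj : j = a
          · subst hj; simp [ha]
          · by_cases hB : j ∈ B <;> simp [hj, hB]
        · funext j
          by_cases hj : j = a
          · subst hj; simp [ha]
          · by_cases hB : j ∈ B <;> simp [hj, hB]
      · rw [add_comm]
        convert h using 3
        · funext j
          by_cases hj : j = a
          · subst hj; simp [ha]
          · by_cases hB : j ∈ B <;> simp [hj, hB]
        · funext j
          by_cases hj : j = a
          · subst hj; simp [ha]
          · by_cases hB : j ∈ B <;> simp [hj, hB]
    linarith

theorem Submodular.sum_posPart_le {n : ℕ} {f : Cube n → ℝ} (hf : Submodular f)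
    (h01 : ∀ x, f x ∈ Set.Icc (0 : ℝ) 1) (x : Cube n) (b : Bool) :
    ∑ i, max (f x - f (Function.update x i b)) 0 ≤ 1 := by
  have h := hf.sum_decrease_le x (Finset.univ.filter fun i => 0 ≤ f x - f (Function.update x i b)) b
  rw [Finset.sum_filter] at h
  have e : ∀ i, max (f x - f (Function.update x i b)) 0
      = if 0 ≤ f x - f (Function.update x i b) then f x - f (Function.update x i b) else 0 := by
    intro i; split_ifs with h
    · exact max_eq_left h
    · exact max_eq_right (not_le.1 h).le
  simp only [e]
  have h1 := (h01 x).2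
  have h2 := (h01 (fun j => if j ∈ Finset.univ.filter
    (fun i => 0 ≤ f x - f (Function.update x i b)) then b else x j)).1
  linarith

theorem bxor_unitVec {n : ℕ} (x : Cube n) (i : Fin n) :
    bxor x (unitVec i) = Function.update x i (!x i) := by
  funext j
  by_cases h : j = i
  · subst h; simp [bxor, unitVec]
  · simp [bxor, unitVec, h]

theorem update_self_eq {n : ℕ} {x : Cube n} {i : Fin n} {b : Bool} (h : x i = b) :
    Function.update x i b = x := by subst h; simp

theorem Submodular.variance_le {n : ℕ} {α : ℝ} {f : Cube n → ℝ} (hf : Submodular f)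
    (hα : 0 ≤ α) (h01 : ∀ x, f x ∈ Set.Icc (0 : ℝ) 1) (hup : UpBounded α f)
    (hdown : ∀ x i, f (Function.update x i false) - f (Function.update x i true) ≤ α) :
    𝔼 x, (f x - 𝔼 y, f y) ^ 2 ≤ α := by
  refine (SubmodLearn.variance_le f).trans ?_
  let a : Fin n → Cube n → ℝ := fun i x => f x - f (bxor x (unitVec i))
  have habs : ∀ i x, a i x ≤ α := by
    intro i x
    simp only [a, bxor_unitVec]
    have h1 := hup x i
    have h2 := hdown x i
    cases hx : x i
    · rw [update_self_eq hx] at h1 h2; simpa using h2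
    · rw [update_self_eq hx] at h1 h2; simpa using h1
  have hpos : ∀ x, ∑ i, max (a i x) 0 ≤ 2 := by
    intro x
    have h1 := hf.sum_posPart_le h01 x true
    have h2 := hf.sum_posPart_le h01 x false
    have : ∀ i, max (a i x) 0 ≤ max (f x - f (Function.update x i true)) 0
        + max (f x - f (Function.update x i false)) 0 := by
      intro i
      simp only [a, bxor_unitVec]
      cases hx : x i
      · have := le_max_right (f x - f (Function.update x i false)) 0
        simp; 
      · have := le_max_right (f x - f (Function.update x i true)) 0
        simp; 
    have h3 := Finset.sum_le_sum fun i (_ : i ∈ Finset.univ) => this i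
    rw [Finset.sum_add_distrib] at h3
    linarith
  have hsym : ∀ i, 𝔼 x, a i x ^ 2 = 2 * 𝔼 x, max (a i x) 0 ^ 2 := by
    intro i
    have h1 := expect_bxor (fun x => max (a i x) 0 ^ 2) (unitVec i)
    have h2 : ∀ x, a i (bxor x (unitVec i)) = - a i x := by
      intro x; simp only [a, bxor_bxor]; ring
    simp only [h2] at h1
    have h3 : ∀ x, a i x ^ 2 = max (a i x) 0 ^ 2 + max (- a i x) 0 ^ 2 := by
      intro x
      rcases le_total 0 (a i x) with h | h
      · rw [max_eq_left h, max_eq_right (by linarith : - a i x ≤ 0)]; ring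
      · rw [max_eq_right h, max_eq_left (by linarith : 0 ≤ - a i x)]; ring
    simp only [h3, Finset.expect_add_distrib, h1]
    ring
  have hle : ∀ i, 𝔼 x, a i x ^ 2 ≤ 2 * α * 𝔼 x, max (a i x) 0 := by
    intro i
    rw [hsym, mul_assoc, Finset.mul_expect _ _ α]
    refine mul_le_mul_of_nonneg_left (Finset.expect_le_expect fun x _ => ?_)
      (by norm_num : (0 : ℝ) ≤ 2)
    rw [pow_two]
    exact mul_le_mul_of_nonneg_right (max_le (habs i x) hα) (le_max_right _ _)
  have hsum := Finset.sum_le_sum fun i (_ : i ∈ Finset.univ) => hle i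
  rw [← Finset.mul_sum, ← Finset.expect_sum_comm _ _ fun x i => max (a i x) 0] at hsum
  have h4 : 𝔼 x, ∑ i, max (a i x) 0 ≤ 2 :=
    Finset.expect_le Finset.univ_nonempty fun x _ => hpos x
  have h5 : 2 * α * 𝔼 x, ∑ i, max (a i x) 0 ≤ 2 * α * 2 :=
    mul_le_mul_of_nonneg_left h4 (by linarith)
  have h6 : ∑ i, 𝔼 x, (f x - f (bxor x (unitVec i))) ^ 2 = ∑ i, 𝔼 x, a i x ^ 2 := rfl
  rw [h6]
  linarith

/-- Functions computed by decision trees of depth `d` with leaf labels in `[0,1]`. -/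
def IsTree {n : ℕ} : ℕ → (Cube n → ℝ) → Prop
  | 0, g => ∃ v ∈ Set.Icc (0 : ℝ) 1, g = fun _ => v
  | d + 1, g => IsTree d g ∨ ∃ i g₀ g₁, IsTree d g₀ ∧ IsTree d g₁ ∧
      g = fun x => if x i then g₁ x else g₀ x

theorem isTree_const {n : ℕ} (d : ℕ) {v : ℝ} (hv : v ∈ Set.Icc (0 : ℝ) 1) :
    IsTree d (fun _ : Cube n => v) := by
  induction d with
  | zero => exact ⟨v, hv, rfl⟩
  | succ d ih => exact Or.inl ih

theorem fc_mul_parity {n : ℕ} (f : Cube n → ℝ) (S T : Finset (Fin n)) :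
    fc (fun x => f x * parity T x) S = fc f (symmDiff S T) := by
  simp only [fc, mul_assoc, parity_mul_parity]
  simp only [symmDiff_comm]

theorem ite_eq_parity {n : ℕ} (g₀ g₁ : Cube n → ℝ) (i : Fin n) :
    (fun x => if x i then g₁ x else g₀ x) = fun x => (1 / 2) * (g₀ x + g₁ x)
      + (1 / 2) * ((g₀ x - g₁ x) * parity {i} x) := by
  funext x
  rw [parity_eq_prod, Finset.prod_singleton]
  cases x i <;> simp <;> ring

theorem fc_ite {n : ℕ} (g₀ g₁ : Cube n → ℝ) (i : Fin n) (S : Finset (Fin n)) :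
    fc (fun x => if x i then g₁ x else g₀ x) S
      = (1 / 2) * (fc g₀ S + fc g₁ S)
        + (1 / 2) * (fc g₀ (symmDiff S {i}) - fc g₁ (symmDiff S {i})) := by
  rw [ite_eq_parity, fc_add (fun x => (1 / 2) * (g₀ x + g₁ x)), fc_const_mul, fc_const_mul,
    fc_add g₀ g₁, fc_mul_parity (fun x => g₀ x - g₁ x), fc_sub g₀ g₁]

theorem IsTree.fc_eq_zero {n d : ℕ} {g : Cube n → ℝ} (hg : IsTree d g) {S : Finset (Fin n)}
    (hS : d < S.card) : fc g S = 0 := by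
  induction d generalizing g S with
  | zero =>
    obtain ⟨v, -, rfl⟩ := hg
    rw [fc, ← Finset.mul_expect, expect_parity, if_neg, mul_zero]
    rintro rfl; simp at hS
  | succ d ih =>
    rcases hg with hg | ⟨i, g₀, g₁, h₀, h₁, rfl⟩
    · exact ih hg (by omega)
    · have hc : d < (symmDiff S {i}).card := by
        have : S.card ≤ (symmDiff S {i}).card + 1 := by
          have hsub : S ⊆ insert i (symmDiff S {i}) := by
            intro j hj
            by_cases h : j = i
            · simp [h]
            · simp [Finset.mem_symmDiff, h, hj]
          exact (Finset.card_le_card hsub).trans (Finset.card_insert_le _ _)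
        omega
      rw [fc_ite, ih h₀ (by omega), ih h₁ (by omega), ih h₀ hc, ih h₁ hc]
      simp

theorem IsTree.sum_abs_fc_le {n d : ℕ} {g : Cube n → ℝ} (hg : IsTree d g) :
    ∑ S, |fc g S| ≤ 2 ^ d := by
  induction d generalizing g with
  | zero =>
    obtain ⟨v, hv, rfl⟩ := hg
    have : ∀ S : Finset (Fin n), |fc (fun _ => v) S| = if S = ∅ then v else 0 := by
      intro S
      rw [fc, ← Finset.mul_expect, expect_parity]
      split_ifs
      · rw [mul_one, abs_of_nonneg hv.1]
      · simp
    simp only [this]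
    simpa using hv.2
  | succ d ih =>
    rcases hg with hg | ⟨i, g₀, g₁, h₀, h₁, rfl⟩
    · exact (ih hg).trans (pow_le_pow_right₀ (by norm_num) (by omega))
    · have hre : ∀ F : Finset (Fin n) → ℝ, ∑ S, F (symmDiff S {i}) = ∑ S, F S := by
        intro F
        exact Equiv.sum_comp (symmDiff_left_involutive ({i} : Finset (Fin n))).toPerm F
      have hle : ∀ S, |fc (fun x => if x i then g₁ x else g₀ x) S|
          ≤ (1 / 2) * (|fc g₀ S| + |fc g₁ S|)
            + (1 / 2) * (|fc g₀ (symmDiff S {i})| + |fc g₁ (symmDiff S {i})|) := by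
        intro S
        rw [fc_ite, abs_le]
        have a1 := abs_le.1 (le_refl |fc g₀ S|)
        have a2 := abs_le.1 (le_refl |fc g₁ S|)
        have a3 := abs_le.1 (le_refl |fc g₀ (symmDiff S {i})|)
        have a4 := abs_le.1 (le_refl |fc g₁ (symmDiff S {i})|)
        constructor <;> linarith
      have hs := Finset.sum_le_sum fun S (_ : S ∈ Finset.univ) => hle S
      rw [Finset.sum_add_distrib, ← Finset.mul_sum, ← Finset.mul_sum, Finset.sum_add_distrib,
        Finset.sum_add_distrib, hre fun S => |fc g₀ S|, hre fun S => |fc g₁ S|] at hs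
      have := ih h₀
      have := ih h₁
      rw [pow_succ]
      linarith

/-- `g` depends on no variable that `f` does not depend on. -/
def Inherits {n : ℕ} (f g : Cube n → ℝ) : Prop :=
  ∀ i, (∀ x b, f (Function.update x i b) = f x) → ∀ x b, g (Function.update x i b) = g x

theorem expect_fixVar {n : ℕ} (F : Cube n → ℝ) (i : Fin n) :
    𝔼 x, F x = (1 / 2) * (𝔼 x, F (Function.update x i false))
      + (1 / 2) * 𝔼 x, F (Function.update x i true) := by
  have h := expect_bxor F (unitVec i)
  have : ∀ x, F (bxor x (unitVec i)) = F (Function.update x i false)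
      + F (Function.update x i true) - F x := by
    intro x
    rw [bxor_unitVec]
    cases hx : x i
    · rw [update_self_eq hx]; simp
    · rw [update_self_eq hx]; simp
  simp only [this, Finset.expect_sub_distrib, Finset.expect_add_distrib] at h
  linarith

theorem expect_sq_ite {n : ℕ} {f g₀ g₁ : Cube n → ℝ} {i : Fin n}
    (h₀ : ∀ x b, g₀ (Function.update x i b) = g₀ x)
    (h₁ : ∀ x b, g₁ (Function.update x i b) = g₁ x) :
    𝔼 x, (f x - if x i then g₁ x else g₀ x) ^ 2
      = (1 / 2) * (𝔼 x, (fixVar i false f x - g₀ x) ^ 2)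
        + (1 / 2) * 𝔼 x, (fixVar i true f x - g₁ x) ^ 2 := by
  rw [expect_fixVar _ i]
  simp [fixVar, h₀, h₁]

/-- A family of functions in which every member is almost constant, or can be split along a
variable so that one of the two parts has a smaller rank, is approximated by shallow trees. -/
theorem exists_isTree {n : ℕ} {α : ℝ} (Q : ℕ → (Cube n → ℝ) → Prop)
    (h01 : ∀ r f, Q r f → ∀ x, f x ∈ Set.Icc (0 : ℝ) 1) (hα : 0 ≤ α)
    (hQ : ∀ r f, Q r f → (𝔼 x, (f x - 𝔼 y, f y) ^ 2 ≤ α) ∨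
      ∃ r' i b, r = r' + 1 ∧ (∃ x, f (Function.update x i true) ≠ f (Function.update x i false)) ∧
        Q r' (fixVar i b f) ∧ Q r (fixVar i (!b) f))
    (D r : ℕ) (f : Cube n → ℝ) (hf : Q r f) :
    ∃ g, IsTree D g ∧ Inherits f g ∧ 𝔼 x, (f x - g x) ^ 2 ≤ α + 2 ^ r * (3 / 4) ^ D := by
  induction D generalizing r f with
  | zero =>
    refine ⟨fun _ => 0, ⟨0, by simp, rfl⟩, fun _ _ _ _ => rfl, ?_⟩
    have h1 : 𝔼 x, (f x - 0) ^ 2 ≤ 1 := by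
      refine Finset.expect_le Finset.univ_nonempty fun x _ => ?_
      have := h01 r f hf x
      rw [sub_zero]
      exact pow_le_one₀ this.1 this.2
    have h2 : (1 : ℝ) ≤ 2 ^ r := one_le_pow₀ (by norm_num)
    rw [pow_zero, mul_one]
    linarith
  | succ D ih =>
    have hpos : (0 : ℝ) ≤ 2 ^ r * (3 / 4) ^ (D + 1) := by positivity
    rcases hQ r f hf with h | ⟨r', i, b, hr, ⟨x₀, hx₀⟩, hb, hnb⟩
    · refine ⟨fun _ => 𝔼 y, f y, isTree_const _ ⟨?_, ?_⟩, fun _ _ _ _ => rfl, by linarith⟩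
      · exact Finset.expect_nonneg fun x _ => (h01 r f hf x).1
      · exact Finset.expect_le Finset.univ_nonempty fun x _ => (h01 r f hf x).2
    · have fix_indep : ∀ c x d, fixVar i c f (Function.update x i d) = fixVar i c f x := by
        intro c x d; simp [fixVar]
      have hfin : ∀ g₀ g₁ : Cube n → ℝ, IsTree D g₀ → IsTree D g₁ →
          Inherits (fixVar i false f) g₀ → Inherits (fixVar i true f) g₁ →
          (𝔼 x, (fixVar i false f x - g₀ x) ^ 2) + 𝔼 x, (fixVar i true f x - g₁ x) ^ 2
            ≤ 2 * (α + 2 ^ r * (3 / 4) ^ (D + 1)) →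
          ∃ g, IsTree (D + 1) g ∧ Inherits f g ∧
            𝔼 x, (f x - g x) ^ 2 ≤ α + 2 ^ r * (3 / 4) ^ (D + 1) := by
        intro g₀ g₁ t₀ t₁ n₀ n₁ he
        refine ⟨_, Or.inr ⟨i, g₀, g₁, t₀, t₁, rfl⟩, ?_, ?_⟩
        · intro j hj x c
          have hji : j ≠ i := by
            rintro rfl
            exact hx₀ ((hj x₀ true).trans (hj x₀ false).symm)
          have hfj : ∀ d x c, fixVar i d f (Function.update x j c) = fixVar i d f x := by
            intro d x c
            simp only [fixVar]
            rw [Function.update_comm hji, hj]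
          simp only [n₀ j (hfj false) x c, n₁ j (hfj true) x c,
            Function.update_of_ne hji.symm]
        · rw [expect_sq_ite (n₀ i (fix_indep false)) (n₁ i (fix_indep true))]
          linarith
      obtain ⟨g, tg, ng, eg⟩ := ih r' _ hb
      obtain ⟨g', tg', ng', eg'⟩ := ih r _ hnb
      have hsum : (α + 2 ^ r' * (3 / 4) ^ D) + (α + 2 ^ r * (3 / 4) ^ D)
          ≤ 2 * (α + 2 ^ r * (3 / 4) ^ (D + 1)) := by
        subst hr
        rw [pow_succ (3 / 4 : ℝ), pow_succ (2 : ℝ)]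
        linarith
      cases b
      · exact hfin g g' tg tg' ng ng' (by rw [Bool.not_false] at eg'; linarith)
      · exact hfin g' g tg' tg ng' ng (by rw [Bool.not_true] at eg'; linarith)

/-- The invariant of the decision tree construction: the marginal increases of `f` are already
small and `r` bounds the number of further gains at the top, or they are not and `r` bounds the
number of gains at the bottom and at the top. -/
def RankInv {n : ℕ} (R : ℕ) (α : ℝ) (r : ℕ) (f : Cube n → ℝ) : Prop :=
  Submodular f ∧ (∀ x, f x ∈ Set.Icc (0 : ℝ) 1) ∧
    ((UpBounded α f ∧ 1 - f ⊤ ≤ r * α) ∨ ∃ q, r = q + R ∧ 1 - f ⊥ ≤ q * α)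

theorem RankInv.split {n R : ℕ} {α : ℝ} (hα : 0 ≤ α) (hR : 1 ≤ R * α) {r : ℕ} {f : Cube n → ℝ}
    (hf : RankInv R α r f) : (𝔼 x, (f x - 𝔼 y, f y) ^ 2 ≤ α) ∨
      ∃ r' i b, r = r' + 1 ∧ (∃ x, f (Function.update x i true) ≠ f (Function.update x i false)) ∧
        RankInv R α r' (fixVar i b f) ∧ RankInv R α r (fixVar i (!b) f) := by
  obtain ⟨hs, h01, hr⟩ := hf
  by_cases hup : UpBounded α f
  · have htop : 1 - f ⊤ ≤ r * α := by
      rcases hr with ⟨-, h⟩ | ⟨q, rfl, -⟩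
      · exact h
      · have := (h01 ⊤).1
        push_cast
        nlinarith [mul_nonneg (Nat.cast_nonneg q : (0 : ℝ) ≤ q) hα]
    by_cases hdown : ∀ i, f (Function.update ⊤ i false) - f ⊤ ≤ α
    · exact Or.inl (hs.variance_le hα h01 hup (hs.downBounded hdown))
    · right
      push Not at hdown
      obtain ⟨i, hi⟩ := hdown
      have h1 := (h01 (Function.update ⊤ i false)).2
      have htt : Function.update (⊤ : Cube n) i true = ⊤ := update_self_eq rfl
      obtain ⟨r', rfl⟩ : ∃ r', r = r' + 1 := by
        refine Nat.exists_eq_succ_of_ne_zero ?_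
        rintro rfl
        simp at htop
        linarith
      refine ⟨r', i, false, rfl, ⟨⊤, ?_⟩, ⟨hs.fixVar _ _, fun x => h01 _, Or.inl
        ⟨hup.fixVar hα _ _, ?_⟩⟩, ⟨hs.fixVar _ _, fun x => h01 _, Or.inl
        ⟨hup.fixVar hα _ _, ?_⟩⟩⟩
      · rw [htt]; intro h; linarith
      · push_cast at htop; simp only [fixVar]; linarith
      · simpa only [fixVar, Bool.not_false, htt] using htop
  · obtain ⟨q, rfl, hq⟩ : ∃ q, r = q + R ∧ 1 - f ⊥ ≤ q * α := by
      rcases hr with ⟨h, -⟩ | h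
      · exact absurd h hup
      · exact h
    right
    have : ∃ i, α < f (Function.update ⊥ i true) - f ⊥ := by
      by_contra! h
      exact hup (hs.upBounded h)
    obtain ⟨i, hi⟩ := this
    have h1 := (h01 (Function.update ⊥ i true)).2
    have hbb : Function.update (⊥ : Cube n) i false = ⊥ := update_self_eq rfl
    obtain ⟨q', rfl⟩ : ∃ q', q = q' + 1 := by
      refine Nat.exists_eq_succ_of_ne_zero ?_
      rintro rfl
      simp at hq
      linarith
    refine ⟨q' + R, i, true, by ring, ⟨⊥, ?_⟩, ⟨hs.fixVar _ _, fun x => h01 _, Or.inr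
        ⟨q', rfl, ?_⟩⟩, ⟨hs.fixVar _ _, fun x => h01 _, Or.inr ⟨q' + 1, rfl, ?_⟩⟩⟩
    · rw [hbb]; intro h; linarith
    · push_cast at hq; simp only [fixVar]; linarith
    · simpa only [fixVar, Bool.not_true, hbb] using hq

/-- Every submodular function with values in `[0,1]` is close to a decision tree of depth `8 R`. -/
theorem Submodular.exists_isTree {n R : ℕ} (hR : 1 ≤ R) {f : Cube n → ℝ} (hs : Submodular f)
    (h01 : ∀ x, f x ∈ Set.Icc (0 : ℝ) 1) :
    ∃ g, IsTree (8 * R) g ∧ 𝔼 x, (f x - g x) ^ 2 ≤ 2 / R := by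
  have hR0 : (0 : ℝ) < R := by exact_mod_cast hR
  have hRα : (R : ℝ) * (1 / R) = 1 := by field_simp
  have hα : (0 : ℝ) ≤ 1 / R := by positivity
  obtain ⟨g, tg, -, eg⟩ := SubmodLearn.exists_isTree (α := 1 / R) (RankInv R (1 / R))
    (fun r f h => h.2.1) hα (fun r f h => h.split hα hRα.ge) (8 * R) (R + R) f
    ⟨hs, h01, Or.inr ⟨R, rfl, by rw [hRα]; linarith [(h01 ⊥).1]⟩⟩
  refine ⟨g, tg, eg.trans ?_⟩
  have h1 : (2 : ℝ) ^ (R + R) * (3 / 4) ^ (8 * R) ≤ (1 / 2) ^ R := by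
    rw [pow_mul, ← two_mul, pow_mul, ← mul_pow]
    exact pow_le_pow_left₀ (by norm_num) (by norm_num) R
  have h2 : (1 / 2 : ℝ) ^ R ≤ 1 / R := by
    rw [div_pow, one_pow]
    refine one_div_le_one_div_of_le hR0 ?_
    exact_mod_cast (Nat.lt_two_pow_self (n := R)).le
  have : (2 : ℝ) / R = 1 / R + 1 / R := by ring
  linarith

/-! ### Pursuit of the Fourier coefficients on a sample -/

/-- The empirical mean of `u` over the sample points `X t`, `t < m`. -/
def emp {n : ℕ} (m : ℕ) (X : ℕ → Cube n) (u : Cube n → ℝ) : ℝ :=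
  (∑ t ∈ Finset.range m, u (X t)) / m

/-- The values on the sample of the residual after `q` steps of the pursuit. -/
def resid {n : ℕ} (m : ℕ) (X : ℕ → Cube n) (f : Cube n → ℝ) (S : ℕ → Finset (Fin n)) :
    ℕ → ℕ → ℝ
  | 0, t => f (X t)
  | q + 1, t => resid m X f S q t
      - (∑ u ∈ Finset.range m, resid m X f S q u * parity (S q) (X u)) / m * parity (S q) (X t)

/-- The coefficient found in step `q` of the pursuit. -/
def coef {n : ℕ} (m : ℕ) (X : ℕ → Cube n) (f : Cube n → ℝ) (S : ℕ → Finset (Fin n)) (q : ℕ) : ℝ :=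
  (∑ t ∈ Finset.range m, resid m X f S q t * parity (S q) (X t)) / m

/-- The hypothesis after `q` steps of the pursuit. -/
def pursuit {n : ℕ} (m : ℕ) (X : ℕ → Cube n) (f : Cube n → ℝ) (S : ℕ → Finset (Fin n)) (q : ℕ)
    (x : Cube n) : ℝ :=
  ∑ j ∈ Finset.range q, coef m X f S j * parity (S j) x

section

variable {n : ℕ} {m : ℕ} {X : ℕ → Cube n} {f : Cube n → ℝ} {S : ℕ → Finset (Fin n)}

theorem resid_eq (q t : ℕ) : resid m X f S q t = f (X t) - pursuit m X f S q (X t) := by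
  induction q with
  | zero => simp [resid, pursuit]
  | succ q ih =>
    rw [resid, ih, pursuit, pursuit, Finset.sum_range_succ, ← sub_sub]
    rfl

theorem fc_pursuit (q : ℕ) (T : Finset (Fin n)) :
    fc (pursuit m X f S q) T = ∑ j ∈ Finset.range q, if S j = T then coef m X f S j else 0 := by
  have : ∀ x, pursuit m X f S q x * parity T x
      = ∑ j ∈ Finset.range q, coef m X f S j * (parity (S j) x * parity T x) := by
    intro x
    rw [pursuit, Finset.sum_mul]
    exact Finset.sum_congr rfl fun j _ => by ring
  simp only [fc, this, Finset.expect_sum_comm, ← Finset.mul_expect, expect_parity_mul, mul_ite,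
    mul_one, mul_zero]

theorem emp_resid (q : ℕ) (T : Finset (Fin n)) :
    (∑ t ∈ Finset.range m, resid m X f S q t * parity T (X t)) / m
      = emp m X (fun x => f x * parity T x)
        - ∑ j ∈ Finset.range q, coef m X f S j * emp m X (fun x => parity (S j) x * parity T x) := by
  simp only [resid_eq, pursuit, emp, sub_mul, Finset.sum_sub_distrib, sub_div]
  congr 1
  simp only [Finset.sum_mul, mul_div_assoc', Finset.mul_sum]
  rw [Finset.sum_comm, Finset.sum_div]
  simp only [mul_assoc]

theorem emp_parity_self (hm : 0 < m) (T : Finset (Fin n)) :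
    emp m X (fun x => parity T x * parity T x) = 1 := by
  simp only [emp, parity_mul_self, Finset.sum_const, Finset.card_range, nsmul_eq_mul, mul_one]
  exact div_self (by exact_mod_cast hm.ne')

theorem abs_fc_le_one (h01 : ∀ x, f x ∈ Set.Icc (0 : ℝ) 1) (T : Finset (Fin n)) :
    |fc f T| ≤ 1 := by
  refine (Finset.abs_expect_le _ _).trans (Finset.expect_le Finset.univ_nonempty fun x _ => ?_)
  rw [abs_mul, abs_parity, mul_one, abs_of_nonneg (h01 x).1]
  exact (h01 x).2

/-- If the sample is representative for the candidate parities, the pursuit finds their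
Fourier coefficients. -/
theorem abs_fc_sub_pursuit_le {N : ℕ} {τ : ℝ} (hm : 0 < m)
    (h01 : ∀ x, f x ∈ Set.Icc (0 : ℝ) 1) (hτ0 : 0 ≤ τ) (hτ : τ * (1 + 2 * N) ≤ 1)
    (hf : ∀ q < N, |emp m X (fun x => f x * parity (S q) x) - fc f (S q)| ≤ τ)
    (hS : ∀ q < N, ∀ q' < N, S q ≠ S q' →
      |emp m X (fun x => parity (S q) x * parity (S q') x)| ≤ τ)
    {q : ℕ} (hq : q ≤ N) :
    (∀ j < q, |coef m X f S j| ≤ 2) ∧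
      ∀ j < q, |fc f (S j) - fc (pursuit m X f S q) (S j)| ≤ τ * (1 + 2 * N) := by
  induction q with
  | zero => simp
  | succ q ih =>
    obtain ⟨ih1, ih2⟩ := ih (by omega)
    have hqN : (q : ℝ) ≤ N := by exact_mod_cast (by omega : q ≤ N)
    have hstep : ∀ T, fc (pursuit m X f S (q + 1)) T
        = fc (pursuit m X f S q) T + if S q = T then coef m X f S q else 0 := by
      intro T; rw [fc_pursuit, fc_pursuit, Finset.sum_range_succ]
    have hc : |coef m X f S q - (fc f (S q) - fc (pursuit m X f S q) (S q))| ≤ τ * (1 + 2 * N) := by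
      have e : coef m X f S q - (fc f (S q) - fc (pursuit m X f S q) (S q))
          = (emp m X (fun x => f x * parity (S q) x) - fc f (S q))
            - ∑ j ∈ Finset.range q, coef m X f S j *
              (emp m X (fun x => parity (S j) x * parity (S q) x) - if S j = S q then 1 else 0) := by
        rw [coef, emp_resid, fc_pursuit]
        simp only [mul_sub, Finset.sum_sub_distrib, mul_ite, mul_one, mul_zero]
        ring
      have hb : |∑ j ∈ Finset.range q, coef m X f S j *
          (emp m X (fun x => parity (S j) x * parity (S q) x) - if S j = S q then 1 else 0)|
          ≤ q * (2 * τ) := by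
        refine (Finset.abs_sum_le_sum_abs _ _).trans ?_
        have : ∀ j ∈ Finset.range q, |coef m X f S j *
          (emp m X (fun x => parity (S j) x * parity (S q) x) - if S j = S q then 1 else 0)|
            ≤ 2 * τ := by
          intro j hj
          rw [Finset.mem_range] at hj
          rw [abs_mul]
          refine mul_le_mul (ih1 j hj) ?_ (abs_nonneg _) (by norm_num)
          split_ifs with h
          · rw [h, emp_parity_self hm]; simpa using hτ0
          · rw [sub_zero]; exact hS j (by omega) q (by omega) h
        refine (Finset.sum_le_sum this).trans ?_
        simp
      rw [e]
      refine (abs_sub _ _).trans ?_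
      have := hf q (by omega)
      nlinarith
    have hcoef : |coef m X f S q| ≤ 2 := by
      have h1 : |fc f (S q) - fc (pursuit m X f S q) (S q)| ≤ 1 := by
        by_cases h : ∃ j < q, S j = S q
        · obtain ⟨j, hj, hjq⟩ := h
          rw [← hjq]
          exact (ih2 j hj).trans hτ
        · push Not at h
          rw [fc_pursuit, Finset.sum_eq_zero, sub_zero]
          · exact abs_fc_le_one h01 _
          · intro j hj
            rw [if_neg (h j (Finset.mem_range.1 hj))]
      rw [abs_le] at hc h1 ⊢
      constructor <;> linarith
    refine ⟨?_, ?_⟩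
    · intro j hj
      rcases Nat.lt_succ_iff_lt_or_eq.1 hj with h | rfl
      · exact ih1 j h
      · exact hcoef
    · intro j hj
      rw [hstep]
      by_cases h : S q = S j
      · rw [if_pos h, ← h]
        rw [abs_sub_comm] at hc
        convert hc using 2
        ring
      · rw [if_neg h, add_zero]
        rcases Nat.lt_succ_iff_lt_or_eq.1 hj with h' | rfl
        · exact ih2 j h'
        · exact absurd rfl h

end

/-- A function that agrees with `f` on the candidate Fourier coefficients and vanishes on the others
competes with every function of low degree and small spectral norm, provided that the candidates
include the large low-degree coefficients of `f`. -/
theorem expect_sq_le_of_candidates {n d N : ℕ} {f h p : Cube n → ℝ} {S : ℕ → Finset (Fin n)}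
    {θ τ L : ℝ} (hθ : 0 ≤ θ)
    (hpd : ∀ T : Finset (Fin n), d < T.card → fc p T = 0) (hpL : ∑ T, |fc p T| ≤ L)
    (hheavy : ∀ T : Finset (Fin n), T.card ≤ d → θ ≤ |fc f T| → ∃ q < N, S q = T)
    (hcand : ∀ q < N, |fc f (S q) - fc h (S q)| ≤ τ)
    (hother : ∀ T, (∀ q < N, S q ≠ T) → fc h T = 0) :
    𝔼 x, (f x - h x) ^ 2 ≤ 𝔼 x, (f x - p x) ^ 2 + 2 * θ * L + N * τ ^ 2 := by
  classical
  have key : ∀ T, (fc f T - fc h T) ^ 2 ≤ (fc f T - fc p T) ^ 2 + 2 * θ * |fc p T|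
      + if T ∈ (Finset.range N).image S then τ ^ 2 else 0 := by
    intro T
    have hnn : 0 ≤ 2 * θ * |fc p T| := by positivity
    by_cases hT : T ∈ (Finset.range N).image S
    · rw [if_pos hT]
      obtain ⟨q, hq, rfl⟩ := Finset.mem_image.1 hT
      have h1 := hcand q (Finset.mem_range.1 hq)
      have h2 : (fc f (S q) - fc h (S q)) ^ 2 ≤ τ ^ 2 := by
        rw [← sq_abs (fc f (S q) - fc h (S q))]
        exact pow_le_pow_left₀ (abs_nonneg _) h1 2
      nlinarith [sq_nonneg (fc f (S q) - fc p (S q))]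
    · have hT' : ∀ q < N, S q ≠ T := by
        intro q hq e
        exact hT (Finset.mem_image.2 ⟨q, Finset.mem_range.2 hq, e⟩)
      rw [if_neg hT, hother T hT', sub_zero, add_zero]
      by_cases hd : d < T.card
      · rw [hpd T hd]; simp
      · have hlt : |fc f T| ≤ θ := by
          by_contra! hlt
          obtain ⟨q, hq, e⟩ := hheavy T (by omega) hlt.le
          exact hT' q hq e
        have : fc f T * fc p T ≤ θ * |fc p T| :=
          (le_abs_self _).trans (by
            rw [abs_mul]; exact mul_le_mul_of_nonneg_right hlt (abs_nonneg _))
        nlinarith [sq_nonneg (fc p T)]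
  have hs := Finset.sum_le_sum fun T (_ : T ∈ Finset.univ) => key T
  rw [Finset.sum_add_distrib, Finset.sum_add_distrib, ← Finset.mul_sum, Finset.sum_ite_mem,
    Finset.univ_inter, Finset.sum_const, nsmul_eq_mul] at hs
  simp only [← fc_sub] at hs
  rw [parseval, parseval] at hs
  have hc : (((Finset.range N).image S).card : ℝ) ≤ N := by
    exact_mod_cast Finset.card_image_le.trans (Finset.card_range N).le
  have h1 := mul_le_mul_of_nonneg_right hc (sq_nonneg τ)
  have h2 := mul_le_mul_of_nonneg_left hpL (by positivity : 0 ≤ 2 * θ)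
  linarith

/-! ### Finite probability spaces -/

open Classical in
/-- The probability of an event in a finite uniform probability space. -/
def pr {Ω : Type*} [Fintype Ω] (A : Ω → Prop) : ℝ := 𝔼 u, if A u then (1 : ℝ) else 0

section

variable {Ω Ω' : Type*} [Fintype Ω] [Fintype Ω']

open Classical in
theorem pr_mono {A B : Ω → Prop} (h : ∀ u, A u → B u) : pr A ≤ pr B := by
  refine Finset.expect_le_expect fun u _ => ?_
  by_cases hA : A u
  · rw [if_pos hA, if_pos (h u hA)]
  · rw [if_neg hA]; split_ifs <;> norm_num

open Classical in
theorem pr_le_one [Nonempty Ω] (A : Ω → Prop) : pr A ≤ 1 :=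
  Finset.expect_le Finset.univ_nonempty fun u _ => by split_ifs <;> norm_num

open Classical in
theorem pr_exists_le {ι : Type*} (s : Finset ι) (A : ι → Ω → Prop) :
    pr (fun u => ∃ i ∈ s, A i u) ≤ ∑ i ∈ s, pr (A i) := by
  simp only [pr]
  rw [← Finset.expect_sum_comm]
  refine Finset.expect_le_expect fun u _ => ?_
  have hnn : ∀ i ∈ s, (0 : ℝ) ≤ if A i u then 1 else 0 := fun i _ => by
    split_ifs <;> norm_num
  split_ifs with h
  · obtain ⟨i, hi, hA⟩ := h
    have := Finset.single_le_sum hnn hi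
    rwa [if_pos hA] at this
  · exact Finset.sum_nonneg hnn

open Classical in
theorem pr_or_le (A B : Ω → Prop) : pr (fun u => A u ∨ B u) ≤ pr A + pr B := by
  simp only [pr]
  rw [← Finset.expect_add_distrib]
  refine Finset.expect_le_expect fun u _ => ?_
  by_cases hA : A u <;> by_cases hB : B u <;> simp [hA, hB]

open Classical in
theorem pr_not [Nonempty Ω] (A : Ω → Prop) : pr (fun u => ¬ A u) = 1 - pr A := by
  simp only [pr]
  rw [← Fintype.expect_one (ι := Ω) (M := ℝ), ← Finset.expect_sub_distrib]
  refine Finset.expect_congr rfl fun u _ => ?_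
  by_cases hA : A u <;> simp [hA]

open Classical in
theorem pr_equiv (e : Ω ≃ Ω') (A : Ω' → Prop) : pr (fun u => A (e u)) = pr A :=
  Fintype.expect_equiv e _ _ fun _ => rfl

theorem expect_prod (F : Ω × Ω' → ℝ) : 𝔼 u, F u = 𝔼 a, 𝔼 b, F (a, b) := by
  rw [← Finset.univ_product_univ, Finset.expect_product]

open Classical in
theorem pr_prod_le [Nonempty Ω] {A : Ω × Ω' → Prop} {δ : ℝ}
    (h : ∀ a, pr (fun b => A (a, b)) ≤ δ) : pr A ≤ δ := by
  rw [pr, expect_prod]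
  exact Finset.expect_le Finset.univ_nonempty fun a _ => h a

open Classical in
theorem pr_prod_le' [Nonempty Ω'] {A : Ω × Ω' → Prop} {δ : ℝ}
    (h : ∀ b, pr (fun a => A (a, b)) ≤ δ) : pr A ≤ δ := by
  rw [pr, expect_prod, Finset.expect_comm]
  exact Finset.expect_le Finset.univ_nonempty fun a _ => h a

open Classical in
theorem pr_abs_ge_le {F : Ω → ℝ} {t v : ℝ} (ht : 0 < t) (hv : 𝔼 u, F u ^ 2 ≤ v) :
    pr (fun u => t ≤ |F u|) ≤ v / t ^ 2 := by
  rw [le_div_iff₀ (by positivity), pr, Finset.expect_mul]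
  refine le_trans (Finset.expect_le_expect fun u _ => ?_) hv
  split_ifs with h
  · rw [one_mul, ← sq_abs (F u)]
    exact pow_le_pow_left₀ ht.le h 2
  · rw [zero_mul]; positivity

open Classical in
theorem pr_forall_pow (A : Ω → Prop) (N : ℕ) :
    pr (fun u : Fin N → Ω => ∀ q, A (u q)) = pr A ^ N := by
  rw [pr, pr, Finset.expect_pow, Fintype.piFinset_univ]
  refine Finset.expect_congr rfl fun u _ => ?_
  split_ifs with h
  · simp [h]
  · push Not at h
    obtain ⟨q, hq⟩ := h
    exact (Finset.prod_eq_zero (Finset.mem_univ q) (if_neg hq)).symm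

open Classical in
theorem pr_eq_const (b : Ω) : pr (fun u => u = b) = 1 / Fintype.card Ω := by
  rw [pr, Fintype.expect_eq_sum_div_card]
  simp

/-- The value of a random function at a point, compared with a value that depends only on the other
points. -/
theorem pr_apply_eq_le {ι β : Type*} [Fintype ι] [DecidableEq ι] [Fintype β] [Nonempty β]
    (i : ι) (F : ({ j // j ≠ i } → β) → β) :
    pr (fun u : ι → β => u i = F fun j => u j) ≤ 1 / Fintype.card β := by
  have := pr_equiv (Equiv.funSplitAt i β) (fun p => p.1 = F p.2)
  simp only [Equiv.funSplitAt_apply] at this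
  rw [this]
  exact pr_prod_le' fun b => (pr_eq_const (F b)).le

theorem pr_apply_eq_apply_le {ι β : Type*} [Fintype ι] [DecidableEq ι] [Fintype β] [Nonempty β]
    {i j : ι} (hij : j ≠ i) : pr (fun u : ι → β => u i = u j) ≤ 1 / Fintype.card β :=
  pr_apply_eq_le i fun r => r ⟨j, hij⟩

theorem pr_apply_eq_const_le {ι β : Type*} [Fintype ι] [DecidableEq ι] [Fintype β] [Nonempty β]
    (i : ι) (b : β) : pr (fun u : ι → β => u i = b) ≤ 1 / Fintype.card β :=
  pr_apply_eq_le i fun _ => b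

end

/-! ### Random affine cubes -/

/-- The sum modulo two of the bit `r 0` and of the bits `r (j + 1)` for the binary digits `j`,
`j < k`, of `b`. -/
def affBit (r : ℕ → Bool) : ℕ → ℕ → Bool
  | 0, _ => r 0
  | k + 1, b => if b < 2 ^ k then affBit r k b else affBit r k (b - 2 ^ k) ^^ r (k + 1)

/-- The points of the affine cube that is spanned by the vectors `z 1, …, z k` at `z 0`. -/
def affPt {n : ℕ} (z : ℕ → Cube n) (k b : ℕ) : Cube n := fun i => affBit (fun j => z j i) k b

theorem affBit_congr {r r' : ℕ → Bool} {k : ℕ} (h : ∀ j ≤ k, r j = r' j) (b : ℕ) :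
    affBit r k b = affBit r' k b := by
  induction k generalizing b with
  | zero => exact h 0 le_rfl
  | succ k ih =>
    simp only [affBit, ih (fun j hj => h j (by omega)), h (k + 1) le_rfl]

theorem affPt_congr {n : ℕ} {z z' : ℕ → Cube n} {k : ℕ} (h : ∀ j ≤ k, z j = z' j) (b : ℕ) :
    affPt z k b = affPt z' k b :=
  funext fun i => affBit_congr (fun j hj => congrFun (h j hj) i) b

theorem affPt_zero {n : ℕ} (z : ℕ → Cube n) (b : ℕ) : affPt z 0 b = z 0 := rfl

theorem affPt_of_lt {n : ℕ} (z : ℕ → Cube n) {k b : ℕ} (h : b < 2 ^ k) :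
    affPt z (k + 1) b = affPt z k b := by
  funext i; simp [affPt, affBit, h]

theorem affPt_add {n : ℕ} (z : ℕ → Cube n) (k b : ℕ) :
    affPt z (k + 1) (2 ^ k + b) = bxor (affPt z k b) (z (k + 1)) := by
  funext i; simp [affPt, affBit, bxor]

theorem sum_affPt_succ {n : ℕ} (z : ℕ → Cube n) (k : ℕ) (φ : Cube n → ℝ) :
    ∑ b ∈ Finset.range (2 ^ (k + 1)), φ (affPt z (k + 1) b)
      = ∑ b ∈ Finset.range (2 ^ k), φ (affPt z k b)
        + ∑ b ∈ Finset.range (2 ^ k), φ (bxor (affPt z k b) (z (k + 1))) := by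
  rw [pow_succ, mul_two, Finset.sum_range_add]
  congr 1
  · refine Finset.sum_congr rfl fun b hb => ?_
    rw [affPt_of_lt z (Finset.mem_range.1 hb)]
  · refine Finset.sum_congr rfl fun b _ => ?_
    rw [affPt_add]

/-- Extend a finite sequence by default values. -/
def ext {β : Type*} [Inhabited β] {a : ℕ} (r : Fin a → β) (j : ℕ) : β :=
  if h : j < a then r ⟨j, h⟩ else default

theorem ext_of_lt {β : Type*} [Inhabited β] {a : ℕ} (r : Fin a → β) {j : ℕ} (h : j < a) :
    ext r j = r ⟨j, h⟩ := dif_pos h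

/-- The sum of a mean zero function over a random affine cube of dimension `k` has the same second
moment as for independent points. -/
theorem expect_sum_affPt_sq {n : ℕ} (k : ℕ) (φ : Cube n → ℝ) (h0 : 𝔼 x, φ x = 0) :
    𝔼 r : Fin (k + 1) → Cube n, (∑ b ∈ Finset.range (2 ^ k), φ (affPt (ext r) k b)) ^ 2
      = 2 ^ k * 𝔼 x, φ x ^ 2 := by
  induction k generalizing φ with
  | zero =>
    simp only [pow_zero, one_mul]
    refine Fintype.expect_equiv (Equiv.funUnique (Fin 1) (Cube n)) _ _ fun r => ?_
    simp [affPt_zero, ext]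
  | succ k ih =>
    rw [← Fintype.expect_equiv (Fin.snocEquiv fun _ => Cube n)
      (fun p => (∑ b ∈ Finset.range (2 ^ (k + 1)),
        φ (affPt (ext (Fin.snocEquiv (fun _ => Cube n) p)) (k + 1) b)) ^ 2) _ fun _ => rfl,
      expect_prod, Finset.expect_comm]
    let A : (Fin (k + 1) → Cube n) → ℝ := fun r =>
      ∑ b ∈ Finset.range (2 ^ k), φ (affPt (ext r) k b)
    let B : Cube n → (Fin (k + 1) → Cube n) → ℝ := fun x r =>
      ∑ b ∈ Finset.range (2 ^ k), φ (bxor (affPt (ext r) k b) x)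
    have hsplit : ∀ (r : Fin (k + 1) → Cube n) (x : Cube n),
        (∑ b ∈ Finset.range (2 ^ (k + 1)),
          φ (affPt (ext (Fin.snocEquiv (fun _ => Cube n) (x, r))) (k + 1) b)) ^ 2
          = A r ^ 2 + 2 * (A r * B x r) + B x r ^ 2 := by
      intro r x
      have e : ∀ b, affPt (ext (Fin.snocEquiv (fun _ => Cube n) (x, r))) k b
          = affPt (ext r) k b := by
        refine fun b => affPt_congr (fun j hj => ?_) b
        rw [ext_of_lt _ (by omega : j < k + 1 + 1), ext_of_lt _ (by omega : j < k + 1)]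
        simp only [Fin.snocEquiv, Equiv.coe_fn_mk]
        exact Fin.snoc_castSucc (α := fun _ => Cube n) x r ⟨j, by omega⟩
      have e' : ext (Fin.snocEquiv (fun _ => Cube n) (x, r)) (k + 1) = x := by
        rw [ext_of_lt _ (by omega : k + 1 < k + 1 + 1)]
        exact Fin.snoc_last (α := fun _ => Cube n) x r
      rw [sum_affPt_succ]
      simp only [e, e', A, B]
      ring
    simp only [hsplit, Finset.expect_add_distrib]
    have h1 : 𝔼 r, 𝔼 x : Cube n, A r ^ 2 = 2 ^ k * 𝔼 x, φ x ^ 2 := by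
      simp only [Fintype.expect_const]
      exact ih φ h0
    have h2 : 𝔼 r, 𝔼 x, 2 * (A r * B x r) = 0 := by
      refine Finset.expect_eq_zero fun r _ => ?_
      rw [← Finset.mul_expect, ← Finset.mul_expect]
      have : 𝔼 x, B x r = 0 := by
        simp only [B]
        rw [Finset.expect_sum_comm]
        refine Finset.sum_eq_zero fun b _ => ?_
        simp only [bxor_comm _ _]
        rw [← h0, ← expect_bxor φ (affPt (ext r) k b)]
      rw [this]; ring
    have h3 : 𝔼 r, 𝔼 x, B x r ^ 2 = 2 ^ k * 𝔼 x, φ x ^ 2 := by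
      rw [Finset.expect_comm]
      have : ∀ x, 𝔼 r, B x r ^ 2 = 2 ^ k * 𝔼 x, φ x ^ 2 := by
        intro x
        have h := ih (fun u => φ (bxor u x)) (by rw [expect_bxor φ x, h0])
        rw [expect_bxor (fun u => φ u ^ 2) x] at h
        exact h
      simp only [this, Fintype.expect_const]
    rw [h1, h2, h3, pow_succ]
    ring

/-- Chebyshev's inequality on random affine cubes. -/
theorem pr_sum_affPt_ge_le {n : ℕ} (k : ℕ) (u : Cube n → ℝ) {μ t : ℝ} (hμ : 𝔼 x, u x = μ)
    (hu : ∀ x, |u x| ≤ 1) (ht : 0 < t) :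
    pr (fun r : Fin (k + 1) → Cube n =>
      2 ^ k * t ≤ |∑ b ∈ Finset.range (2 ^ k), (u (affPt (ext r) k b) - μ)|)
        ≤ 1 / (2 ^ k * t ^ 2) := by
  have h0 : 𝔼 x, (u x - μ) = 0 := by
    rw [Finset.expect_sub_distrib, hμ, Fintype.expect_const, sub_self]
  have h1 : 𝔼 x, (u x - μ) ^ 2 ≤ 1 := by
    have e : 𝔼 x, (u x - μ) ^ 2 = 𝔼 x, u x ^ 2 - μ ^ 2 := by
      have : ∀ x, (u x - μ) ^ 2 = u x ^ 2 - 2 * μ * u x + μ ^ 2 := fun x => by ring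
      simp only [this, Finset.expect_add_distrib, Finset.expect_sub_distrib, ← Finset.mul_expect,
        hμ, Fintype.expect_const]
      ring
    have : 𝔼 x, u x ^ 2 ≤ 1 := Finset.expect_le Finset.univ_nonempty fun x _ =>
      (sq_le_one_iff_abs_le_one _).2 (hu x)
    rw [e]; nlinarith [sq_nonneg μ]
  have h2 := expect_sum_affPt_sq k (fun x => u x - μ) h0
  have hpos : (0 : ℝ) < 2 ^ k := by positivity
  refine (pr_abs_ge_le (v := 2 ^ k) (by positivity) ?_).trans_eq ?_
  · rw [h2]; nlinarith
  · field_simp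

/-! ### Random candidates for large Fourier coefficients -/

/-- The number with binary digits `b 0, …, b (a - 1)`, most significant digit first. -/
def bitsNum (b : ℕ → Bool) : ℕ → ℕ
  | 0 => 0
  | a + 1 => 2 * bitsNum b a + (b a).toNat

theorem bitsNum_lt (b : ℕ → Bool) (a : ℕ) : bitsNum b a < 2 ^ a := by
  induction a with
  | zero => simp [bitsNum]
  | succ a ih =>
    have := Bool.toNat_le (b a)
    rw [bitsNum, pow_succ]; omega

theorem bitsNum_congr {b b' : ℕ → Bool} {a : ℕ} (h : ∀ j < a, b j = b' j) :
    bitsNum b a = bitsNum b' a := by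
  induction a with
  | zero => rfl
  | succ a ih => rw [bitsNum, bitsNum, ih fun j hj => h j (by omega), h a (by omega)]

theorem bitsNum_inj {b b' : ℕ → Bool} {a : ℕ} (h : bitsNum b a = bitsNum b' a) :
    ∀ j < a, b j = b' j := by
  induction a with
  | zero => simp
  | succ a ih =>
    rw [bitsNum, bitsNum] at h
    have h1 := Bool.toNat_le (b a)
    have h2 := Bool.toNat_le (b' a)
    intro j hj
    rcases Nat.lt_succ_iff_lt_or_eq.1 hj with hj | rfl
    · exact ih (by omega) j hj
    · have : (b j).toNat = (b' j).toNat := by omega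
      revert this
      cases b j <;> cases b' j <;> simp

/-- The restriction of `y` to the variables of colour `c`. -/
def mask {n : ℕ} (y : Cube n) (col : Fin n → ℕ) (c : ℕ) : Cube n :=
  fun i => y i && decide (col i = c)

/-- The signed sum of the values of `f` on a translated affine cube. -/
def probeSum {n : ℕ} (f : Cube n → ℝ) (k : ℕ) (z : ℕ → Cube n) (g : ℕ → Bool) (w : Cube n) : ℝ :=
  ∑ b ∈ Finset.range (2 ^ k), f (bxor (affPt z k b) w) * sgn (affBit g k b)

/-- The decoded value of the parity of `w` on the hidden set. -/
def probeBit {n : ℕ} (f : Cube n → ℝ) (k : ℕ) (z : ℕ → Cube n) (g : ℕ → Bool) (w : Cube n) : Bool :=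
  open Classical in decide (probeSum f k z g w < 0)

/-- The set of variables whose test vectors agree with the probes. -/
def candSet {n : ℕ} (f : Cube n → ℝ) (k T : ℕ) (z : ℕ → Cube n) (g : ℕ → Bool)
    (col : Fin n → ℕ) (y : ℕ → Cube n) : Finset (Fin n) :=
  Finset.univ.filter fun i => ∀ t < T, y t i = probeBit f k z g (mask (y t) col (col i))

theorem sgn_affBit {n : ℕ} {S : Finset (Fin n)} {z : ℕ → Cube n} {g : ℕ → Bool} {s : ℝ} {k : ℕ}
    (h0 : sgn (g 0) = s * parity S (z 0)) (h : ∀ j, 1 ≤ j → j ≤ k → sgn (g j) = parity S (z j))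
    {b : ℕ} (hb : b < 2 ^ k) : sgn (affBit g k b) = s * parity S (affPt z k b) := by
  induction k generalizing b with
  | zero => exact h0
  | succ k ih =>
    have ih := fun {b} => @ih (fun j h1 h2 => h j h1 (by omega)) b
    by_cases hlt : b < 2 ^ k
    · rw [affPt_of_lt z hlt, affBit, if_pos hlt, ih hlt]
    · obtain ⟨c, rfl⟩ := Nat.exists_eq_add_of_le (not_lt.1 hlt)
      rw [affPt_add, affBit, if_neg hlt, Nat.add_sub_cancel_left, sgn_xor, parity_bxor,
        ih (by rw [pow_succ] at hb; omega), h (k + 1) (by omega) le_rfl]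
      ring

theorem parity_mask_of_mem {n : ℕ} {S : Finset (Fin n)} {y : Cube n} {col : Fin n → ℕ}
    (hcol : ∀ i ∈ S, ∀ j ∈ S, col i = col j → i = j) {i : Fin n} (hi : i ∈ S) :
    parity S (mask y col (col i)) = sgn (y i) := by
  rw [parity_eq_prod, Finset.prod_eq_single_of_mem i hi]
  · simp [mask]
  · intro j hj hji
    have : col j ≠ col i := fun h => hji (hcol j hj i hi h)
    simp [mask, this]

theorem parity_mask_of_forall_ne {n : ℕ} {S : Finset (Fin n)} {y : Cube n} {col : Fin n → ℕ}
    {c : ℕ} (h : ∀ j ∈ S, col j ≠ c) : parity S (mask y col c) = 1 := by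
  rw [parity_eq_prod]
  exact Finset.prod_eq_one fun j hj => by simp [mask, h j hj]

theorem sgn_injective {a b : Bool} (h : sgn a = sgn b) : a = b := by
  revert h
  cases a <;> cases b <;> norm_num

/-- Decoding is correct if the guess of the parities is correct, the probes are accurate, the
colours isolate the elements of `S`, and the test vectors separate the variables. -/
theorem candSet_eq {n : ℕ} {f : Cube n → ℝ} {S : Finset (Fin n)} {k T : ℕ} {z : ℕ → Cube n}
    {g : ℕ → Bool} {col : Fin n → ℕ} {y : ℕ → Cube n} {s : ℝ} (hs : s * fc f S = |fc f S|)
    (hs1 : |s| = 1)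
    (h0 : sgn (g 0) = s * parity S (z 0)) (hg : ∀ j, 1 ≤ j → j ≤ k → sgn (g j) = parity S (z j))
    (hest : ∀ t < T, ∀ i, |∑ b ∈ Finset.range (2 ^ k),
      (f (bxor (affPt z k b) (mask (y t) col (col i))) * parity S (affPt z k b)
        - fc f S * parity S (mask (y t) col (col i)))| < 2 ^ k * |fc f S|)
    (hcol : ∀ i ∈ S, ∀ j ∈ S, col i = col j → i = j)
    (hsep : ∀ i j, i ≠ j → ∃ t < T, y t i ≠ y t j) (hone : ∀ i, ∃ t < T, y t i = true) :
    candSet f k T z g col y = S := by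
  have hbit : ∀ t < T, ∀ i, sgn (probeBit f k z g (mask (y t) col (col i)))
      = parity S (mask (y t) col (col i)) := by
    intro t ht i
    have he := hest t ht i
    set w := mask (y t) col (col i)
    have hsum : probeSum f k z g w = s * ∑ b ∈ Finset.range (2 ^ k),
        f (bxor (affPt z k b) w) * parity S (affPt z k b) := by
      rw [probeSum, Finset.mul_sum]
      refine Finset.sum_congr rfl fun b hb => ?_
      rw [sgn_affBit h0 hg (Finset.mem_range.1 hb)]
      ring
    rw [Finset.sum_sub_distrib, Finset.sum_const, Finset.card_range, nsmul_eq_mul,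
      ← one_mul |_|, ← hs1, ← abs_mul, mul_sub, ← hsum] at he
    have e2 : s * (((2 ^ k : ℕ) : ℝ) * (fc f S * parity S w))
        = 2 ^ k * |fc f S| * parity S w := by
      rw [← hs]; push_cast; ring
    rw [e2, abs_lt] at he
    rcases eq_or_eq_neg_of_abs_eq (abs_parity S w) with h | h
    · rw [h] at he ⊢
      have : ¬ probeSum f k z g w < 0 := by linarith [he.1]
      simp [probeBit, this]
    · rw [h] at he ⊢
      have : probeSum f k z g w < 0 := by linarith [he.2]
      simp [probeBit, this]
  ext i
  simp only [candSet, Finset.mem_filter, Finset.mem_univ, true_and]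
  constructor
  · intro h
    by_contra hi
    by_cases hex : ∃ j ∈ S, col j = col i
    · obtain ⟨j, hj, hji⟩ := hex
      obtain ⟨t, ht, hne⟩ := hsep i j (by rintro rfl; exact hi hj)
      refine hne (sgn_injective ?_)
      rw [h t ht, hbit t ht i, ← hji, parity_mask_of_mem hcol hj]
    · push Not at hex
      obtain ⟨t, ht, hy⟩ := hone i
      have h1 := hbit t ht i
      rw [← h t ht, parity_mask_of_forall_ne hex, hy] at h1
      norm_num at h1
  · intro hi t ht
    refine sgn_injective ?_
    rw [hbit t ht i, parity_mask_of_mem hcol hi]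

theorem candSet_congr {n : ℕ} (f : Cube n → ℝ) {k T : ℕ} {z z' : ℕ → Cube n} {g g' : ℕ → Bool}
    {col col' : Fin n → ℕ} {y y' : ℕ → Cube n} (hz : ∀ j ≤ k, z j = z' j)
    (hg : ∀ j ≤ k, g j = g' j) (hcol : col = col') (hy : ∀ t < T, y t = y' t) :
    candSet f k T z g col y = candSet f k T z' g' col' y' := by
  subst hcol
  have hsum : probeSum f k z g = probeSum f k z' g' := funext fun w => by
    simp only [probeSum, affPt_congr hz, affBit_congr hg]
  have hbit : probeBit f k z g = probeBit f k z' g' := funext fun w => by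
    unfold probeBit; rw [hsum]
  refine Finset.filter_congr fun i _ => forall₂_congr fun t ht => ?_
  rw [hy t ht, hbit]

/-! ### The success probability of a random candidate -/

/-- The coins of a trial: colours, test vectors, directions and guesses. -/
abbrev Trial (n k a T : ℕ) : Type :=
  ((Fin n → Fin a → Bool) × (Fin n → Fin T → Bool)) × ((Fin (k + 1) → Cube n) × (Fin (k + 1) → Bool))

/-- The colours of a trial. -/
def Trial.col {n k a T : ℕ} (u : Trial n k a T) (i : Fin n) : ℕ := bitsNum (ext (u.1.1 i)) a

/-- The test vectors of a trial. -/
def Trial.test {n k a T : ℕ} (u : Trial n k a T) (t : ℕ) : Cube n := fun i => ext (u.1.2 i) t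

/-- The candidate of a trial. -/
def Trial.cand {n k a T : ℕ} (f : Cube n → ℝ) (u : Trial n k a T) : Finset (Fin n) :=
  candSet f k T (ext u.2.1) (ext u.2.2) u.col u.test

theorem expect_translate_parity {n : ℕ} (f : Cube n → ℝ) (S : Finset (Fin n)) (w : Cube n) :
    𝔼 x, f (bxor x w) * parity S x = fc f S * parity S w := by
  rw [fc, Finset.expect_mul, ← expect_bxor _ w]
  simp only [bxor_bxor, parity_bxor, mul_assoc]

/-- The accuracy of the probes fails with small probability. -/
theorem pr_probe_le {n : ℕ} {f : Cube n → ℝ} (h01 : ∀ x, f x ∈ Set.Icc (0 : ℝ) 1)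
    (S : Finset (Fin n)) (k a T : ℕ) {θ : ℝ} (hθ : 0 < θ) (col : Fin n → ℕ)
    (hcol : ∀ i, col i < 2 ^ a) (y : ℕ → Cube n) :
    pr (fun r : Fin (k + 1) → Cube n => ∃ t < T, ∃ i, 2 ^ k * θ ≤ |∑ b ∈ Finset.range (2 ^ k),
      (f (bxor (affPt (ext r) k b) (mask (y t) col (col i))) * parity S (affPt (ext r) k b)
        - fc f S * parity S (mask (y t) col (col i)))|)
      ≤ T * 2 ^ a / (2 ^ k * θ ^ 2) := by
  let A : ℕ × ℕ → (Fin (k + 1) → Cube n) → Prop := fun p r =>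
    2 ^ k * θ ≤ |∑ b ∈ Finset.range (2 ^ k),
      (f (bxor (affPt (ext r) k b) (mask (y p.1) col p.2)) * parity S (affPt (ext r) k b)
        - fc f S * parity S (mask (y p.1) col p.2))|
  have hA : ∀ p, pr (A p) ≤ 1 / (2 ^ k * θ ^ 2) := by
    intro p
    refine pr_sum_affPt_ge_le k (fun x => f (bxor x (mask (y p.1) col p.2)) * parity S x)
      (expect_translate_parity f S _) (fun x => ?_) hθ
    rw [abs_mul, abs_parity, mul_one, abs_of_nonneg (h01 _).1]
    exact (h01 _).2
  refine le_trans (b := pr fun r => ∃ p ∈ Finset.range T ×ˢ Finset.range (2 ^ a), A p r)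
    (pr_mono fun r hr => ?_) ((pr_exists_le _ A).trans ?_)
  · obtain ⟨t, ht, i, h⟩ := hr
    refine ⟨(t, col i), Finset.mem_product.2 ⟨Finset.mem_range.2 ht, Finset.mem_range.2 (hcol i)⟩, ?_⟩
    exact h
  · refine (Finset.sum_le_sum fun p _ => hA p).trans_eq ?_
    rw [Finset.sum_const, Finset.card_product, Finset.card_range, Finset.card_range, nsmul_eq_mul]
    push_cast
    ring

theorem pr_col_le {n a : ℕ} (S : Finset (Fin n)) :
    pr (fun h : Fin n → Fin a → Bool => ¬ ∀ i ∈ S, ∀ j ∈ S,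
      bitsNum (ext (h i)) a = bitsNum (ext (h j)) a → i = j) ≤ S.card ^ 2 / 2 ^ a := by
  have hex := pr_exists_le ((S ×ˢ S).filter fun p => p.2 ≠ p.1)
    fun (p : Fin n × Fin n) (h : Fin n → Fin a → Bool) => h p.1 = h p.2
  refine (pr_mono ?_).trans (hex.trans ?_)
  · intro h hn
    push Not at hn
    obtain ⟨i, hi, j, hj, he, hne⟩ := hn
    refine ⟨(i, j), by simp [hi, hj, Ne.symm hne], ?_⟩
    funext l
    have := bitsNum_inj he l l.2
    rwa [ext_of_lt _ l.2, ext_of_lt _ l.2] at this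
  · have hc : (Fintype.card (Fin a → Bool) : ℝ) = 2 ^ a := by simp
    refine (Finset.sum_le_sum (g := fun _ => 1 / (2 : ℝ) ^ a) fun p hp => ?_).trans ?_
    · rw [← hc]
      exact pr_apply_eq_apply_le (Finset.mem_filter.1 hp).2
    · rw [Finset.sum_const, nsmul_eq_mul, mul_one_div]
      gcongr
      have := Finset.card_filter_le (S ×ˢ S) fun p : Fin n × Fin n => p.2 ≠ p.1
      rw [Finset.card_product] at this
      rw [pow_two]
      exact_mod_cast this

theorem pr_test_le {n T : ℕ} :
    pr (fun y : Fin n → Fin T → Bool => ¬ ((∀ i j, i ≠ j → ∃ t < T, ext (y i) t ≠ ext (y j) t) ∧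
      ∀ i, ∃ t < T, ext (y i) t = true)) ≤ (n ^ 2 + n) / 2 ^ T := by
  have hc : (Fintype.card (Fin T → Bool) : ℝ) = 2 ^ T := by simp
  refine (pr_mono (B := fun y => (∃ p ∈ Finset.univ.filter fun p : Fin n × Fin n => p.2 ≠ p.1,
      y p.1 = y p.2) ∨ ∃ i ∈ Finset.univ, y i = fun _ => false) ?_).trans
    ((pr_or_le _ _).trans ?_)
  · intro y hn
    rw [not_and_or] at hn
    rcases hn with hn | hn
    · left
      push Not at hn
      obtain ⟨i, j, hij, h⟩ := hn
      refine ⟨(i, j), by simp [Ne.symm hij], funext fun t => ?_⟩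
      have := h t t.2
      rwa [ext_of_lt _ t.2, ext_of_lt _ t.2] at this
    · right
      push Not at hn
      obtain ⟨i, h⟩ := hn
      refine ⟨i, Finset.mem_univ i, funext fun t => ?_⟩
      have := h t t.2
      rw [ext_of_lt _ t.2] at this
      simpa using this
  · rw [add_div]
    refine add_le_add ((pr_exists_le _ fun (p : Fin n × Fin n) (y : Fin n → Fin T → Bool) => y p.1 = y p.2).trans ?_)
      ((pr_exists_le _ fun i (y : Fin n → Fin T → Bool) => y i = fun _ => false).trans ?_)
    · refine (Finset.sum_le_sum (g := fun _ => 1 / (2 : ℝ) ^ T) fun p hp => ?_).trans ?_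
      · rw [← hc]
        exact pr_apply_eq_apply_le (Finset.mem_filter.1 hp).2
      · rw [Finset.sum_const, nsmul_eq_mul, mul_one_div]
        gcongr
        have := Finset.card_filter_le Finset.univ fun p : Fin n × Fin n => p.2 ≠ p.1
        rw [Finset.card_univ, Fintype.card_prod, Fintype.card_fin] at this
        rw [pow_two]
        exact_mod_cast this
    · refine (Finset.sum_le_sum (g := fun _ => 1 / (2 : ℝ) ^ T) fun i _ => ?_).trans ?_
      · rw [← hc]
        exact pr_apply_eq_const_le i _
      · rw [Finset.sum_const, nsmul_eq_mul, mul_one_div, Finset.card_univ, Fintype.card_fin]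

open Classical in
/-- A trial finds a given large coefficient with probability at least `2^{-(k+1)} / 2`. -/
theorem le_pr_cand {n k a T : ℕ} {f : Cube n → ℝ} (h01 : ∀ x, f x ∈ Set.Icc (0 : ℝ) 1)
    {S : Finset (Fin n)} {θ : ℝ} (hθ : 0 < θ) (hS : θ ≤ |fc f S|)
    (hparam : (S.card : ℝ) ^ 2 / 2 ^ a + ((n : ℝ) ^ 2 + n) / 2 ^ T
      + T * 2 ^ a / (2 ^ k * θ ^ 2) ≤ 1 / 2) :
    1 / 2 / 2 ^ (k + 1) ≤ pr fun u : Trial n k a T => u.cand f = S := by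
  obtain ⟨s, hs1, hs⟩ : ∃ s : ℝ, |s| = 1 ∧ s * fc f S = |fc f S| := by
    rcases le_total 0 (fc f S) with h | h
    · exact ⟨1, by simp, by rw [abs_of_nonneg h, one_mul]⟩
    · exact ⟨-1, by simp, by rw [abs_of_nonpos h]; ring⟩
  have hguess : ∀ r : Fin (k + 1) → Cube n, ∃ g : Fin (k + 1) → Bool,
      sgn (ext g 0) = s * parity S (ext r 0) ∧
        ∀ j, 1 ≤ j → j ≤ k → sgn (ext g j) = parity S (ext r j) := by
    intro r
    have : ∀ j : Fin (k + 1), ∃ b, sgn b = (if j = 0 then s else 1) * parity S (r j) := by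
      intro j
      refine ⟨decide ((if j = 0 then s else 1) * parity S (r j) < 0), ?_⟩
      have habs : |(if j = 0 then s else 1) * parity S (r j)| = 1 := by
        rw [abs_mul, abs_parity, mul_one]; split_ifs
        · exact hs1
        · simp
      rcases eq_or_eq_neg_of_abs_eq habs with h | h <;> rw [h] <;> norm_num
    choose g hg using this
    refine ⟨g, ?_, ?_⟩
    · rw [ext_of_lt _ (Nat.succ_pos k), ext_of_lt _ (Nat.succ_pos k)]
      simpa using hg 0
    · intro j h1 hj
      rw [ext_of_lt _ (by omega : j < k + 1), ext_of_lt _ (by omega : j < k + 1)]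
      have hj0 : (⟨j, by omega⟩ : Fin (k + 1)) ≠ 0 := by
        intro h; have := congrArg Fin.val h; simp at this; omega
      simpa [hj0] using hg ⟨j, by omega⟩
  choose γ hγ0 hγ using hguess
  let bad1 : (Fin n → Fin a → Bool) → Prop := fun h => ¬ ∀ i ∈ S, ∀ j ∈ S,
      bitsNum (ext (h i)) a = bitsNum (ext (h j)) a → i = j
  let bad2 : (Fin n → Fin T → Bool) → Prop := fun y =>
    ¬ ((∀ i j, i ≠ j → ∃ t < T, ext (y i) t ≠ ext (y j) t) ∧ ∀ i, ∃ t < T, ext (y i) t = true)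
  let bad3 : (Fin n → Fin a → Bool) × (Fin n → Fin T → Bool) → (Fin (k + 1) → Cube n) → Prop :=
    fun v r => ∃ t < T, ∃ i, 2 ^ k * θ ≤ |∑ b ∈ Finset.range (2 ^ k),
      (f (bxor (affPt (ext r) k b) (mask (fun i => ext (v.2 i) t) (fun i => bitsNum (ext (v.1 i)) a)
          (bitsNum (ext (v.1 i)) a))) * parity S (affPt (ext r) k b)
        - fc f S * parity S (mask (fun i => ext (v.2 i) t) (fun i => bitsNum (ext (v.1 i)) a)
          (bitsNum (ext (v.1 i)) a)))|
  have hsucc : ∀ u : Trial n k a T, ¬ (bad1 u.1.1 ∨ bad2 u.1.2 ∨ bad3 u.1 u.2.1) →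
      u.2.2 = γ u.2.1 → u.cand f = S := by
    intro u hb hgu
    simp only [not_or, bad1, bad2, bad3, not_not] at hb
    obtain ⟨h1, ⟨h2, h2'⟩, h3⟩ := hb
    push Not at h3
    refine candSet_eq hs hs1 (by rw [hgu]; exact hγ0 _) (by rw [hgu]; exact hγ _) ?_ h1 h2 h2'
    intro t ht i
    exact (h3 t ht i).trans_le (by gcongr)
  have hbad : pr (fun p : ((Fin n → Fin a → Bool) × (Fin n → Fin T → Bool)) ×
      (Fin (k + 1) → Cube n) => bad1 p.1.1 ∨ bad2 p.1.2 ∨ bad3 p.1 p.2) ≤ 1 / 2 := by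
    refine (pr_or_le _ _).trans (le_trans (add_le_add ?_ ((pr_or_le _ _).trans
      (add_le_add ?_ ?_))) (by linarith only [hparam] : (S.card : ℝ) ^ 2 / 2 ^ a
        + (((n : ℝ) ^ 2 + n) / 2 ^ T + T * 2 ^ a / (2 ^ k * θ ^ 2)) ≤ 1 / 2))
    · exact pr_prod_le' fun _ => pr_prod_le' (A := fun p => bad1 p.1) fun _ => pr_col_le S
    · exact pr_prod_le' fun _ => pr_prod_le (A := fun p => bad2 p.2) fun _ => pr_test_le
    · exact pr_prod_le fun v => pr_probe_le h01 S k a T hθ (fun i => bitsNum (ext (v.1 i)) a)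
        (fun i => bitsNum_lt _ _) fun t i => ext (v.2 i) t
  have hgood : 1 / 2 ≤ pr (fun p : ((Fin n → Fin a → Bool) × (Fin n → Fin T → Bool)) ×
      (Fin (k + 1) → Cube n) => ¬ (bad1 p.1.1 ∨ bad2 p.1.2 ∨ bad3 p.1 p.2)) := by
    rw [pr_not]; linarith
  have hcard : (Fintype.card (Fin (k + 1) → Bool) : ℝ) = 2 ^ (k + 1) := by simp
  have key : pr (fun p : ((Fin n → Fin a → Bool) × (Fin n → Fin T → Bool)) ×
      (Fin (k + 1) → Cube n) => ¬ (bad1 p.1.1 ∨ bad2 p.1.2 ∨ bad3 p.1 p.2)) * (1 / 2 ^ (k + 1))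
      ≤ pr fun u : Trial n k a T => u.cand f = S := by
    rw [← pr_equiv (Equiv.prodAssoc _ _ _) fun u : Trial n k a T => u.cand f = S, pr, pr,
      expect_prod (Ω' := Fin (k + 1) → Bool), Finset.expect_mul]
    refine Finset.expect_le_expect fun p _ => ?_
    rw [← hcard, ← pr_eq_const (γ p.2)]
    by_cases hp : bad1 p.1.1 ∨ bad2 p.1.2 ∨ bad3 p.1 p.2
    · rw [if_neg (not_not.2 hp), zero_mul]
      exact Finset.expect_nonneg fun b _ => by split_ifs <;> norm_num
    · rw [if_pos hp, one_mul, pr]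
      refine Finset.expect_le_expect fun b _ => ?_
      by_cases hb : b = γ p.2
      · rw [if_pos hb, if_pos]; exact hsucc (p.1, (p.2, b)) hp hb
      · rw [if_neg hb]; split_ifs <;> norm_num
  refine le_trans ?_ key
  rw [div_eq_mul_one_div]
  exact mul_le_mul_of_nonneg_right hgood (by positivity)

/-! ### The success probability of the learner -/

/-- The parameters of the learner: `R` is the rank, `2 ^ k` and `2 ^ k₂` are the numbers of points of
the affine cubes for the probes and for the sample, `T` is the number of test vectors, and `N` is
the number of trials. -/
structure Params (n R k k₂ T N : ℕ) : Prop where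
  R_pos : 1 ≤ R
  T_pos : 1 ≤ T
  test : 8 * (n ^ 2 + n) ≤ 2 ^ T
  le_k : (2 ^ R) ^ 32 * T ≤ 2 ^ k
  k_lt : 2 ^ k < 2 * ((2 ^ R) ^ 32 * T)
  N_eq : N = (2 ^ R) ^ 32 * T * (2 ^ R) ^ 32
  le_k₂ : N ^ 8 ≤ 2 ^ k₂

theorem two_le_two_pow {R : ℕ} (hR : 1 ≤ R) : (2 : ℝ) ≤ 2 ^ R := by
  calc (2 : ℝ) = 2 ^ 1 := by norm_num
    _ ≤ 2 ^ R := pow_le_pow_right₀ (by norm_num) hR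

theorem Params.le_pr_cand {n R k k₂ T N : ℕ} (hp : Params n R k k₂ T N) {f : Cube n → ℝ}
    (h01 : ∀ x, f x ∈ Set.Icc (0 : ℝ) 1) {S : Finset (Fin n)} (hcard : S.card ≤ 8 * R)
    (hS : 1 / (2 ^ R) ^ 10 ≤ |fc f S|) :
    1 / (8 * ((2 ^ R) ^ 32 * T)) ≤ pr fun u : Trial n k (8 * R) T => u.cand f = S := by
  have hB := two_le_two_pow hp.R_pos
  have hT : (0 : ℝ) < T := by exact_mod_cast hp.T_pos
  have hlek : ((2 : ℝ) ^ R) ^ 32 * T ≤ 2 ^ k := by exact_mod_cast hp.le_k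
  have hklt : (2 : ℝ) ^ k < 2 * ((2 ^ R) ^ 32 * T) := by exact_mod_cast hp.k_lt
  have hRB : (R : ℝ) + 1 ≤ 2 ^ R := by exact_mod_cast (Nat.lt_two_pow_self (n := R))
  set B : ℝ := 2 ^ R with hBdef
  have ha : (2 : ℝ) ^ (8 * R) = B ^ 8 := by rw [mul_comm, pow_mul]
  have h1 : (S.card : ℝ) ^ 2 / 2 ^ (8 * R) ≤ 1 / 4 := by
    have hR1 : (1 : ℝ) ≤ R := by exact_mod_cast hp.R_pos
    have hc : (S.card : ℝ) ≤ 8 * R := by exact_mod_cast hcard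
    have hR : (R : ℝ) ≤ B / 2 + B / 2 - 1 := by linarith
    rw [ha, div_le_iff₀ (by positivity)]
    have hc2 : (S.card : ℝ) ^ 2 ≤ (8 * (B - 1)) ^ 2 :=
      pow_le_pow_left₀ (Nat.cast_nonneg _) (by linarith) 2
    have hB8 : B ^ 8 = B ^ 2 * B ^ 6 := by ring
    have hB6 : (2 : ℝ) ^ 6 ≤ B ^ 6 := pow_le_pow_left₀ (by norm_num) hB 6
    have : B ^ 2 * 2 ^ 6 ≤ B ^ 2 * B ^ 6 := mul_le_mul_of_nonneg_left hB6 (by positivity)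
    have hB14 : (2 : ℝ) ^ 6 * 4 * (B - 1) ^ 2 ≤ B ^ 8 := by
      have hq : 4 * (B - 1) ^ 2 ≤ B ^ 4 := by
        have : 2 * (B - 1) ≤ B ^ 2 := by nlinarith
        have := pow_le_pow_left₀ (by linarith : 0 ≤ 2 * (B - 1)) this 2
        nlinarith
      have hB4 : (2 : ℝ) ^ 4 ≤ B ^ 4 := pow_le_pow_left₀ (by norm_num) hB 4
      by_cases hR1' : R = 1
      · have : B = 2 := by rw [hBdef, hR1']; norm_num
        rw [this]; norm_num
      · have hR2 : 2 ≤ R := by have := hp.R_pos; omega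
        have hB' : (4 : ℝ) ≤ B := by
          calc (4 : ℝ) = 2 ^ 2 := by norm_num
            _ ≤ 2 ^ R := pow_le_pow_right₀ (by norm_num) hR2
        have hB4' : (4 : ℝ) ^ 4 ≤ B ^ 4 := pow_le_pow_left₀ (by norm_num) hB' 4
        nlinarith
    nlinarith
  have h2 : ((n : ℝ) ^ 2 + n) / 2 ^ T ≤ 1 / 8 := by
    rw [div_le_iff₀ (by positivity)]
    have : 8 * ((n : ℝ) ^ 2 + n) ≤ 2 ^ T := by exact_mod_cast hp.test
    linarith
  have h3 : T * 2 ^ (8 * R) / (2 ^ k * (1 / B ^ 10) ^ 2) ≤ 1 / 16 := by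
    rw [ha, div_le_iff₀ (by positivity)]
    have e : (1 / 16 : ℝ) * (2 ^ k * (1 / B ^ 10) ^ 2) = 2 ^ k / (16 * B ^ 20) := by
      field_simp
    rw [e, le_div_iff₀ (by positivity)]
    have hB4 : (2 : ℝ) ^ 4 ≤ B ^ 4 := pow_le_pow_left₀ (by norm_num) hB 4
    calc T * B ^ 8 * (16 * B ^ 20) = 2 ^ 4 * (B ^ 28 * T) := by ring
      _ ≤ B ^ 4 * (B ^ 28 * T) := by gcongr
      _ = B ^ 32 * T := by ring
      _ ≤ 2 ^ k := hlek
  refine le_trans ?_ (SubmodLearn.le_pr_cand (k := k) (a := 8 * R) (T := T) h01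
    (θ := 1 / B ^ 10) (by positivity) hS (by linarith))
  rw [div_div]
  refine one_div_le_one_div_of_le (by positivity) ?_
  rw [pow_succ]
  linarith

theorem one_sub_pow_le {p : ℝ} (h0 : 0 < p) (h1 : p ≤ 1) {N : ℕ} (hN : 0 < N) :
    (1 - p) ^ N ≤ 1 / (N * p) := by
  have hN' : (0 : ℝ) < N := by exact_mod_cast hN
  rw [le_div_iff₀ (by positivity)]
  have hb := one_add_mul_le_pow (show (-2 : ℝ) ≤ p by linarith) N
  have h2 : (1 - p) ^ N * (1 + p) ^ N ≤ 1 := by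
    rw [← mul_pow]
    exact pow_le_one₀ (by nlinarith) (by nlinarith)
  have h3 : 0 ≤ (1 - p) ^ N := pow_nonneg (by linarith) N
  nlinarith

/-- The low-degree sets with a large Fourier coefficient. -/
def heavySets {n : ℕ} (f : Cube n → ℝ) (d : ℕ) (θ : ℝ) : Finset (Finset (Fin n)) :=
  open Classical in Finset.univ.filter fun S => S.card ≤ d ∧ θ ≤ |fc f S|

theorem card_heavySets_le {n : ℕ} {f : Cube n → ℝ} (h01 : ∀ x, f x ∈ Set.Icc (0 : ℝ) 1) (d : ℕ)
    {θ : ℝ} (hθ : 0 < θ) : ((heavySets f d θ).card : ℝ) ≤ 1 / θ ^ 2 := by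
  classical
  rw [le_div_iff₀ (by positivity)]
  have h1 : 𝔼 x, f x ^ 2 ≤ 1 := Finset.expect_le Finset.univ_nonempty fun x _ =>
    pow_le_one₀ (h01 x).1 (h01 x).2
  rw [← parseval] at h1
  refine le_trans ?_ h1
  rw [← nsmul_eq_mul, ← Finset.sum_const]
  refine (Finset.sum_le_sum fun S hS => ?_).trans
    (Finset.sum_le_sum_of_subset_of_nonneg (Finset.subset_univ _) fun S _ _ => sq_nonneg (fc f S))
  rw [heavySets, Finset.mem_filter] at hS
  rw [← sq_abs (fc f S)]
  exact pow_le_pow_left₀ hθ.le hS.2.2 2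

theorem Params.pr_miss_le {n R k k₂ T N : ℕ} (hp : Params n R k k₂ T N) {f : Cube n → ℝ}
    (h01 : ∀ x, f x ∈ Set.Icc (0 : ℝ) 1) :
    pr (fun u : Fin N → Trial n k (8 * R) T =>
      ∃ S ∈ heavySets f (8 * R) (1 / (2 ^ R) ^ 10), ∀ q, (u q).cand f ≠ S) ≤ 1 / 6 := by
  classical
  have hB := two_le_two_pow hp.R_pos
  have hT : (0 : ℝ) < T := by exact_mod_cast hp.T_pos
  have hN : (N : ℝ) = (2 ^ R) ^ 32 * T * (2 ^ R) ^ 32 := by exact_mod_cast hp.N_eq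
  have hNpos : 0 < N := by
    have : (0 : ℝ) < N := by rw [hN]; positivity
    exact_mod_cast this
  have hcard := card_heavySets_le h01 (8 * R) (θ := 1 / (2 ^ R) ^ 10) (by positivity)
  set B : ℝ := 2 ^ R
  refine (pr_exists_le _ fun S (u : Fin N → Trial n k (8 * R) T) => ∀ q, (u q).cand f ≠ S).trans ?_
  have hone : ∀ S ∈ heavySets f (8 * R) (1 / B ^ 10),
      pr (fun u : Fin N → Trial n k (8 * R) T => ∀ q, (u q).cand f ≠ S) ≤ 8 / B ^ 32 := by
    intro S hS
    rw [heavySets, Finset.mem_filter] at hS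
    rw [pr_forall_pow fun u : Trial n k (8 * R) T => u.cand f ≠ S]
    have hge := hp.le_pr_cand h01 hS.2.1 hS.2.2
    have hle := pr_le_one fun u : Trial n k (8 * R) T => u.cand f = S
    have hnot := pr_not fun u : Trial n k (8 * R) T => u.cand f = S
    set p := pr fun u : Trial n k (8 * R) T => u.cand f = S
    have hp0 : 0 < p := lt_of_lt_of_le (by positivity) hge
    rw [hnot]
    refine (one_sub_pow_le hp0 hle hNpos).trans ?_
    have hNp : B ^ 32 / 8 ≤ N * p := by
      calc B ^ 32 / 8 = N * (1 / (8 * (B ^ 32 * T))) := by rw [hN]; field_simp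
        _ ≤ N * p := by gcongr
    calc 1 / (N * p) ≤ 1 / (B ^ 32 / 8) := one_div_le_one_div_of_le (by positivity) hNp
      _ = 8 / B ^ 32 := by field_simp
  refine (Finset.sum_le_sum hone).trans ?_
  rw [Finset.sum_const, nsmul_eq_mul]
  have hB12 : (2 : ℝ) ^ 12 ≤ B ^ 12 := pow_le_pow_left₀ (by norm_num) hB 12
  calc ((heavySets f (8 * R) (1 / B ^ 10)).card : ℝ) * (8 / B ^ 32)
      ≤ 1 / (1 / B ^ 10) ^ 2 * (8 / B ^ 32) := by gcongr
    _ = 8 / B ^ 12 := by field_simp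
    _ ≤ 8 / 2 ^ 12 := by gcongr
    _ ≤ 1 / 6 := by norm_num

theorem emp_sub_eq {n m : ℕ} (hm : 0 < m) (X : ℕ → Cube n) (u : Cube n → ℝ) (μ : ℝ) :
    emp m X u - μ = (∑ t ∈ Finset.range m, (u (X t) - μ)) / m := by
  have : (m : ℝ) ≠ 0 := by exact_mod_cast hm.ne'
  rw [emp, Finset.sum_sub_distrib, Finset.sum_const, Finset.card_range, nsmul_eq_mul]
  field_simp

theorem pr_emp_le {n : ℕ} (k : ℕ) (u : Cube n → ℝ) {μ t : ℝ} (hμ : 𝔼 x, u x = μ)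
    (hu : ∀ x, |u x| ≤ 1) (ht : 0 < t) :
    pr (fun r : Fin (k + 1) → Cube n => t < |emp (2 ^ k) (affPt (ext r) k) u - μ|)
      ≤ 1 / (2 ^ k * t ^ 2) := by
  refine (pr_mono fun r hr => ?_).trans (pr_sum_affPt_ge_le k u hμ hu ht)
  rw [emp_sub_eq (by positivity), abs_div, lt_div_iff₀ (by positivity)] at hr
  push_cast at hr
  rw [abs_of_pos (by positivity : (0 : ℝ) < 2 ^ k)] at hr
  rw [mul_comm]
  exact hr.le

/-- The sample is representative for the parities of the sets `S q`, `q < N`. -/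
def Representative {n : ℕ} (m : ℕ) (X : ℕ → Cube n) (f : Cube n → ℝ) (S : ℕ → Finset (Fin n))
    (N : ℕ) (τ : ℝ) : Prop :=
  (∀ q < N, |emp m X (fun x => f x * parity (S q) x) - fc f (S q)| ≤ τ) ∧
    ∀ q < N, ∀ q' < N, S q ≠ S q' → |emp m X (fun x => parity (S q) x * parity (S q') x)| ≤ τ

theorem pr_not_representative_le {n : ℕ} {f : Cube n → ℝ} (h01 : ∀ x, f x ∈ Set.Icc (0 : ℝ) 1)
    (k : ℕ) (S : ℕ → Finset (Fin n)) (N : ℕ) {τ : ℝ} (hτ : 0 < τ) :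
    pr (fun r : Fin (k + 1) → Cube n => ¬ Representative (2 ^ k) (affPt (ext r) k) f S N τ)
      ≤ (N + N ^ 2) / (2 ^ k * τ ^ 2) := by
  have h1 := pr_exists_le (Finset.range N) fun q (r : Fin (k + 1) → Cube n) =>
    τ < |emp (2 ^ k) (affPt (ext r) k) (fun x => f x * parity (S q) x) - fc f (S q)|
  have h2 := pr_exists_le ((Finset.range N ×ˢ Finset.range N).filter fun p => S p.1 ≠ S p.2)
    fun (p : ℕ × ℕ) (r : Fin (k + 1) → Cube n) =>
    τ < |emp (2 ^ k) (affPt (ext r) k) (fun x => parity (S p.1) x * parity (S p.2) x) - 0|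
  refine (pr_mono ?_).trans ((pr_or_le _ _).trans ((add_le_add h1 h2).trans ?_))
  · intro r hr
    rw [Representative, not_and_or] at hr
    rcases hr with hr | hr
    · left
      push Not at hr
      obtain ⟨q, hq, h⟩ := hr
      exact ⟨q, Finset.mem_range.2 hq, h⟩
    · right
      push Not at hr
      obtain ⟨q, hq, q', hq', hne, h⟩ := hr
      refine ⟨(q, q'), by simp [hq, hq', hne], ?_⟩
      rwa [sub_zero]
  · rw [add_div]
    refine add_le_add ?_ ?_
    · refine (Finset.sum_le_sum (g := fun _ => 1 / (2 ^ k * τ ^ 2)) fun q _ => ?_).trans_eq ?_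
      · refine pr_emp_le k _ rfl (fun x => ?_) hτ
        rw [abs_mul, abs_parity, mul_one, abs_of_nonneg (h01 _).1]
        exact (h01 _).2
      · rw [Finset.sum_const, Finset.card_range, nsmul_eq_mul, mul_one_div]
    · refine (Finset.sum_le_sum (g := fun _ => 1 / (2 ^ k * τ ^ 2)) fun p hp => ?_).trans ?_
      · refine pr_emp_le k _ ?_ (fun x => ?_) hτ
        · rw [expect_parity_mul, if_neg (Finset.mem_filter.1 hp).2]
        · rw [abs_mul, abs_parity, abs_parity, mul_one]
      · rw [Finset.sum_const, nsmul_eq_mul, mul_one_div]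
        gcongr
        have := Finset.card_filter_le (Finset.range N ×ˢ Finset.range N) fun p : ℕ × ℕ => S p.1 ≠ S p.2
        rw [Finset.card_product, Finset.card_range] at this
        rw [pow_two]
        exact_mod_cast this

theorem Params.N_ge {n R k k₂ T N : ℕ} (hp : Params n R k k₂ T N) : (2 : ℝ) ^ R * 2 ^ 5 ≤ N := by
  have hB := two_le_two_pow hp.R_pos
  have hT : (1 : ℝ) ≤ T := by exact_mod_cast hp.T_pos
  have hN : (N : ℝ) = (2 ^ R) ^ 32 * T * (2 ^ R) ^ 32 := by exact_mod_cast hp.N_eq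
  rw [hN]
  set B : ℝ := 2 ^ R
  have h1 : (1 : ℝ) ≤ B ^ 58 := one_le_pow₀ (by linarith)
  have h2 : (2 : ℝ) ^ 5 ≤ B ^ 5 := pow_le_pow_left₀ (by norm_num) hB 5
  have hB0 : (0 : ℝ) < B := by linarith
  calc B * 2 ^ 5 ≤ B * B ^ 5 := by gcongr
    _ ≤ (B * B ^ 5) * (T * B ^ 58) := le_mul_of_one_le_right (by positivity)
        (one_le_mul_of_one_le_of_one_le hT h1)
    _ = B ^ 32 * T * B ^ 32 := by ring

/-- The guarantee of the learner in terms of the events that its coins determine. -/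
theorem Params.l2norm_le {n R k k₂ T N : ℕ} (hp : Params n R k k₂ T N) {f g : Cube n → ℝ}
    (h01 : ∀ x, f x ∈ Set.Icc (0 : ℝ) 1) (hg : g ∈ submodularClass n) {ε : ℝ} (hε : 0 < ε)
    (hR : 8 ≤ R * ε ^ 2) {X : ℕ → Cube n} {S : ℕ → Finset (Fin n)}
    (hrep : Representative (2 ^ k₂) X f S N (1 / (3 * N ^ 2)))
    (hheavy : ∀ T ∈ heavySets f (8 * R) (1 / (2 ^ R) ^ 10), ∃ q < N, S q = T) :
    l2norm (fun x => f x - pursuit (2 ^ k₂) X f S N x) ≤ l2norm (fun x => f x - g x) + ε := by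
  obtain ⟨p, tp, ep⟩ := Submodular.exists_isTree hp.R_pos (f := g) hg.2 hg.1
  have hB := two_le_two_pow hp.R_pos
  have hRpos : (0 : ℝ) < R := by exact_mod_cast hp.R_pos
  have hRB : (R : ℝ) ≤ 2 ^ R := by exact_mod_cast (Nat.lt_two_pow_self (n := R)).le
  have hNge := hp.N_ge
  have hN1 : (1 : ℝ) ≤ N := by linarith
  have hτ : 1 / (3 * (N : ℝ) ^ 2) * (1 + 2 * N) ≤ 1 / N := by
    rw [div_mul_eq_mul_div, one_mul, div_le_div_iff₀ (by positivity) (by positivity)]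
    nlinarith
  have hτ1 : 1 / (N : ℝ) ≤ 1 := by rw [div_le_one (by positivity)]; exact hN1
  have hpur := (abs_fc_sub_pursuit_le (q := N) (by positivity) h01 (by positivity) (hτ.trans hτ1)
    hrep.1 hrep.2 le_rfl).2
  have hkey := expect_sq_le_of_candidates (f := f) (h := pursuit (2 ^ k₂) X f S N) (p := p) (S := S)
    (d := 8 * R) (N := N) (θ := 1 / (2 ^ R) ^ 10) (τ := 1 / N) (L := 2 ^ (8 * R)) (by positivity)
    (fun T hT => tp.fc_eq_zero hT) tp.sum_abs_fc_le
    (fun U hU hθ => hheavy U (by simp [heavySets, hU]; simpa using hθ))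
    (fun q hq => (hpur q hq).trans hτ)
    (fun U hU => by
      rw [fc_pursuit]
      exact Finset.sum_eq_zero fun j hj => if_neg (hU j (Finset.mem_range.1 hj)))
  have hfp : l2norm (fun x => f x - p x) ≤ l2norm (fun x => f x - g x) + ε / 2 := by
    have h1 := l2norm_add_le (fun x => f x - g x) (fun x => g x - p x)
    have e : (fun x => f x - g x + (g x - p x)) = fun x => f x - p x := by funext x; ring
    rw [e] at h1
    refine h1.trans (by
      gcongr
      refine (sq_le_sq₀ (l2norm_nonneg _) (by positivity)).1 ?_
      rw [l2norm_sq]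
      refine ep.trans ?_
      rw [div_le_iff₀ hRpos]
      nlinarith)
  have e1 : 2 * (1 / ((2 : ℝ) ^ R) ^ 10) * 2 ^ (8 * R) ≤ 1 / (2 * R) := by
    have : (2 : ℝ) ^ (8 * R) = (2 ^ R) ^ 8 := by rw [mul_comm, pow_mul]
    rw [this]
    set B : ℝ := 2 ^ R with hBdef
    have e : 2 * (1 / B ^ 10) * B ^ 8 = 2 / B ^ 2 := by field_simp
    rw [e, div_le_div_iff₀ (by positivity) (by positivity)]
    have : 4 * R ≤ 4 ^ R := by
      have hpow : ∀ r : ℕ, 4 * (r + 1) ≤ 4 ^ (r + 1) := by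
        intro r
        induction r with
        | zero => norm_num
        | succ r ih => rw [pow_succ]; omega
      obtain ⟨r, rfl⟩ := Nat.exists_eq_add_of_le' hp.R_pos
      exact hpow r
    have h4 : (4 : ℝ) * R ≤ 4 ^ R := by exact_mod_cast this
    have h5 : (4 : ℝ) ^ R = B ^ 2 := by rw [hBdef, ← pow_mul, mul_comm, pow_mul]; norm_num
    linarith
  have e2 : (N : ℝ) * (1 / N) ^ 2 ≤ 1 / (2 * R) := by
    have e : (N : ℝ) * (1 / N) ^ 2 = 1 / N := by field_simp
    rw [e]
    exact one_div_le_one_div_of_le (by positivity) (by linarith)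
  have e3 : 1 / (2 * (R : ℝ)) + 1 / (2 * R) ≤ ε ^ 2 / 8 := by
    have : 1 / (2 * (R : ℝ)) + 1 / (2 * R) = 1 / R := by field_simp; norm_num
    rw [this, div_le_div_iff₀ hRpos (by norm_num)]
    linarith
  have hΔ := l2norm_nonneg fun x => f x - g x
  refine (sq_le_sq₀ (l2norm_nonneg _) (by linarith)).1 ?_
  rw [l2norm_sq]
  have hfp2 := pow_le_pow_left₀ (l2norm_nonneg _) hfp 2
  rw [l2norm_sq] at hfp2
  nlinarith [mul_nonneg hΔ hε.le, sq_nonneg ε]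

/-- The finite probability space of the coins of the learner. -/
abbrev Coins (n k a T k₂ N : ℕ) : Type := (Fin (k₂ + 1) → Cube n) × (Fin N → Trial n k a T)

/-- The candidates of the learner. -/
def Coins.cand {n k a T k₂ N : ℕ} (f : Cube n → ℝ) (u : Coins n k a T k₂ N) (q : ℕ) :
    Finset (Fin n) :=
  ext (fun q => (u.2 q).cand f) q

/-- The hypothesis of the learner. -/
def Coins.hyp {n k a T k₂ N : ℕ} (f : Cube n → ℝ) (u : Coins n k a T k₂ N) : Cube n → ℝ :=
  pursuit (2 ^ k₂) (affPt (ext u.1) k₂) f (u.cand f) N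

theorem Params.le_pr_hyp {n R k k₂ T N : ℕ} (hp : Params n R k k₂ T N) {f g : Cube n → ℝ}
    (h01 : ∀ x, f x ∈ Set.Icc (0 : ℝ) 1) (hg : g ∈ submodularClass n) {ε : ℝ} (hε : 0 < ε)
    (hR : 8 ≤ R * ε ^ 2) :
    2 / 3 ≤ pr fun u : Coins n k (8 * R) T k₂ N =>
      l2norm (fun x => f x - u.hyp f x) ≤ l2norm (fun x => f x - g x) + ε := by
  have hB := two_le_two_pow hp.R_pos
  have hNge := hp.N_ge
  have hN1 : (1 : ℝ) ≤ N := by linarith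
  have hN12 : (12 : ℝ) ≤ N := by linarith
  have hk₂ : (N : ℝ) ^ 8 ≤ 2 ^ k₂ := by exact_mod_cast hp.le_k₂
  have hbad1 : pr (fun u : Coins n k (8 * R) T k₂ N =>
      ∃ S ∈ heavySets f (8 * R) (1 / (2 ^ R) ^ 10), ∀ q, (u.2 q).cand f ≠ S) ≤ 1 / 6 :=
    pr_prod_le fun _ => hp.pr_miss_le h01
  have hbad2 : pr (fun u : Coins n k (8 * R) T k₂ N =>
      ¬ Representative (2 ^ k₂) (affPt (ext u.1) k₂) f (u.cand f) N (1 / (3 * N ^ 2))) ≤ 1 / 6 := by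
    refine pr_prod_le' fun v => ?_
    refine (pr_not_representative_le h01 k₂ (ext fun q => (v q).cand f) N (by positivity)).trans ?_
    rw [div_le_iff₀ (by positivity)]
    have e : (1 / 6 : ℝ) * (2 ^ k₂ * (1 / (3 * (N : ℝ) ^ 2)) ^ 2) = 2 ^ k₂ / (54 * N ^ 4) := by
      field_simp; norm_num
    rw [e, le_div_iff₀ (by positivity)]
    refine le_trans ?_ hk₂
    have h1 : (N : ℝ) + N ^ 2 ≤ 2 * N ^ 2 := by nlinarith
    have h2 : (108 : ℝ) ≤ N ^ 2 := by nlinarith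
    calc ((N : ℝ) + (N : ℝ) ^ 2) * (54 * (N : ℝ) ^ 4) ≤ 2 * (N : ℝ) ^ 2 * (54 * (N : ℝ) ^ 4) := by gcongr
      _ = 108 * (N : ℝ) ^ 6 := by ring
      _ ≤ (N : ℝ) ^ 2 * N ^ 6 := by gcongr
      _ = (N : ℝ) ^ 8 := by ring
  have hgood := pr_not fun u : Coins n k (8 * R) T k₂ N =>
    (∃ S ∈ heavySets f (8 * R) (1 / (2 ^ R) ^ 10), ∀ q, (u.2 q).cand f ≠ S) ∨
      ¬ Representative (2 ^ k₂) (affPt (ext u.1) k₂) f (u.cand f) N (1 / (3 * N ^ 2))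
  have hor := pr_or_le (fun u : Coins n k (8 * R) T k₂ N =>
      ∃ S ∈ heavySets f (8 * R) (1 / (2 ^ R) ^ 10), ∀ q, (u.2 q).cand f ≠ S)
    fun u : Coins n k (8 * R) T k₂ N =>
      ¬ Representative (2 ^ k₂) (affPt (ext u.1) k₂) f (u.cand f) N (1 / (3 * N ^ 2))
  refine le_trans ?_ (pr_mono (A := fun u : Coins n k (8 * R) T k₂ N => ¬
    ((∃ S ∈ heavySets f (8 * R) (1 / (2 ^ R) ^ 10), ∀ q, (u.2 q).cand f ≠ S) ∨
      ¬ Representative (2 ^ k₂) (affPt (ext u.1) k₂) f (u.cand f) N (1 / (3 * N ^ 2)))) ?_)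
  · rw [hgood]; linarith
  · intro u hu
    rw [not_or, not_not] at hu
    obtain ⟨h1, h2⟩ := hu
    push Not at h1
    refine hp.l2norm_le h01 hg hε hR h2 fun S hS => ?_
    obtain ⟨q, hq⟩ := h1 S hS
    exact ⟨q, q.2, by rw [Coins.cand, ext_of_lt _ q.2]; exact hq⟩

/-! ### Reading the coins from an infinite sequence -/

theorem resid_congr {n m : ℕ} (X : ℕ → Cube n) (f : Cube n → ℝ) {S S' : ℕ → Finset (Fin n)} {q : ℕ}
    (h : ∀ j < q, S j = S' j) (t : ℕ) : resid m X f S q t = resid m X f S' q t := by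
  induction q generalizing t with
  | zero => rfl
  | succ q ih =>
    have ih := ih fun j hj => h j (by omega)
    simp only [resid, ih, h q (by omega)]

theorem pursuit_congr {n m : ℕ} (X : ℕ → Cube n) (f : Cube n → ℝ) {S S' : ℕ → Finset (Fin n)}
    {q : ℕ} (h : ∀ j < q, S j = S' j) : pursuit m X f S q = pursuit m X f S' q := by
  funext x
  refine Finset.sum_congr rfl fun j hj => ?_
  have hj := Finset.mem_range.1 hj
  simp only [coef, resid_congr X f (fun i hi => h i (hi.trans hj)), h j hj]

/-- Row `j` of a table of coins with rows of length `n + 1`, without its last entry. -/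
def coinRow (n : ℕ) (ω : ℕ → Bool) (j : ℕ) : Cube n := fun i => ω (j * (n + 1) + i)

/-- The last entry of row `j` of a table of coins with rows of length `n + 1`. -/
def coinLast (n : ℕ) (ω : ℕ → Bool) (j : ℕ) : Bool := ω (j * (n + 1) + n)

/-- The number of coins of a trial. -/
def trialLen (n k a T : ℕ) : ℕ := (k + 1) * (n + 1) + n * a + T * n

/-- The colours that are read from a sequence of coins. -/
def coinCol (n k a : ℕ) (ω : ℕ → Bool) (i : Fin n) : ℕ :=
  bitsNum (fun l => ω ((k + 1) * (n + 1) + i * a + l)) a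

/-- The test vectors that are read from a sequence of coins. -/
def coinTest (n k a : ℕ) (ω : ℕ → Bool) (t : ℕ) : Cube n :=
  fun i => ω ((k + 1) * (n + 1) + n * a + t * n + i)

/-- The candidate that is computed from a sequence of coins. -/
def coinCand {n : ℕ} (f : Cube n → ℝ) (k a T : ℕ) (ω : ℕ → Bool) : Finset (Fin n) :=
  candSet f k T (coinRow n ω) (coinLast n ω) (coinCol n k a ω) (coinTest n k a ω)

/-- The candidate of trial `q`. -/
def coinCands {n : ℕ} (f : Cube n → ℝ) (k a T k₂ : ℕ) (ω : ℕ → Bool) (q : ℕ) : Finset (Fin n) :=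
  coinCand f k a T fun p => ω ((k₂ + 1) * (n + 1) + q * trialLen n k a T + p)

/-- The hypothesis that is computed from a sequence of coins. -/
def coinHyp {n : ℕ} (f : Cube n → ℝ) (k a T k₂ N : ℕ) (ω : ℕ → Bool) : Cube n → ℝ :=
  pursuit (2 ^ k₂) (affPt (coinRow n ω) k₂) f (coinCands f k a T k₂ ω) N

/-- The index set of the coins of a trial. -/
abbrev TrialIdx (n k a T : ℕ) : Type :=
  ((Fin n × Fin a) ⊕ (Fin n × Fin T)) ⊕ ((Fin (k + 1) × Fin n) ⊕ Fin (k + 1))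

/-- The index set of the coins of the learner. -/
abbrev CoinIdx (n k a T k₂ N : ℕ) : Type := (Fin (k₂ + 1) × Fin n) ⊕ (Fin N × TrialIdx n k a T)

/-- A trial as a function on its index set. -/
def trialEquiv (n k a T : ℕ) : Trial n k a T ≃ (TrialIdx n k a T → Bool) :=
  (Equiv.prodCongr
    ((Equiv.prodCongr (Equiv.curry _ _ _).symm (Equiv.curry _ _ _).symm).trans
      (Equiv.sumArrowEquivProdArrow _ _ _).symm)
    ((Equiv.prodCongr (Equiv.curry _ _ _).symm (Equiv.refl _)).trans
      (Equiv.sumArrowEquivProdArrow _ _ _).symm)).trans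
    (Equiv.sumArrowEquivProdArrow _ _ _).symm

/-- The coins of the learner as a function on their index set. -/
def coinsEquiv (n k a T k₂ N : ℕ) : Coins n k a T k₂ N ≃ (CoinIdx n k a T k₂ N → Bool) :=
  (Equiv.prodCongr (Equiv.curry _ _ _).symm
    (((Equiv.refl (Fin N)).arrowCongr (trialEquiv n k a T)).trans (Equiv.curry _ _ _).symm)).trans
    (Equiv.sumArrowEquivProdArrow _ _ _).symm

/-- The positions of the coins of a trial. -/
def trialPos (n k a T : ℕ) : TrialIdx n k a T → ℕ
  | .inl (.inl (i, l)) => (k + 1) * (n + 1) + i * a + l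
  | .inl (.inr (i, t)) => (k + 1) * (n + 1) + n * a + t * n + i
  | .inr (.inl (j, i)) => j * (n + 1) + i
  | .inr (.inr j) => j * (n + 1) + n

/-- The positions of the coins of the learner. -/
def coinPos (n k a T k₂ N : ℕ) : CoinIdx n k a T k₂ N → ℕ
  | .inl (j, i) => j * (n + 1) + i
  | .inr (q, p) => (k₂ + 1) * (n + 1) + q * trialLen n k a T + trialPos n k a T p

theorem mul_add_lt {q b m i : ℕ} (hq : q < b) (hi : i < m) : q * m + i < b * m := by
  calc q * m + i < q * m + m := by omega
    _ = (q + 1) * m := by ring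
    _ ≤ b * m := Nat.mul_le_mul_right m hq

theorem mul_add_inj {q q' m i i' : ℕ} (hi : i < m) (hi' : i' < m) (h : q * m + i = q' * m + i') :
    q = q' ∧ i = i' := by
  have hq : q = q' := by
    rcases lt_trichotomy q q' with hlt | heq | hlt
    · have := mul_add_lt hlt hi; omega
    · exact heq
    · have := mul_add_lt hlt hi'; omega
  subst hq
  exact ⟨rfl, by omega⟩

theorem trialPos_lt {n k a T : ℕ} (p : TrialIdx n k a T) :
    trialPos n k a T p < trialLen n k a T := by
  rcases p with (⟨i, l⟩ | ⟨i, t⟩) | (⟨j, i⟩ | j) <;> simp only [trialPos, trialLen]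
  · have := mul_add_lt i.2 l.2; omega
  · have := mul_add_lt t.2 i.2; omega
  · have := mul_add_lt j.2 (i.2.trans (Nat.lt_add_one n)); omega
  · have := mul_add_lt j.2 (Nat.lt_add_one n); omega

theorem trialPos_injective (n k a T : ℕ) : Function.Injective (trialPos n k a T) := by
  rintro ((⟨i, l⟩ | ⟨i, t⟩) | (⟨j, i⟩ | j)) ((⟨i', l'⟩ | ⟨i', t'⟩) | (⟨j', i'⟩ | j')) h <;>
    simp only [trialPos] at h
  · obtain ⟨h1, h2⟩ := mul_add_inj l.2 l'.2 (by omega : i.1 * a + l = i' * a + l')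
    rw [Fin.ext h1, Fin.ext h2]
  · have := mul_add_lt i.2 l.2; omega
  · have := mul_add_lt j'.2 (i'.2.trans (Nat.lt_add_one n)); omega
  · have := mul_add_lt j'.2 (Nat.lt_add_one n); omega
  · have := mul_add_lt i'.2 l'.2; omega
  · obtain ⟨h1, h2⟩ := mul_add_inj i.2 i'.2 (by omega : t.1 * n + i = t' * n + i')
    rw [Fin.ext h1, Fin.ext h2]
  · have := mul_add_lt j'.2 (i'.2.trans (Nat.lt_add_one n)); omega
  · have := mul_add_lt j'.2 (Nat.lt_add_one n); omega
  · have := mul_add_lt j.2 (i.2.trans (Nat.lt_add_one n)); omega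
  · have := mul_add_lt j.2 (i.2.trans (Nat.lt_add_one n)); omega
  · obtain ⟨h1, h2⟩ := mul_add_inj (i.2.trans (Nat.lt_add_one n))
      (i'.2.trans (Nat.lt_add_one n)) h
    rw [Fin.ext h1, Fin.ext h2]
  · have := (mul_add_inj (i.2.trans (Nat.lt_add_one n)) (Nat.lt_add_one n) h).2
    have := i.2; omega
  · have := mul_add_lt j.2 (Nat.lt_add_one n); omega
  · have := mul_add_lt j.2 (Nat.lt_add_one n); omega
  · have := (mul_add_inj (Nat.lt_add_one n) (i'.2.trans (Nat.lt_add_one n)) h).2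
    have := i'.2; omega
  · rw [Fin.ext (mul_add_inj (Nat.lt_add_one n) (Nat.lt_add_one n) h).1]

theorem coinPos_injective (n k a T k₂ N : ℕ) : Function.Injective (coinPos n k a T k₂ N) := by
  rintro (⟨j, i⟩ | ⟨q, p⟩) (⟨j', i'⟩ | ⟨q', p'⟩) h <;> simp only [coinPos] at h
  · obtain ⟨h1, h2⟩ := mul_add_inj (i.2.trans (Nat.lt_add_one n))
      (i'.2.trans (Nat.lt_add_one n)) h
    rw [Fin.ext h1, Fin.ext h2]
  · have := mul_add_lt j.2 (i.2.trans (Nat.lt_add_one n)); omega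
  · have := mul_add_lt j'.2 (i'.2.trans (Nat.lt_add_one n)); omega
  · obtain ⟨h1, h2⟩ := mul_add_inj (trialPos_lt p) (trialPos_lt p')
      (by omega : q.1 * trialLen n k a T + trialPos n k a T p = q' * _ + trialPos n k a T p')
    rw [Fin.ext h1, trialPos_injective n k a T h2]

/-- The coins of the learner, read from a sequence. -/
def readCoins (n k a T k₂ N : ℕ) (ω : ℕ → Bool) : Coins n k a T k₂ N :=
  (coinsEquiv n k a T k₂ N).symm fun c => ω (coinPos n k a T k₂ N c)

theorem coinHyp_eq {n : ℕ} (f : Cube n → ℝ) (k a T k₂ N : ℕ) (ω : ℕ → Bool) :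
    coinHyp f k a T k₂ N ω = (readCoins n k a T k₂ N ω).hyp f := by
  have hX : affPt (coinRow n ω) k₂ = affPt (ext (readCoins n k a T k₂ N ω).1) k₂ := by
    funext b
    refine affPt_congr (fun j hj => ?_) b
    rw [ext_of_lt _ (by omega : j < k₂ + 1)]
    rfl
  rw [coinHyp, Coins.hyp, hX]
  refine pursuit_congr _ _ fun q hq => ?_
  rw [Coins.cand, ext_of_lt _ hq]
  refine candSet_congr f (fun j hj => ?_) (fun j hj => ?_) (funext fun i => ?_) fun t ht => ?_
  · rw [ext_of_lt _ (by omega : j < k + 1)]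
    rfl
  · rw [ext_of_lt _ (by omega : j < k + 1)]
    rfl
  · refine bitsNum_congr fun l hl => ?_
    rw [ext_of_lt _ hl]
    rfl
  · funext i
    rw [Trial.test, ext_of_lt _ ht]
    rfl

open MeasureTheory in
theorem fairCoins_pattern {I : Type*} [Fintype I] {ι : I → ℕ} (hι : Function.Injective ι)
    (v : I → Bool) : fairCoins {ω | (fun c => ω (ι c)) = v} = (1 / 2) ^ Fintype.card I := by
  classical
  have hset : {ω : ℕ → Bool | (fun c => ω (ι c)) = v}
      = Set.pi (Finset.univ.image ι : Finset ℕ) fun p => {b | ∀ c, ι c = p → b = v c} := by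
    ext ω
    simp only [Set.mem_ofPred_eq, Set.mem_pi, Finset.mem_coe, Finset.mem_image, Finset.mem_univ,
      true_and]
    constructor
    · rintro h p - c rfl
      exact congrFun h c
    · intro h
      funext c
      exact h (ι c) ⟨c, rfl⟩ c rfl
  rw [hset, fairCoins, Measure.infinitePi_pi _ fun _ _ => MeasurableSet.of_discrete,
    Finset.prod_image hι.injOn]
  have : ∀ c, (PMF.uniformOfFintype Bool).toMeasure {b | ∀ c', ι c' = ι c → b = v c'} = 1 / 2 := by
    intro c
    have : {b | ∀ c', ι c' = ι c → b = v c'} = {v c} := by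
      ext b
      simp only [Set.mem_ofPred_eq, Set.mem_singleton_iff]
      constructor
      · intro h; exact h c rfl
      · rintro rfl c' h; rw [hι h]
    rw [this, PMF.toMeasure_apply_singleton _ _ (MeasurableSet.of_discrete)]
    simp
  simp only [this, Finset.prod_const, Finset.card_univ]

open MeasureTheory Classical in
/-- The coins of the learner are uniformly distributed. -/
theorem fairCoins_readCoins {n k a T k₂ N : ℕ} (A : Coins n k a T k₂ N → Prop) :
    fairCoins {ω | A (readCoins n k a T k₂ N ω)} = ENNReal.ofReal (pr A) := by
  set e := coinsEquiv n k a T k₂ N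
  have hset : {ω | A (readCoins n k a T k₂ N ω)}
      = ⋃ u ∈ Finset.univ.filter A, {ω | (fun c => ω (coinPos n k a T k₂ N c)) = e u} := by
    ext ω
    simp only [Set.mem_ofPred_eq, Finset.mem_filter, Finset.mem_univ, true_and, Set.mem_iUnion,
      exists_prop]
    constructor
    · intro h
      exact ⟨_, h, by simp [readCoins, e]⟩
    · rintro ⟨u, hu, h⟩
      rwa [readCoins, h, Equiv.symm_apply_apply]
  rw [hset, measure_biUnion_finset]
  · simp only [fairCoins_pattern (coinPos_injective n k a T k₂ N), Finset.sum_const, nsmul_eq_mul]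
    have hcard : (Fintype.card (Coins n k a T k₂ N) : ℝ)
        = 2 ^ Fintype.card (CoinIdx n k a T k₂ N) := by
      rw [Fintype.card_congr e, Fintype.card_fun, Fintype.card_bool]
      push_cast; rfl
    rw [pr, Fintype.expect_eq_sum_div_card, hcard, ← Finset.sum_filter, Finset.sum_const,
      nsmul_eq_mul, mul_one, ENNReal.ofReal_div_of_pos (by positivity), ENNReal.ofReal_natCast,
      ENNReal.ofReal_pow (by norm_num)]
    simp [div_eq_mul_inv, ENNReal.inv_pow]
  · intro u _ v _ huv
    refine Set.disjoint_left.2 fun ω hu hv => huv (e.injective ?_)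
    rw [Set.mem_ofPred_eq] at hu hv
    rw [← hu, ← hv]
  · intro u _
    have : Measurable fun (ω : ℕ → Bool) (c : CoinIdx n k a T k₂ N) =>
        ω (coinPos n k a T k₂ N c) := by fun_prop
    exact this (MeasurableSet.singleton (e u))

/-! ### A logic for programs -/

/-- The part of a machine state without the counter of time. -/
structure Core (n : ℕ) : Type where
  mem : ℕ → ℕ
  reg : ℕ → ℝ
  coins : ℕ
  queries : ℕ
  out : List (Finset (Fin n) × ℝ)

/-- The core of a state. -/
def State.core {n : ℕ} (s : State n) : Core n := ⟨s.mem, s.reg, s.coins, s.queries, s.out⟩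

/-- The point of the cube stored from address `a` on. -/
def pointAt {n : ℕ} (m : ℕ → ℕ) (a : ℕ) : Cube n := fun i => decide (m (a + i) ≠ 0)

/-- The effect of an instruction on the core. -/
def Instr.step {n : ℕ} (f : Cube n → ℝ) (ω : ℕ → Bool) (s : Core n) : Instr → Core n
  | .skip => s
  | .const d c => { s with mem := Function.update s.mem d c }
  | .add d a b => { s with mem := Function.update s.mem d (s.mem a + s.mem b) }
  | .sub d a b => { s with mem := Function.update s.mem d (s.mem a - s.mem b) }
  | .load d a => { s with mem := Function.update s.mem d (s.mem (s.mem a)) }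
  | .store a b => { s with mem := Function.update s.mem (s.mem a) (s.mem b) }
  | .rcast d a => { s with reg := Function.update s.reg d (s.mem a : ℝ) }
  | .radd d a b => { s with reg := Function.update s.reg d (s.reg a + s.reg b) }
  | .rsub d a b => { s with reg := Function.update s.reg d (s.reg a - s.reg b) }
  | .rmul d a b => { s with reg := Function.update s.reg d (s.reg a * s.reg b) }
  | .rdiv d a b => { s with reg := Function.update s.reg d (s.reg a / s.reg b) }
  | .rload d a => { s with reg := Function.update s.reg d (s.reg (s.mem a)) }
  | .rstore a b => { s with reg := Function.update s.reg (s.mem a) (s.reg b) }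
  | .flip d =>
      { s with mem := Function.update s.mem d (ω s.coins).toNat, coins := s.coins + 1 }
  | .query d a =>
      { s with
        reg := Function.update s.reg d (f (pointAt s.mem (s.mem a))), queries := s.queries + 1 }
  | .emit a b =>
      { s with out := (Finset.univ.filter (fun i => pointAt s.mem (s.mem a) i = true), s.reg b)
          :: s.out }

theorem Instr.core_exec {n : ℕ} (f : Cube n → ℝ) (ω : ℕ → Bool) (s : State n) (i : Instr) :
    (i.exec f ω s).core = i.step f ω s.core := by
  cases i <;> try rfl
  simp only [Instr.exec, Instr.step, State.core, State.setMem, State.tick]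
  cases ω s.coins <;> rfl

theorem Instr.time_exec_le {n : ℕ} (f : Cube n → ℝ) (ω : ℕ → Bool) (s : State n) (i : Instr) :
    (i.exec f ω s).time ≤ s.time + (n + 1) := by
  cases i <;> simp [Instr.exec, State.setMem, State.setReg, State.tick]

/-- The outcome of a test on a core. -/
def Test.on {n : ℕ} (s : Core n) : Test → Prop
  | .lt a b => s.mem a < s.mem b
  | .rlt a b => s.reg a < s.reg b

theorem Test.holds_iff {n : ℕ} (s : State n) (t : Test) : t.holds s ↔ t.on s.core := by
  cases t <;> rfl

/-- The coefficient in the time bound of a program. -/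
def Prog.coef : Prog → ℕ
  | .instr _ => 1
  | .seq p q => p.coef + q.coef
  | .ite _ p q => p.coef + q.coef + 1
  | .loop _ p => p.coef + 2

/-- The nesting depth of the loops of a program, plus one. -/
def Prog.depth : Prog → ℕ
  | .instr _ => 1
  | .seq p q => max p.depth q.depth
  | .ite _ p q => max p.depth q.depth
  | .loop _ p => p.depth + 1

/-- Started in the core `s`, the program `p` halts in a core that satisfies `Q`, within the time
that it needs if every loop is repeated at most `W` times. -/
def Runs {n : ℕ} (W : ℕ) (f : Cube n → ℝ) (ω : ℕ → Bool) (p : Prog) (s : Core n)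
    (Q : Core n → Prop) : Prop :=
  ∀ S : State n, S.core = s → ∃ S', Exec f ω p S S' ∧
    S'.time ≤ S.time + p.coef * W ^ p.depth ∧ Q S'.core

/-- Straight-line programs. -/
def block : List Instr → Prog
  | [] => .instr .skip
  | i :: l => .seq (.instr i) (block l)

/-- The effect of a straight-line program. -/
def steps {n : ℕ} (f : Cube n → ℝ) (ω : ℕ → Bool) : Core n → List Instr → Core n
  | s, [] => s
  | s, i :: l => steps f ω (i.step f ω s) l

section

variable {n W : ℕ} {f : Cube n → ℝ} {ω : ℕ → Bool} {p p' : Prog} {s : Core n}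
  {Q Q' : Core n → Prop}

theorem Runs.post (h : Runs W f ω p s Q) (hQ : ∀ s', Q s' → Q' s') : Runs W f ω p s Q' := by
  intro S hS
  obtain ⟨S', h1, h2, h3⟩ := h S hS
  exact ⟨S', h1, h2, hQ _ h3⟩

theorem Runs.seq (hW : n + 1 ≤ W) (h : Runs W f ω p s Q) (h' : ∀ s', Q s' → Runs W f ω p' s' Q') :
    Runs W f ω (.seq p p') s Q' := by
  intro S hS
  obtain ⟨S₁, h1, h2, h3⟩ := h S hS
  obtain ⟨S₂, k1, k2, k3⟩ := h' _ h3 S₁ rfl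
  have e1 : p.coef * W ^ p.depth ≤ p.coef * W ^ max p.depth p'.depth :=
    Nat.mul_le_mul_left _ (Nat.pow_le_pow_right (by omega) (le_max_left _ _))
  have e2 : p'.coef * W ^ p'.depth ≤ p'.coef * W ^ max p.depth p'.depth :=
    Nat.mul_le_mul_left _ (Nat.pow_le_pow_right (by omega) (le_max_right _ _))
  exact ⟨S₂, .seq h1 k1, by rw [Prog.coef, Prog.depth, add_mul]; omega, k3⟩

theorem Runs.instr (hW : n + 1 ≤ W) {i : Instr} (hQ : Q (i.step f ω s)) :
    Runs W f ω (.instr i) s Q := by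
  intro S hS
  refine ⟨_, .instr i S, ?_, ?_⟩
  · have := Instr.time_exec_le f ω S i
    simp only [Prog.coef, Prog.depth, pow_one]; omega
  · rw [Instr.core_exec, hS]; exact hQ

theorem Runs.block (hW : n + 1 ≤ W) {l : List Instr} (hQ : Q (steps f ω s l)) :
    Runs W f ω (block l) s Q := by
  induction l generalizing s with
  | nil => exact Runs.instr hW hQ
  | cons i l ih => exact Runs.seq hW (Runs.instr hW rfl) fun s' hs => ih (hs ▸ hQ)

theorem Runs.blockSeq (hW : n + 1 ≤ W) {l : List Instr} (h : Runs W f ω p (steps f ω s l) Q) :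
    Runs W f ω (.seq (SubmodLearn.block l) p) s Q :=
  Runs.seq hW (Runs.block hW (Q := fun s' => s' = steps f ω s l) rfl) fun _ hs => hs ▸ h

theorem Runs.ite {t : Test} (hW : n + 1 ≤ W) (h1 : t.on s → Runs W f ω p s Q)
    (h2 : ¬ t.on s → Runs W f ω p' s Q) : Runs W f ω (.ite t p p') s Q := by
  intro S hS
  have e1 : p.coef * W ^ p.depth ≤ p.coef * W ^ max p.depth p'.depth :=
    Nat.mul_le_mul_left _ (Nat.pow_le_pow_right (by omega) (le_max_left _ _))
  have e2 : p'.coef * W ^ p'.depth ≤ p'.coef * W ^ max p.depth p'.depth :=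
    Nat.mul_le_mul_left _ (Nat.pow_le_pow_right (by omega) (le_max_right _ _))
  have e3 : 1 ≤ W ^ max p.depth p'.depth := Nat.one_le_pow _ _ (by omega)
  by_cases ht : t.on s
  · obtain ⟨S', k1, k2, k3⟩ := h1 ht (S.tick 1) hS
    refine ⟨S', .ite_true ((t.holds_iff S).2 (hS ▸ ht)) k1, ?_, k3⟩
    simp only [State.tick] at k2
    rw [Prog.coef, Prog.depth, add_mul, add_mul]; omega
  · obtain ⟨S', k1, k2, k3⟩ := h2 ht (S.tick 1) hS
    refine ⟨S', .ite_false (fun h => ht (hS ▸ (t.holds_iff S).1 h)) k1, ?_, k3⟩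
    simp only [State.tick] at k2
    rw [Prog.coef, Prog.depth, add_mul, add_mul]; omega

theorem Runs.loop {t : Test} (hW : n + 1 ≤ W) {N : ℕ} (hN : N ≤ W) (I : ℕ → Core n → Prop)
    (hs : I 0 s) (hbody : ∀ j < N, ∀ s, I j s → t.on s ∧ Runs W f ω p s (I (j + 1)))
    (hend : ∀ s, I N s → ¬ t.on s) : Runs W f ω (.loop t p) s (I N) := by
  have key : ∀ r j, j + r = N → ∀ S : State n, I j S.core → ∃ S', Exec f ω (.loop t p) S S' ∧
      S'.time ≤ S.time + (r * (p.coef * W ^ p.depth + 1) + 1) ∧ I N S'.core := by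
    intro r
    induction r with
    | zero =>
      rintro j rfl S hI
      exact ⟨S.tick 1, .loop_false fun h => hend _ hI ((t.holds_iff S).1 h),
        by simp [State.tick], hI⟩
    | succ r ih =>
      intro j hj S hI
      obtain ⟨ht, hb⟩ := hbody j (by omega) _ hI
      obtain ⟨S₁, h1, h2, h3⟩ := hb (S.tick 1) rfl
      obtain ⟨S₂, k1, k2, k3⟩ := ih (j + 1) (by omega) S₁ h3
      refine ⟨S₂, .loop_true ((t.holds_iff S).2 ht) h1 k1, ?_, k3⟩
      simp only [State.tick] at h2
      rw [add_mul]; omega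
  intro S hS
  obtain ⟨S', h1, h2, h3⟩ := key N 0 (by omega) S (hS ▸ hs)
  refine ⟨S', h1, h2.trans ?_, h3⟩
  have hpos : 1 ≤ W ^ p.depth := Nat.one_le_pow _ _ (by omega)
  have : N * (p.coef * W ^ p.depth + 1) ≤ W * (p.coef * W ^ p.depth + W ^ p.depth) :=
    Nat.mul_le_mul hN (Nat.add_le_add_left hpos _)
  have h5 : (p.coef + 2) * W ^ (p.depth + 1)
      = W * (p.coef * W ^ p.depth + W ^ p.depth) + W ^ (p.depth + 1) := by ring
  have h6 : 1 ≤ W ^ (p.depth + 1) := Nat.one_le_pow _ _ (by omega)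
  rw [Prog.coef, Prog.depth]
  omega

end

/-! ### Affine point sets -/

/-- Write `M[L]` coins from address `M[22]` on, and advance `M[22]`. -/
def flipRow (L : ℕ) : Prog :=
  .seq (block [.const 20 0])
    (.loop (.lt 20 L) (block [.flip 21, .store 22 21, .add 22 22 1, .add 20 20 1]))

/-- From address `M[23]` on, write the sum modulo `2` of the vectors of length `M[8]` at the
addresses `M[24]` and `M[26]`. -/
def xorRow : Prog :=
  .loop (.lt 20 8) (block [.load 27 24, .load 28 26, .sub 29 27 28, .sub 30 28 27, .add 29 29 30,
    .store 23 29, .add 23 23 1, .add 24 24 1, .add 26 26 1, .add 20 20 1])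

section

variable {n W : ℕ} {f : Cube n → ℝ} {ω : ℕ → Bool} {m : ℕ → ℕ} {r : ℕ → ℝ} {c q : ℕ}
  {o : List (Finset (Fin n) × ℝ)}

theorem runs_flipRow (hW : n + 1 ≤ W) {L d l : ℕ} (hL : L < 20) (h1 : m 1 = 1) (hl : m L = l)
    (hlW : l ≤ W) (hd : m 22 = d) (h64 : 64 ≤ d) :
    Runs W f ω (flipRow L) ⟨m, r, c, q, o⟩ fun s => ∃ m', s = ⟨m', r, c + l, q, o⟩ ∧
      m' 22 = d + l ∧ (∀ i < l, m' (d + i) = (ω (c + i)).toNat) ∧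
      ∀ a, (a < 20 ∨ 22 < a) → (a < d ∨ d + l ≤ a) → m' a = m a := by
  refine Runs.blockSeq hW ((Runs.loop hW hlW (fun j s => ∃ m', s = ⟨m', r, c + j, q, o⟩ ∧
      m' 20 = j ∧ m' 22 = d + j ∧ (∀ i < j, m' (d + i) = (ω (c + i)).toNat) ∧
      ∀ a, (a < 20 ∨ 22 < a) → (a < d ∨ d + j ≤ a) → m' a = m a) ?_ ?_ ?_).post ?_)
  · refine ⟨_, rfl, ?_, ?_, fun i hi => by omega, fun a ha hb => ?_⟩ <;>
      simp (disch := omega) only [Function.update_self, Function.update_of_ne, hd, add_zero]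
  · rintro j hj _ ⟨m, rfl, i1, i2, i3, i4⟩
    have e1 := i4 1 (by omega) (by omega)
    have e2 := i4 L (by omega) (by omega)
    refine ⟨by simp only [Test.on]; omega, Runs.block hW ⟨_, rfl, ?_, ?_, fun i hi => ?_,
      fun a ha hb => ?_⟩⟩ <;> simp (disch := omega) only [Instr.step, Function.update_self, Function.update_of_ne, i1, i2, e1, h1, i4]
    · omega
    · rcases Nat.lt_succ_iff_lt_or_eq.1 hi with h | rfl
      · simp (disch := omega) only [Function.update_of_ne, i3]
      · simp only [Function.update_self]
  · rintro _ ⟨m, rfl, i1, i2, i3, i4⟩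
    have e2 := i4 L (by omega) (by omega)
    simp only [Test.on]; omega
  · rintro _ ⟨m, rfl, i1, i2, i3, i4⟩
    exact ⟨m, rfl, i2, i3, i4⟩

theorem toNat_xor (x y : Bool) :
    x.toNat - y.toNat + (y.toNat - x.toNat) = (x ^^ y).toNat := by
  cases x <;> cases y <;> rfl

theorem runs_xorRow (hW : n + 1 ≤ W) {D S Z l : ℕ} (h1 : m 1 = 1) (h8 : m 8 = l) (hlW : l ≤ W)
    (h20 : m 20 = 0) (h23 : m 23 = D) (h24 : m 24 = S) (h26 : m 26 = Z) (hS : 64 ≤ S)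
    (hSD : S + l ≤ D) (hZ : 64 ≤ Z) (hZD : Z + l ≤ D) {x y : ℕ → Bool}
    (hx : ∀ i < l, m (S + i) = (x i).toNat) (hy : ∀ i < l, m (Z + i) = (y i).toNat) :
    Runs W f ω xorRow ⟨m, r, c, q, o⟩ fun s => ∃ m', s = ⟨m', r, c, q, o⟩ ∧
      m' 23 = D + l ∧ m' 24 = S + l ∧ (∀ i < l, m' (D + i) = (x i ^^ y i).toNat) ∧
      ∀ a, (a < 20 ∨ a = 25 ∨ 30 < a) → (a < D ∨ D + l ≤ a) → m' a = m a := by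
  refine (Runs.loop hW hlW (fun j s => ∃ m', s = ⟨m', r, c, q, o⟩ ∧
      m' 20 = j ∧ m' 23 = D + j ∧ m' 24 = S + j ∧ m' 26 = Z + j ∧
      (∀ i < j, m' (D + i) = (x i ^^ y i).toNat) ∧
      ∀ a, (a < 20 ∨ a = 25 ∨ 30 < a) → (a < D ∨ D + j ≤ a) → m' a = m a) ?_ ?_ ?_).post ?_
  · exact ⟨m, rfl, h20, h23, h24, h26, fun i hi => by omega, fun a ha hb => rfl⟩
  · rintro j hj _ ⟨m', rfl, i1, i2, i3, i4, i5, i6⟩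
    have e1 := i6 1 (by omega) (by omega)
    have e2 := i6 8 (by omega) (by omega)
    have e3 := i6 (S + j) (by omega) (by omega)
    have e4 := i6 (Z + j) (by omega) (by omega)
    rw [hx j hj] at e3
    rw [hy j hj] at e4
    refine ⟨by simp only [Test.on]; omega, Runs.block hW ⟨_, rfl, ?_, ?_, ?_, ?_, fun i hi => ?_,
      fun a ha hb => ?_⟩⟩ <;> simp (disch := omega) only [Instr.step, Function.update_self,
        Function.update_of_ne, i1, i2, i3, i4, e1, e3, e4, h1, i6, toNat_xor]
    · omega
    · omega
    · omega
    · rcases Nat.lt_succ_iff_lt_or_eq.1 hi with h | rfl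
      · simp (disch := omega) only [Function.update_of_ne, i5]
      · simp only [Function.update_self]
  · rintro _ ⟨m', rfl, i1, i2, i3, i4, i5, i6⟩
    have e2 := i6 8 (by omega) (by omega)
    simp only [Test.on]; omega
  · rintro _ ⟨m', rfl, i1, i2, i3, i4, i5, i6⟩
    exact ⟨m', rfl, i2, i3, i5, i6⟩

end

/-- From address `M[bb]` on, write the points of a random affine map, one after the other; `M[cc]`
is their number, a power of two. -/
def genPoints (bb cc : ℕ) : Prog :=
  .seq (block [.const 36 1, .add 22 bb 18]) <| .seq (flipRow 8) <| .seq (block [.add 23 22 18]) <|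
  .loop (.lt 36 cc) <| .seq (block [.add 22 9 18]) <| .seq (flipRow 8) <|
  .seq (block [.add 24 bb 18, .const 25 0]) <|
  .seq (.loop (.lt 25 36) (.seq (block [.add 26 9 18, .const 20 0]) <| .seq xorRow <|
    block [.add 25 25 1])) <| block [.add 36 36 36]

section

variable {n W : ℕ} {f : Cube n → ℝ} {ω : ℕ → Bool} {m : ℕ → ℕ} {r : ℕ → ℝ} {c q : ℕ}
  {o : List (Finset (Fin n) × ℝ)}

theorem runs_genPoints_copy (hW : n + 1 ≤ W) {bb b l k Z c₀ : ℕ} (hbb : bb < 20) (h1 : m 1 = 1)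
    (h8 : m 8 = l) (h9 : m 9 = Z) (h18 : m 18 = 0) (hlW : l ≤ W) (hkW : 2 ^ k ≤ W)
    (hb : m bb = b) (hZ : 64 ≤ Z) (hZb : Z + l ≤ b) (h36 : m 36 = 2 ^ k)
    (h23 : m 23 = b + 2 ^ k * l) (h24 : m 24 = b) (h25 : m 25 = 0)
    (hz : ∀ i < l, m (Z + i) = (ω (c₀ + (k + 1) * l + i)).toNat)
    (hx : ∀ p < 2 ^ k, ∀ i < l, m (b + p * l + i)
      = (affBit (fun j => ω (c₀ + j * l + i)) k p).toNat) :
    Runs W f ω (.loop (.lt 25 36) (.seq (block [.add 26 9 18, .const 20 0]) <| .seq xorRow <|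
      block [.add 25 25 1])) ⟨m, r, c, q, o⟩ fun s => ∃ m', s = ⟨m', r, c, q, o⟩ ∧
      m' 23 = b + 2 ^ (k + 1) * l ∧
      (∀ p < 2 ^ (k + 1), ∀ i < l, m' (b + p * l + i)
        = (affBit (fun j => ω (c₀ + j * l + i)) (k + 1) p).toNat) ∧
      ∀ a, (a < 20 ∨ 30 < a) → a < b → m' a = m a := by
  refine (Runs.loop hW hkW (fun j s => ∃ m', s = ⟨m', r, c, q, o⟩ ∧
      m' 25 = j ∧ m' 23 = b + (2 ^ k + j) * l ∧ m' 24 = b + j * l ∧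
      (∀ p < 2 ^ k + j, ∀ i < l, m' (b + p * l + i)
        = (affBit (fun j => ω (c₀ + j * l + i)) (k + 1) p).toNat) ∧
      ∀ a, (a < 20 ∨ 30 < a) → a < b → m' a = m a) ?_ ?_ ?_).post ?_
  · refine ⟨m, rfl, h25, by simpa using h23, by simpa using h24, fun p hp i hi => ?_,
      fun a ha hb => rfl⟩
    rw [hx p hp i hi, affBit, if_pos (by omega)]
  · rintro j hj _ ⟨m', rfl, i1, i2, i3, i4, i5⟩
    have e1 := i5 1 (by omega) (by omega)
    have e8 := i5 8 (by omega) (by omega)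
    have e9 := i5 9 (by omega) (by omega)
    have e18 := i5 18 (by omega) (by omega)
    have ebb := i5 bb (by omega) (by omega)
    have e36 := i5 36 (by omega) (by omega)
    have hjl := mul_add_lt hj (show 0 < l + 1 by omega)
    have hjl' : (j + 1) * l ≤ 2 ^ k * l := Nat.mul_le_mul_right l hj
    have hadd : (2 ^ k + j) * l = 2 ^ k * l + j * l := by ring
    have hadd1 : (2 ^ k + (j + 1)) * l = 2 ^ k * l + j * l + l := by ring
    have hadd2 : (j + 1) * l = j * l + l := by ring
    refine ⟨by simp only [Test.on]; omega, Runs.blockSeq hW (Runs.seq hW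
      (runs_xorRow hW (l := l) (D := b + (2 ^ k + j) * l) (S := b + j * l) (Z := Z)
        (x := fun i => affBit (fun j => ω (c₀ + j * l + i)) k j)
        (y := fun i => ω (c₀ + (k + 1) * l + i))
        ?_ ?_ hlW ?_ ?_ ?_ ?_ ?_ ?_ ?_ ?_ ?_ ?_) ?_)⟩
    all_goals try simp (disch := omega) only [Instr.step, Function.update_self, Function.update_of_ne]
    all_goals try omega
    · intro i hi
      have h := i4 j (by omega) i hi
      rw [h, affBit, if_pos (by omega)]
    · intro i hi
      rw [i5 _ (by omega) (by omega), hz i hi]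
    · rintro _ ⟨m1, rfl, k1, k2, k3, k4⟩
      have e25 := k4 25 (by omega) (by omega)
      have e1' := k4 1 (by omega) (by omega)
      simp (disch := omega) only [Function.update_of_ne] at e25 e1'
      refine Runs.block hW ⟨_, rfl, ?_, ?_, ?_, fun p hp i hi => ?_, fun a ha hb => ?_⟩ <;>
        simp (disch := omega) only [Function.update_self, Function.update_of_ne]
      · omega
      · omega
      · omega
      · rcases (Nat.lt_succ_iff_lt_or_eq (n := 2 ^ k + j)).1 hp with h | rfl
        · have h' := mul_add_lt h hi
          rw [k4 _ (by omega) (by omega)]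
          simp (disch := omega) only [Function.update_of_ne]
          exact i4 p h i hi
        · rw [k3 i hi, affBit, if_neg (by omega), Nat.add_sub_cancel_left]
      · rw [k4 _ (by omega) (by omega)]
        simp (disch := omega) only [Function.update_of_ne, i5]
  · rintro _ ⟨m', rfl, i1, i2, i3, i4, i5⟩
    have e2 := i5 36 (by omega) (by omega)
    simp only [Test.on]; omega
  · rintro _ ⟨m', rfl, i1, i2, i3, i4, i5⟩
    have : 2 ^ (k + 1) = 2 ^ k + 2 ^ k := by ring
    rw [this]
    exact ⟨m', rfl, i2, i4, i5⟩

theorem runs_genPoints (hW : n + 1 ≤ W) {bb cc b l k Z : ℕ} (hbb : bb < 20) (hcc : cc < 20)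
    (h1 : m 1 = 1) (h8 : m 8 = l) (h9 : m 9 = Z) (h18 : m 18 = 0) (hlW : l ≤ W) (hkW : 2 ^ k ≤ W)
    (hb : m bb = b) (hk : m cc = 2 ^ k) (hZ : 64 ≤ Z) (hZb : Z + l ≤ b) :
    Runs W f ω (genPoints bb cc) ⟨m, r, c, q, o⟩ fun s => ∃ m',
      s = ⟨m', r, c + (k + 1) * l, q, o⟩ ∧
      (∀ p < 2 ^ k, ∀ i < l, m' (b + p * l + i)
        = (affBit (fun j => ω (c + j * l + i)) k p).toNat) ∧
      ∀ a, (a < 20 ∨ 36 < a) → a < b → (a < Z ∨ Z + l ≤ a) → m' a = m a := by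
  refine Runs.blockSeq hW (Runs.seq hW (runs_flipRow hW (L := 8) (d := b) (l := l) (by omega) ?_ ?_
    hlW ?_ (by omega)) ?_)
  all_goals try simp (disch := omega) only [Instr.step, Function.update_self, Function.update_of_ne]
  all_goals try omega
  rintro _ ⟨m0, rfl, a1, a2, a3⟩
  refine Runs.blockSeq hW ((Runs.loop hW (Nat.lt_two_pow_self.le.trans hkW) (fun j s => ∃ m',
    s = ⟨m', r, c + (j + 1) * l, q, o⟩ ∧ m' 36 = 2 ^ j ∧ m' 23 = b + 2 ^ j * l ∧
      (∀ p < 2 ^ j, ∀ i < l, m' (b + p * l + i)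
        = (affBit (fun j => ω (c + j * l + i)) j p).toNat) ∧
      ∀ a, (a < 20 ∨ 36 < a) → a < b → (a < Z ∨ Z + l ≤ a) → m' a = m a) ?_ ?_ ?_).post ?_)
  · have e18 := a3 18 (by omega) (by omega)
    have e36 := a3 36 (by omega) (by omega)
    simp (disch := omega) only [Function.update_self, Function.update_of_ne] at e18 e36
    refine ⟨_, by simp only [steps, Instr.step, zero_add, one_mul]; rfl, ?_, ?_, fun p hp i hi => ?_,
      fun a ha hb hz => ?_⟩
    all_goals simp (disch := omega) only [Function.update_self, Function.update_of_ne]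
    · rw [e36, pow_zero]
    · rw [a1, e18, h18, pow_zero, one_mul, add_zero]
    · obtain rfl : p = 0 := by omega
      simp only [zero_mul, add_zero, affBit]
      exact a2 i hi
    · rw [a3 a (by omega) (by omega)]
      simp (disch := omega) only [Function.update_of_ne]
  · rintro j hj _ ⟨m1, rfl, i1, i2, i3, i4⟩
    have hlt := Nat.pow_lt_pow_right one_lt_two hj
    have hle : 2 ^ j * l ≤ 2 ^ k * l := Nat.mul_le_mul_right l hlt.le
    have e1 := i4 1 (by omega) (by omega) (by omega)
    have e8 := i4 8 (by omega) (by omega) (by omega)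
    have e9 := i4 9 (by omega) (by omega) (by omega)
    have e18 := i4 18 (by omega) (by omega) (by omega)
    have ebb := i4 bb (by omega) (by omega) (by omega)
    have ecc := i4 cc (by omega) (by omega) (by omega)
    refine ⟨by simp only [Test.on]; omega, Runs.blockSeq hW (Runs.seq hW (runs_flipRow hW (L := 8)
      (d := Z) (l := l) (by omega) ?_ ?_ hlW ?_ (by omega)) ?_)⟩
    all_goals try simp (disch := omega) only [Function.update_self, Function.update_of_ne]
    all_goals try omega
    rintro _ ⟨m2, rfl, j1, j2, j3⟩
    have g : ∀ a, (a < 20 ∨ 22 < a) → (a < Z ∨ Z + l ≤ a) → m2 a = m1 a := fun a ha hb => by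
      rw [j3 a ha hb]
      simp (disch := omega) only [Function.update_of_ne]
    have g1 := g 1 (by omega) (by omega)
    have g8 := g 8 (by omega) (by omega)
    have g9 := g 9 (by omega) (by omega)
    have g18 := g 18 (by omega) (by omega)
    have gbb := g bb (by omega) (by omega)
    have g36 := g 36 (by omega) (by omega)
    have g23 := g 23 (by omega) (by omega)
    refine Runs.blockSeq hW (Runs.seq hW (runs_genPoints_copy hW (bb := bb) (b := b) (l := l)
      (k := j) (Z := Z) (c₀ := c) hbb ?_ ?_ ?_ ?_ hlW (hlt.le.trans hkW) ?_ hZ hZb ?_ ?_ ?_ ?_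
      (fun i hi => ?_) fun p hp i hi => ?_) ?_)
    all_goals try simp (disch := omega) only [Instr.step, Function.update_self, Function.update_of_ne]
    all_goals try omega
    · exact j2 i hi
    · rw [g _ (by omega) (by omega)]
      exact i3 p hp i hi
    · rintro _ ⟨m3, rfl, k1, k2, k3⟩
      have k36 := k3 36 (by omega) (by omega)
      simp (disch := omega) only [Function.update_of_ne] at k36
      refine Runs.block hW ⟨_, by simp only [steps, Instr.step, add_mul, one_mul, add_assoc]; rfl, ?_, ?_,
        fun p hp i hi => ?_, fun a ha hb hz => ?_⟩
      all_goals simp (disch := omega) only [Function.update_self, Function.update_of_ne]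
      · rw [k36, g36, i1]; ring
      · rw [k1]
      · exact k2 p hp i hi
      · rw [k3 a (by omega) (by omega)]
        simp (disch := omega) only [Function.update_of_ne]
        rw [g a (by omega) (by omega), i4 a (by omega) (by omega) (by omega)]
  · rintro _ ⟨m1, rfl, i1, i2, i3, i4⟩
    have e2 := i4 cc (by omega) (by omega) (by omega)
    simp only [Test.on]; omega
  · rintro _ ⟨m1, rfl, i1, i2, i3, i4⟩
    exact ⟨m1, rfl, i3, i4⟩

end

/-! ### Probes -/

/-- `M[26]` becomes the bit which tells whether the cell at address `M[22]` holds `M[33]`. -/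
def eqBit : Prog :=
  block [.load 25 22, .sub 26 25 33, .sub 27 33 25, .add 26 26 27, .sub 26 1 26]

/-- From address `M[24]` on, write the sum modulo `2` of the vector at `M[35]` and the restriction of
the vector at `M[23]` to the variables of colour `M[33]`. -/
def maskRow : Prog :=
  .loop (.lt 20 0) <| .seq eqBit <| block [.load 27 23, .add 26 26 27, .sub 26 26 1, .load 27 35,
    .sub 28 26 27, .sub 29 27 26, .add 28 28 29, .store 24 28, .add 22 22 1, .add 23 23 1,
    .add 24 24 1, .add 35 35 1, .add 20 20 1]

/-- Remove from the set at `M[24]` the variables of colour `M[33]` on which the vector at `M[23]`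
differs from `M[36]`. -/
def filterRow : Prog :=
  .loop (.lt 20 0) <| .seq eqBit <| block [.load 27 23, .sub 28 27 36, .sub 29 36 27, .add 28 28 29,
    .add 26 26 28, .sub 26 26 1, .load 27 24, .sub 27 27 26, .store 24 27, .add 22 22 1,
    .add 23 23 1, .add 24 24 1, .add 20 20 1]

section

variable {n W : ℕ} {f : Cube n → ℝ} {ω : ℕ → Bool} {m : ℕ → ℕ} {r : ℕ → ℝ} {c q : ℕ}
  {o : List (Finset (Fin n) × ℝ)}

theorem one_sub_dist (x y : ℕ) : 1 - (x - y + (y - x)) = (decide (x = y)).toNat := by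
  by_cases h : x = y
  · simp [h]
  · rw [decide_eq_false h]
    simp only [Bool.toNat_false]; omega

theorem toNat_and (x y : Bool) : x.toNat + y.toNat - 1 = (x && y).toNat := by
  cases x <;> cases y <;> rfl

theorem toNat_and_not (x y : Bool) : x.toNat - y.toNat = (x && !y).toNat := by
  cases x <;> cases y <;> rfl

theorem runs_eqBit (hW : n + 1 ≤ W) {C x w : ℕ} (h1 : m 1 = 1) (h22 : m 22 = C)
    (hx : m C = x) (hw : m 33 = w) :
    Runs W f ω eqBit ⟨m, r, c, q, o⟩ fun s => ∃ m', s = ⟨m', r, c, q, o⟩ ∧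
      m' 26 = (decide (x = w)).toNat ∧ ∀ a, (a < 25 ∨ 27 < a) → m' a = m a := by
  refine Runs.block hW ⟨_, rfl, ?_, fun a ha => ?_⟩
  · simp (disch := omega) only [Instr.step, Function.update_self, Function.update_of_ne, h22, hw, h1,
      hx, one_sub_dist]
  · simp (disch := omega) only [Instr.step, Function.update_of_ne]

theorem runs_maskRow (hW : n + 1 ≤ W) {B P Y C w : ℕ} (h0 : m 0 = n) (h1 : m 1 = 1)
    (h20 : m 20 = 0) (h22 : m 22 = C) (h23 : m 23 = Y) (h24 : m 24 = B) (h35 : m 35 = P)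
    (h33 : m 33 = w) (hC : 64 ≤ C) (hY : 64 ≤ Y) (hB : 64 ≤ B) (hP : 64 ≤ P)
    (hCB : C + n ≤ B) (hYB : Y + n ≤ B) (hPB : B + n ≤ P) {col : Fin n → ℕ} {x y : Cube n}
    (hcol : ∀ i : Fin n, m (C + i) = col i) (hx : ∀ i : Fin n, m (P + i) = (x i).toNat)
    (hy : ∀ i : Fin n, m (Y + i) = (y i).toNat) :
    Runs W f ω maskRow ⟨m, r, c, q, o⟩ fun s => ∃ m', s = ⟨m', r, c, q, o⟩ ∧
      m' 35 = P + n ∧ pointAt m' B = bxor x (mask y col w) ∧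
      ∀ a, (a < 20 ∨ 29 < a) → a ≠ 35 → (a < B ∨ B + n ≤ a) → m' a = m a := by
  refine (Runs.loop hW (N := n) (by omega) (fun j s => ∃ m', s = ⟨m', r, c, q, o⟩ ∧
      m' 20 = j ∧ m' 22 = C + j ∧ m' 23 = Y + j ∧ m' 24 = B + j ∧ m' 35 = P + j ∧
      (∀ i : Fin n, i < j → m' (B + i) = (mask y col w i ^^ x i).toNat) ∧
      ∀ a, (a < 20 ∨ 29 < a) → a ≠ 35 → (a < B ∨ B + n ≤ a) → m' a = m a) ?_ ?_ ?_).post ?_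
  · exact ⟨m, rfl, h20, h22, h23, h24, h35, fun i hi => by omega, fun a _ _ _ => rfl⟩
  · rintro j hj _ ⟨m', rfl, i1, i2, i3, i4, i5, i6, i7⟩
    have e0 := i7 0 (by omega) (by omega) (by omega)
    have e1 := i7 1 (by omega) (by omega) (by omega)
    have e33 := i7 33 (by omega) (by omega) (by omega)
    have eC := i7 (C + j) (by omega) (by omega) (by omega)
    have eY := i7 (Y + j) (by omega) (by omega) (by omega)
    have eP := i7 (P + j) (by omega) (by omega) (by omega)
    rw [hcol ⟨j, hj⟩] at eC
    rw [hy ⟨j, hj⟩] at eY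
    rw [hx ⟨j, hj⟩] at eP
    refine ⟨by simp only [Test.on]; omega, Runs.seq hW (runs_eqBit hW (C := C + j) (w := w)
      (by omega) (by omega) eC (by omega)) ?_⟩
    rintro _ ⟨m2, rfl, k1, k2⟩
    refine Runs.block hW ⟨_, rfl, ?_, ?_, ?_, ?_, ?_, fun i hi => ?_, fun a ha hb hc => ?_⟩ <;>
      simp (disch := omega) only [Instr.step, Function.update_self,
        Function.update_of_ne, k1, k2, i1, i2, i3, i4, i5, e1, h1, eY, eP, i7, toNat_xor, toNat_and]
    · omega
    · omega
    · omega
    · omega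
    · rcases Nat.lt_succ_iff_lt_or_eq.1 hi with h | h
      · simp (disch := omega) only [Function.update_of_ne, k2, i6]
      · subst h
        simp only [Function.update_self, mask, Fin.eta, Bool.and_comm]
  · rintro _ ⟨m', rfl, i1, i2, i3, i4, i5, i6, i7⟩
    have e2 := i7 0 (by omega) (by omega) (by omega)
    simp only [Test.on]; omega
  · rintro _ ⟨m', rfl, i1, i2, i3, i4, i5, i6, i7⟩
    refine ⟨m', rfl, i5, ?_, i7⟩
    funext i
    rw [pointAt, i6 i i.2, bxor, Bool.xor_comm]
    cases x i ^^ mask y col w i <;> rfl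

theorem runs_filterRow (hW : n + 1 ≤ W) {S Y C w : ℕ} (h0 : m 0 = n) (h1 : m 1 = 1)
    (h20 : m 20 = 0) (h22 : m 22 = C) (h23 : m 23 = Y) (h24 : m 24 = S)
    (h33 : m 33 = w) {b : Bool} (h36 : m 36 = b.toNat) (hC : 64 ≤ C) (hY : 64 ≤ Y) (hS : 64 ≤ S)
    (hSC : S + n ≤ C) (hSY : S + n ≤ Y) {col : Fin n → ℕ} {y t : Cube n}
    (hcol : ∀ i : Fin n, m (C + i) = col i) (ht : ∀ i : Fin n, m (S + i) = (t i).toNat)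
    (hy : ∀ i : Fin n, m (Y + i) = (y i).toNat) :
    Runs W f ω filterRow ⟨m, r, c, q, o⟩ fun s => ∃ m', s = ⟨m', r, c, q, o⟩ ∧
      (∀ i : Fin n, m' (S + i) = (t i && !(decide (col i = w) && (y i ^^ b))).toNat) ∧
      ∀ a, (a < 20 ∨ 29 < a) → (a < S ∨ S + n ≤ a) → m' a = m a := by
  refine (Runs.loop hW (N := n) (by omega) (fun j s => ∃ m', s = ⟨m', r, c, q, o⟩ ∧
      m' 20 = j ∧ m' 22 = C + j ∧ m' 23 = Y + j ∧ m' 24 = S + j ∧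
      (∀ i : Fin n, i < j → m' (S + i) = (t i && !(decide (col i = w) && (y i ^^ b))).toNat) ∧
      ∀ a, (a < 20 ∨ 29 < a) → (a < S ∨ S + j ≤ a) → m' a = m a) ?_ ?_ ?_).post ?_
  · exact ⟨m, rfl, h20, h22, h23, h24, fun i hi => by omega, fun a _ _ => rfl⟩
  · rintro j hj _ ⟨m', rfl, i1, i2, i3, i4, i6, i7⟩
    have e0 := i7 0 (by omega) (by omega)
    have e1 := i7 1 (by omega) (by omega)
    have e33 := i7 33 (by omega) (by omega)
    have e36 := i7 36 (by omega) (by omega)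
    have eC := i7 (C + j) (by omega) (by omega)
    have eY := i7 (Y + j) (by omega) (by omega)
    have eS := i7 (S + j) (by omega) (by omega)
    rw [hcol ⟨j, hj⟩] at eC
    rw [hy ⟨j, hj⟩] at eY
    rw [ht ⟨j, hj⟩] at eS
    refine ⟨by simp only [Test.on]; omega, Runs.seq hW (runs_eqBit hW (C := C + j) (w := w)
      (by omega) (by omega) eC (by omega)) ?_⟩
    rintro _ ⟨m2, rfl, k1, k2⟩
    refine Runs.block hW ⟨_, rfl, ?_, ?_, ?_, ?_, fun i hi => ?_, fun a ha hb => ?_⟩ <;>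
      simp (disch := omega) only [Instr.step, Function.update_self, Function.update_of_ne, k1, k2,
        i1, i2, i3, i4, e1, h1, eY, eS, e36, h36, i7, toNat_xor, toNat_and]
    · omega
    · omega
    · omega
    · rcases Nat.lt_succ_iff_lt_or_eq.1 hi with h | h
      · simp (disch := omega) only [Function.update_of_ne, k2, i6]
      · subst h
        simp only [Function.update_self, Fin.eta, toNat_and_not]
  · rintro _ ⟨m', rfl, i1, i2, i3, i4, i6, i7⟩
    have e2 := i7 0 (by omega) (by omega)
    simp only [Test.on]; omega
  · rintro _ ⟨m', rfl, i1, i2, i3, i4, i6, i7⟩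
    exact ⟨m', rfl, fun i => i6 i i.2, i7⟩

end

/-- `M[36]` becomes the decoded value of the parity of the restriction of the vector at `M[12]` to
the variables of colour `M[33]`. -/
def probe : Prog :=
  .seq (block [.rsub 5 5 5, .const 34 0, .add 35 15 18]) <|
  .seq (.loop (.lt 34 17) <| .seq (block [.const 20 0, .add 22 11 18, .add 23 12 18, .add 24 13 18])
    <| .seq maskRow <| block [.query 4 13, .load 21 35, .rcast 6 21, .radd 6 6 6, .rsub 6 2 6,
      .rmul 4 4 6, .radd 5 5 4, .add 35 35 1, .add 34 34 1]) <|
  .ite (.rlt 5 1) (block [.const 36 1]) (block [.const 36 0])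

/-- The constants that the learner keeps in its memory. -/
structure Layout (n T A N a k k₂ : ℕ) (m : ℕ → ℕ) : Prop where
  m0 : m 0 = n
  m1 : m 1 = 1
  m2 : m 2 = T
  m4 : m 4 = N
  m5 : m 5 = A
  m6 : m 6 = a
  m8 : m 8 = n + 1
  m9 : m 9 = 64
  m10 : m 10 = 65 + n
  m11 : m 11 = 65 + 2 * n
  m12 : m 12 = 65 + 3 * n
  m13 : m 13 = 65 + 4 * n
  m14 : m 14 = 65 + 5 * n
  m15 : m 15 = 65 + 5 * n + 2 ^ k₂ * (n + 1)
  m16 : m 16 = 2 ^ k₂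
  m17 : m 17 = 2 ^ k
  m18 : m 18 = 0

theorem Layout.congr {n T A N a k k₂ : ℕ} {m m' : ℕ → ℕ} (h : Layout n T A N a k k₂ m)
    (hm : ∀ i < 20, m' i = m i) : Layout n T A N a k k₂ m' := by
  constructor <;> rw [hm _ (by omega)]
  exacts [h.m0, h.m1, h.m2, h.m4, h.m5, h.m6, h.m8, h.m9, h.m10, h.m11, h.m12, h.m13, h.m14, h.m15,
    h.m16, h.m17, h.m18]

theorem one_sub_toNat_add (b : Bool) : (1 : ℝ) - ((b.toNat : ℝ) + b.toNat) = sgn b := by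
  cases b <;> norm_num

section

variable {n W : ℕ} {f : Cube n → ℝ} {ω : ℕ → Bool} {m : ℕ → ℕ} {r : ℕ → ℝ} {c q : ℕ}
  {o : List (Finset (Fin n) × ℝ)} {T A N a k k₂ : ℕ}

theorem runs_probe (hW : n + 1 ≤ W) (hkW : 2 ^ k ≤ W) (hL : Layout n T A N a k k₂ m) (hr1 : r 1 = 0)
    (hr2 : r 2 = 1) {w : ℕ} (h33 : m 33 = w) {col : Fin n → ℕ} {y : Cube n} {z : ℕ → Cube n}
    {g : ℕ → Bool} (hcol : ∀ i : Fin n, m (65 + 2 * n + i) = col i)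
    (hy : ∀ i : Fin n, m (65 + 3 * n + i) = (y i).toNat)
    (hz : ∀ p < 2 ^ k, ∀ i : Fin n, m (65 + 5 * n + 2 ^ k₂ * (n + 1) + p * (n + 1) + i)
      = (affPt z k p i).toNat)
    (hg : ∀ p < 2 ^ k, m (65 + 5 * n + 2 ^ k₂ * (n + 1) + p * (n + 1) + n)
      = (affBit g k p).toNat) :
    Runs W f ω probe ⟨m, r, c, q, o⟩ fun s => ∃ m' r', s = ⟨m', r', c, q + 2 ^ k, o⟩ ∧
      m' 36 = (probeBit f k z g (mask y col w)).toNat ∧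
      (∀ a, (a < 20 ∨ 29 < a) → (a < 34 ∨ 36 < a) → (a < 65 + 4 * n ∨ 65 + 5 * n ≤ a) →
        m' a = m a) ∧ ∀ a, (a < 4 ∨ 7 < a) → r' a = r a := by
  refine Runs.blockSeq hW (Runs.seq hW (Runs.loop hW hkW (fun j s => ∃ m' r',
      s = ⟨m', r', c, q + j, o⟩ ∧ m' 34 = j ∧
      m' 35 = 65 + 5 * n + 2 ^ k₂ * (n + 1) + j * (n + 1) ∧
      r' 5 = ∑ b ∈ Finset.range j, f (bxor (affPt z k b) (mask y col w)) * sgn (affBit g k b) ∧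
      (∀ a, (a < 20 ∨ 29 < a) → (a < 34 ∨ 36 < a) → (a < 65 + 4 * n ∨ 65 + 5 * n ≤ a) →
        m' a = m a) ∧ ∀ a, (a < 4 ∨ 7 < a) → r' a = r a) ?_ ?_ ?_) ?_)
  · refine ⟨_, _, rfl, ?_, ?_, ?_, fun a ha hb hc => ?_, fun a ha => ?_⟩ <;>
      simp (disch := omega) only [Instr.step, Function.update_self, Function.update_of_ne, hL.m15,
        hL.m18, sub_self, Finset.range_zero, Finset.sum_empty, zero_mul, add_zero]
  · rintro j hj _ ⟨m', r', rfl, i1, i2, i3, i4, i5⟩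
    have hL' := hL.congr fun a ha => i4 a (by omega) (by omega) (by omega)
    have e33 := i4 33 (by omega) (by omega) (by omega)
    have l0 := hL'.m0
    have l1 := hL'.m1
    have l11 := hL'.m11
    have l12 := hL'.m12
    have l13 := hL'.m13
    have l17 := hL'.m17
    have l18 := hL'.m18
    refine ⟨by simp only [Test.on]; omega, Runs.blockSeq hW (Runs.seq hW (runs_maskRow hW
      (B := 65 + 4 * n) (P := 65 + 5 * n + 2 ^ k₂ * (n + 1) + j * (n + 1)) (Y := 65 + 3 * n)
      (C := 65 + 2 * n) (w := w) (col := col) (x := affPt z k j) (y := y) ?_ ?_ ?_ ?_ ?_ ?_ ?_ ?_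
      (by omega) (by omega) (by omega) (by omega) (by omega) (by omega) (by omega)
      (fun i => ?_) (fun i => ?_) (fun i => ?_)) ?_)⟩
    all_goals try simp (disch := omega) only [Instr.step, Function.update_self,
      Function.update_of_ne]
    all_goals try omega
    all_goals try simp (disch := omega) only [i4, hcol, hy, hz j hj]
    rintro _ ⟨m2, rfl, k1, k2, k3⟩
    have g1 := k3 1 (by omega) (by omega) (by omega)
    have g13 := k3 13 (by omega) (by omega) (by omega)
    have g34 := k3 34 (by omega) (by omega) (by omega)
    have gP := k3 (65 + 5 * n + 2 ^ k₂ * (n + 1) + j * (n + 1) + n) (by omega) (by omega) (by omega)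
    simp (disch := omega) only [Function.update_of_ne, l1, l13, i1, i4, hg j hj] at g1 g13 g34 gP
    refine Runs.block hW ⟨_, _, rfl, ?_, ?_, ?_, fun a ha hb hc => ?_, fun a ha => ?_⟩ <;>
      simp (disch := omega) only [Instr.step, Function.update_self, Function.update_of_ne, g1, g13,
        g34, k1, i3, k2, gP, i5, hr2, one_sub_toNat_add, Finset.sum_range_succ]
    · ring
    rw [k3 a (by omega) (by omega) (by omega)]
    simp (disch := omega) only [Function.update_of_ne, i4]
  · rintro _ ⟨m', r', rfl, i1, i2, i3, i4, i5⟩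
    have e17 := i4 17 (by omega) (by omega) (by omega)
    rw [hL.m17] at e17
    simp only [Test.on]; omega
  · rintro _ ⟨m', r', rfl, i1, i2, i3, i4, i5⟩
    have e1 := i5 1 (by omega)
    rw [hr1] at e1
    refine Runs.ite hW (fun h => Runs.block hW ⟨_, _, rfl, ?_, fun a ha hb hc => ?_, i5⟩)
      fun h => Runs.block hW ⟨_, _, rfl, ?_, fun a ha hb hc => ?_, i5⟩
    all_goals simp only [Test.on, e1, i3] at h
    · rw [probeBit, probeSum, decide_eq_true h]
      simp only [Function.update_self, Bool.toNat_true]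
    · simp (disch := omega) only [Function.update_of_ne, i4]
    · rw [probeBit, probeSum, decide_eq_false h]
      simp only [Function.update_self, Bool.toNat_false]
    · simp (disch := omega) only [Function.update_of_ne, i4]

end

/-! ### Candidates -/

/-- `M[21]` becomes the number whose `M[6]` binary digits are coins. -/
def flipNum : Prog :=
  .seq (block [.const 20 0, .const 21 0]) <|
  .loop (.lt 20 6) <| block [.flip 22, .add 21 21 21, .add 21 21 22, .add 20 20 1]

/-- Choose the colours of the variables, and initialize the candidate. -/
def colours : Prog :=
  .seq (block [.const 32 0, .add 33 11 18, .add 34 10 18]) <| .loop (.lt 32 0) <| .seq flipNum <|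
  block [.store 33 21, .store 34 1, .add 33 33 1, .add 34 34 1, .add 32 32 1]

/-- Compare the test vector with its probes. -/
def compareAll : Prog :=
  .loop (.lt 33 5) <| .seq probe <|
  .seq (block [.const 20 0, .add 22 11 18, .add 23 12 18, .add 24 10 18]) <|
  .seq filterRow <| block [.add 33 33 1]

/-- Draw the test vectors, and compute the candidate. -/
def tests : Prog :=
  .seq (block [.const 32 0]) <| .loop (.lt 32 2) <| .seq (block [.add 22 12 18]) <|
  .seq (flipRow 0) <| .seq (block [.const 33 0]) <| .seq compareAll <| block [.add 32 32 1]

section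

variable {n W : ℕ} {f : Cube n → ℝ} {ω : ℕ → Bool} {m : ℕ → ℕ} {r : ℕ → ℝ} {c q : ℕ}
  {o : List (Finset (Fin n) × ℝ)} {T A N a k k₂ : ℕ}

theorem runs_flipNum (hW : n + 1 ≤ W) (haW : a ≤ W) (h1 : m 1 = 1) (h6 : m 6 = a) :
    Runs W f ω flipNum ⟨m, r, c, q, o⟩ fun s => ∃ m', s = ⟨m', r, c + a, q, o⟩ ∧
      m' 21 = bitsNum (fun l => ω (c + l)) a ∧ ∀ b, (b < 20 ∨ 22 < b) → m' b = m b := by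
  refine Runs.blockSeq hW ((Runs.loop hW haW (fun l s => ∃ m', s = ⟨m', r, c + l, q, o⟩ ∧
    m' 20 = l ∧ m' 21 = bitsNum (fun l => ω (c + l)) l ∧
    ∀ b, (b < 20 ∨ 22 < b) → m' b = m b) ?_ ?_ ?_).post ?_)
  · refine ⟨_, rfl, ?_, ?_, fun a ha => ?_⟩ <;>
      simp (disch := omega) only [Function.update_self, Function.update_of_ne, Instr.step, bitsNum]
  · rintro l hl _ ⟨m2, rfl, k1, k2, k3⟩
    have g1 := k3 1 (by omega)
    have g6 := k3 6 (by omega)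
    refine ⟨by simp only [Test.on]; omega, Runs.block hW ⟨_, rfl, ?_, ?_, fun a ha => ?_⟩⟩ <;>
      simp (disch := omega) only [Function.update_self, Function.update_of_ne, Instr.step, bitsNum,
        k1, k2, g1, h1, k3]
    omega
  · rintro _ ⟨m2, rfl, k1, k2, k3⟩
    have g6 := k3 6 (by omega)
    simp only [Test.on]; omega
  · rintro _ ⟨m2, rfl, k1, k2, k3⟩
    exact ⟨m2, rfl, k2, k3⟩

theorem runs_colours (hW : n + 1 ≤ W) (haW : a ≤ W) (hL : Layout n T A N a k k₂ m) :
    Runs W f ω colours ⟨m, r, c, q, o⟩ fun s => ∃ m', s = ⟨m', r, c + n * a, q, o⟩ ∧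
      (∀ i < n, m' (65 + n + i) = 1) ∧
      (∀ i < n, m' (65 + 2 * n + i) = bitsNum (fun l => ω (c + i * a + l)) a) ∧
      ∀ b, (b < 20 ∨ 34 < b) → (b < 65 + n ∨ 65 + 3 * n ≤ b) → m' b = m b := by
  refine Runs.blockSeq hW ((Runs.loop hW (show n ≤ W by omega) (fun j s => ∃ m',
    s = ⟨m', r, c + j * a, q, o⟩ ∧ m' 32 = j ∧ m' 33 = 65 + 2 * n + j ∧ m' 34 = 65 + n + j ∧
      (∀ i < j, m' (65 + n + i) = 1) ∧
      (∀ i < j, m' (65 + 2 * n + i) = bitsNum (fun l => ω (c + i * a + l)) a) ∧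
      ∀ b, (b < 20 ∨ 34 < b) → (b < 65 + n ∨ 65 + 3 * n ≤ b) → m' b = m b) ?_ ?_ ?_).post ?_)
  · refine ⟨_, by simp only [steps, Instr.step, zero_mul, add_zero]; rfl, ?_, ?_, ?_,
      fun i hi => by omega, fun i hi => by omega, fun a ha hb => ?_⟩ <;>
      simp (disch := omega) only [Function.update_self, Function.update_of_ne, hL.m10,
        hL.m11, hL.m18, add_zero]
  · rintro j hj _ ⟨m', rfl, i1, i2, i3, i4, i5, i6⟩
    have hL' := hL.congr fun b hb => i6 b (by omega) (by omega)
    refine ⟨by simp only [Test.on, i1, hL'.m0]; omega,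
      Runs.seq hW (runs_flipNum hW haW hL'.m1 hL'.m6) ?_⟩
    rintro _ ⟨m2, rfl, k2, k3⟩
    have g1 := k3 1 (by omega)
    have g32 := k3 32 (by omega)
    have g33 := k3 33 (by omega)
    have g34 := k3 34 (by omega)
    rw [hL'.m1] at g1
    rw [i1] at g32
    rw [i2] at g33
    rw [i3] at g34
    clear i1 i2 i3
    refine Runs.block hW ⟨_, by simp only [steps, Instr.step, add_mul, one_mul, add_assoc]; rfl,
      ?_, ?_, ?_, fun i hi => ?_, fun i hi => ?_, fun b hb hc => ?_⟩ <;>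
      simp (disch := omega) only [Function.update_self, Function.update_of_ne, g33, g34, g32, g1]
    · omega
    · omega
    · rcases Nat.lt_succ_iff_lt_or_eq.1 hi with h | rfl
      · simp (disch := omega) only [Function.update_of_ne, k3, i4]
      · simp only [Function.update_self]
    · rcases Nat.lt_succ_iff_lt_or_eq.1 hi with h | rfl
      · simp (disch := omega) only [Function.update_of_ne, k3, i5]
      · simp only [Function.update_self, k2]
    · rw [k3 b (by omega), i6 b hb (by omega)]
  · rintro _ ⟨m', rfl, i1, i2, i3, i4, i5, i6⟩
    have e0 := i6 0 (by omega) (by omega)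
    rw [hL.m0] at e0
    simp only [Test.on]; omega
  · rintro _ ⟨m', rfl, i1, i2, i3, i4, i5, i6⟩
    exact ⟨m', rfl, i4, i5, i6⟩

/-- The table of the points and signs for the probes is in memory. -/
def Table (k k₂ : ℕ) (z : ℕ → Cube n) (g : ℕ → Bool) (m : ℕ → ℕ) : Prop :=
  ∀ p < 2 ^ k,
    (∀ i : Fin n, m (65 + 5 * n + 2 ^ k₂ * (n + 1) + p * (n + 1) + i) = (affPt z k p i).toNat) ∧
    m (65 + 5 * n + 2 ^ k₂ * (n + 1) + p * (n + 1) + n) = (affBit g k p).toNat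

theorem Table.congr {z : ℕ → Cube n} {g : ℕ → Bool} {m m' : ℕ → ℕ} (h : Table k k₂ z g m)
    (hm : ∀ b, 65 + 5 * n ≤ b → m' b = m b) : Table k k₂ z g m' := fun p hp =>
  ⟨fun i => by rw [hm _ (by omega), (h p hp).1 i], by rw [hm _ (by omega), (h p hp).2]⟩

theorem runs_compareAll (hW : n + 1 ≤ W) (hkW : 2 ^ k ≤ W) (hAW : A ≤ W)
    (hL : Layout n T A N a k k₂ m) (hr1 : r 1 = 0) (hr2 : r 2 = 1) (h33 : m 33 = 0)
    {col : Fin n → ℕ} {y t : Cube n} {z : ℕ → Cube n} {g : ℕ → Bool}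
    (hcol : ∀ i : Fin n, m (65 + 2 * n + i) = col i) (hcolA : ∀ i, col i < A)
    (hy : ∀ i : Fin n, m (65 + 3 * n + i) = (y i).toNat) (hz : Table k k₂ z g m)
    (ht : ∀ i : Fin n, m (65 + n + i) = (t i).toNat) :
    Runs W f ω compareAll ⟨m, r, c, q, o⟩ fun s => ∃ m' r', s = ⟨m', r', c, q + A * 2 ^ k, o⟩ ∧
      (∀ i : Fin n, m' (65 + n + i)
        = (t i && !(y i ^^ probeBit f k z g (mask y col (col i)))).toNat) ∧
      (∀ b, (b < 20 ∨ 29 < b) → (b < 33 ∨ 36 < b) → (b < 65 + n ∨ 65 + 2 * n ≤ b) →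
        (b < 65 + 4 * n ∨ 65 + 5 * n ≤ b) → m' b = m b) ∧ ∀ b, (b < 4 ∨ 7 < b) → r' b = r b := by
  refine (Runs.loop hW hAW (fun j s => ∃ m' r', s = ⟨m', r', c, q + j * 2 ^ k, o⟩ ∧ m' 33 = j ∧
      (∀ i : Fin n, m' (65 + n + i) = (t i && !(decide (col i < j) &&
        (y i ^^ probeBit f k z g (mask y col (col i))))).toNat) ∧
      (∀ b, (b < 20 ∨ 29 < b) → (b < 33 ∨ 36 < b) → (b < 65 + n ∨ 65 + 2 * n ≤ b) →
        (b < 65 + 4 * n ∨ 65 + 5 * n ≤ b) → m' b = m b) ∧ ∀ b, (b < 4 ∨ 7 < b) → r' b = r b)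
    ?_ ?_ ?_).post ?_
  · exact ⟨m, r, by simp only [zero_mul, add_zero], h33, fun i => by simp [ht i],
      fun _ _ _ _ _ => rfl, fun _ _ => rfl⟩
  · rintro j hj _ ⟨m1, r1, rfl, i1, i2, i3, i4⟩
    have hL1 := hL.congr fun b hb => i3 b (by omega) (by omega) (by omega) (by omega)
    have hz1 := hz.congr fun b hb => i3 b (by omega) (by omega) (by omega) (by omega)
    have l5 := hL1.m5
    refine ⟨by simp only [Test.on]; omega, Runs.seq hW (runs_probe hW hkW hL1 (col := col) (y := y)
      (by rw [i4 1 (by omega), hr1]) (by rw [i4 2 (by omega), hr2]) i1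
      (fun i => by rw [i3 _ (by omega) (by omega) (by omega) (by omega)]; exact hcol i)
      (fun i => by rw [i3 _ (by omega) (by omega) (by omega) (by omega)]; exact hy i)
      (fun p hp => (hz1 p hp).1) (fun p hp => (hz1 p hp).2)) ?_⟩
    rintro _ ⟨m2, r2, rfl, k1, k2, k3⟩
    have hL2 := hL1.congr fun b hb => k2 b (by omega) (by omega) (by omega)
    have l0 := hL2.m0
    have l1 := hL2.m1
    have l10 := hL2.m10
    have l11 := hL2.m11
    have l12 := hL2.m12
    have l18 := hL2.m18
    have e33 := k2 33 (by omega) (by omega) (by omega)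
    refine Runs.blockSeq hW (Runs.seq hW (runs_filterRow hW (S := 65 + n) (Y := 65 + 3 * n)
      (C := 65 + 2 * n) (w := j) (b := probeBit f k z g (mask y col j)) (col := col) (y := y)
      (t := fun i => t i && !(decide (col i < j) && (y i ^^ probeBit f k z g (mask y col (col i)))))
      ?_ ?_ ?_ ?_ ?_ ?_ ?_ ?_ (by omega) (by omega) (by omega) (by omega) (by omega)
      (fun i => ?_) (fun i => ?_) (fun i => ?_)) ?_)
    all_goals try simp (disch := omega) only [Instr.step, Function.update_self,
      Function.update_of_ne]
    all_goals try omega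
    · rw [k2 _ (by omega) (by omega) (by omega), i3 _ (by omega) (by omega) (by omega) (by omega),
        hcol i]
    · rw [k2 _ (by omega) (by omega) (by omega), i2 i]
    · rw [k2 _ (by omega) (by omega) (by omega), i3 _ (by omega) (by omega) (by omega) (by omega),
        hy i]
    rintro _ ⟨m3, rfl, g1, g2⟩
    refine Runs.block hW ⟨_, _, by simp only [steps, Instr.step, add_mul, one_mul, add_assoc]; rfl,
        ?_, fun i => ?_, fun b hb hc hd he => ?_, fun b hb => ?_⟩ <;>
        simp (disch := omega) only [Function.update_self, Function.update_of_ne, k3, i4]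
    · rw [g2 _ (by omega) (by omega), g2 _ (by omega) (by omega)]
      simp (disch := omega) only [Function.update_of_ne]
      omega
    · rw [g1 i]
      congr 1
      rcases lt_trichotomy (col i) j with h | h | h
      · simp [h, h.ne, Nat.lt_succ_of_lt h]
      · subst h; simp
      · simp [h.ne', h.not_gt, (show ¬ col i < j + 1 by omega)]
    · rw [g2 _ (by omega) (by omega)]
      simp (disch := omega) only [Function.update_of_ne, k2, i3]
  · rintro _ ⟨m1, r1, rfl, i1, i2, i3, i4⟩
    have e5 := i3 5 (by omega) (by omega) (by omega) (by omega)
    rw [hL.m5] at e5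
    simp only [Test.on]; omega
  · rintro _ ⟨m1, r1, rfl, i1, i2, i3, i4⟩
    refine ⟨m1, r1, rfl, fun i => ?_, i3, i4⟩
    rw [i2 i]
    simp [hcolA i]

theorem runs_tests (hW : n + 1 ≤ W) (hkW : 2 ^ k ≤ W) (hAW : A ≤ W) (hTW : T ≤ W)
    (hL : Layout n T A N a k k₂ m) (hr1 : r 1 = 0) (hr2 : r 2 = 1)
    {col : Fin n → ℕ} {z : ℕ → Cube n} {g : ℕ → Bool}
    (hcol : ∀ i : Fin n, m (65 + 2 * n + i) = col i) (hcolA : ∀ i, col i < A)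
    (hz : Table k k₂ z g m) (ht : ∀ i : Fin n, m (65 + n + i) = 1) :
    Runs W f ω tests ⟨m, r, c, q, o⟩ fun s => ∃ m' r',
      s = ⟨m', r', c + T * n, q + T * (A * 2 ^ k), o⟩ ∧
      (∀ i : Fin n, m' (65 + n + i)
        = (decide (i ∈ candSet f k T z g col fun t i => ω (c + t * n + i))).toNat) ∧
      (∀ b, (b < 20 ∨ 36 < b) → (b < 65 + n ∨ 65 + 5 * n ≤ b) → m' b = m b) ∧
      ∀ b, (b < 4 ∨ 7 < b) → r' b = r b := by
  refine Runs.blockSeq hW ((Runs.loop hW hTW (fun j s => ∃ m' r',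
      s = ⟨m', r', c + j * n, q + j * (A * 2 ^ k), o⟩ ∧ m' 32 = j ∧
      (∀ i : Fin n, m' (65 + 2 * n + i) = col i) ∧
      (∀ i : Fin n, m' (65 + n + i)
        = (decide (i ∈ candSet f k j z g col fun t i => ω (c + t * n + i))).toNat) ∧
      (∀ b, (b < 20 ∨ 36 < b) → (b < 65 + n ∨ 65 + 5 * n ≤ b) → m' b = m b) ∧
      ∀ b, (b < 4 ∨ 7 < b) → r' b = r b) ?_ ?_ ?_).post ?_)
  · refine ⟨_, _, by simp only [steps, Instr.step, zero_mul, add_zero]; rfl, ?_, fun i => ?_,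
      fun i => ?_, fun b hb hc => ?_, fun b hb => rfl⟩ <;>
      simp (disch := omega) only [Function.update_self, Function.update_of_ne, hcol, ht]
    simp [candSet]
  · rintro j hj _ ⟨m1, r1, rfl, i1, i2, i3, i4, i5⟩
    have hL1 := hL.congr fun b hb => i4 b (by omega) (by omega)
    have l0 := hL1.m0
    have l1 := hL1.m1
    have l2 := hL1.m2
    have l12 := hL1.m12
    have l18 := hL1.m18
    refine ⟨by simp only [Test.on]; omega, Runs.blockSeq hW (Runs.seq hW (runs_flipRow hW (L := 0)
      (d := 65 + 3 * n) (l := n) (by omega) ?_ ?_ (by omega) ?_ (by omega)) ?_)⟩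
    all_goals try simp (disch := omega) only [Function.update_self,
      Function.update_of_ne]
    all_goals try omega
    rintro _ ⟨m2, rfl, k1, k2, k3⟩
    have k4 : ∀ b, (b < 20 ∨ 22 < b) → b ≠ 33 → (b < 65 + 3 * n ∨ 65 + 4 * n ≤ b) →
        Function.update m2 33 0 b = m1 b := fun b hb hc hd => by
      simp (disch := omega) only [Function.update_of_ne]
      rw [k3 b hb (by omega)]
      simp (disch := omega) only [Function.update_of_ne]
    have hL2 : Layout n T A N a k k₂ (Function.update m2 33 0) :=
      hL1.congr fun b hb => k4 b (by omega) (by omega) (by omega)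
    have hz2 : Table k k₂ z g (Function.update m2 33 0) := hz.congr fun b hb => by
      rw [k4 b (by omega) (by omega) (by omega), i4 b (by omega) (by omega)]
    refine Runs.blockSeq hW (Runs.seq hW (runs_compareAll hW hkW hAW hL2
      (by rw [← hr1, ← i5 1 (by omega)]) (by rw [← hr2, ← i5 2 (by omega)])
      (Function.update_self ..) (y := fun i => ω (c + j * n + i))
      (fun i => by rw [k4 _ (by omega) (by omega) (by omega)]; exact i2 i) hcolA (fun i => ?_) hz2
      fun i => by rw [k4 _ (by omega) (by omega) (by omega)]; exact i3 i) ?_)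
    · simp (disch := omega) only [Function.update_of_ne]
      exact k2 i i.2
    rintro _ ⟨m3, r3, rfl, g1, g2, g3⟩
    refine Runs.block hW ⟨_, _, by simp only [steps, Instr.step, add_mul, one_mul, add_assoc]; rfl,
        ?_, fun i => ?_, fun i => ?_, fun b hb hc => ?_, fun b hb => ?_⟩
    · simp only [Function.update_self]
      rw [g2 _ (by omega) (by omega) (by omega) (by omega),
        g2 _ (by omega) (by omega) (by omega) (by omega), k4 _ (by omega) (by omega) (by omega),
        k4 _ (by omega) (by omega) (by omega), l1, i1]
    · simp (disch := omega) only [Function.update_of_ne]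
      rw [g2 _ (by omega) (by omega) (by omega) (by omega), k4 _ (by omega) (by omega) (by omega),
        i2 i]
    · simp (disch := omega) only [Function.update_of_ne]
      rw [g1 i]
      congr 1
      rw [Bool.eq_iff_iff]
      simp only [candSet, Finset.mem_filter, Finset.mem_univ, true_and, Nat.forall_lt_succ_right,
        Bool.and_eq_true, decide_eq_true_eq, Bool.not_eq_true']
      refine and_congr_right fun _ => ?_
      generalize ω _ = b, probeBit _ _ _ _ _ = b'
      cases b <;> cases b' <;> simp
    · simp (disch := omega) only [Function.update_of_ne]
      rw [g2 _ (by omega) (by omega) (by omega) (by omega), k4 _ (by omega) (by omega) (by omega),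
        i4 b hb hc]
    · rw [g3 b hb]
      exact i5 b hb
  · rintro _ ⟨m1, r1, rfl, i1, i2, i3, i4, i5⟩
    have e2 := i4 2 (by omega) (by omega)
    rw [hL.m2] at e2
    simp only [Test.on]; omega
  · rintro _ ⟨m1, r1, rfl, i1, i2, i3, i4, i5⟩
    exact ⟨m1, r1, rfl, i3, i4, i5⟩

end

/-! ### Coefficients -/

/-- Multiply `R[6]` by the parity of the vector at `M[35]` on the set at `M[24]`. -/
def parityRow : Prog :=
  .loop (.lt 20 0) <| block [.load 25 24, .load 26 35, .add 26 26 25, .sub 26 26 1, .rcast 7 26,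
    .radd 7 7 7, .rsub 7 2 7, .rmul 6 6 7, .add 24 24 1, .add 35 35 1, .add 20 20 1]

/-- Correlate the residuals with the parity on the candidate. -/
def correlate : Prog :=
  .seq (block [.rsub 5 5 5, .const 32 0, .add 35 14 18, .const 33 64, .add 34 16 33]) <|
  .loop (.lt 32 16) <| .seq (block [.radd 6 2 1, .const 20 0, .add 24 10 18]) <| .seq parityRow <|
  block [.rstore 34 6, .rload 4 33, .rmul 4 4 6, .radd 5 5 4, .add 35 35 1, .add 33 33 1,
    .add 34 34 1, .add 32 32 1]

/-- Subtract the new term from the residuals. -/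
def subtract : Prog :=
  .seq (block [.rcast 7 16, .rdiv 5 5 7, .const 32 0, .const 33 64, .add 34 16 33]) <|
  .loop (.lt 32 16) <| block [.rload 4 33, .rload 6 34, .rmul 6 6 5, .rsub 4 4 6, .rstore 33 4,
    .add 33 33 1, .add 34 34 1, .add 32 32 1]

/-- Evaluate the target function at the sample points. -/
def sample : Prog :=
  .seq (block [.add 22 14 18, .const 23 0, .const 24 64]) <| .loop (.lt 23 16) <|
  block [.query 4 22, .rstore 24 4, .add 22 22 8, .add 24 24 1, .add 23 23 1]

section

variable {n W : ℕ} {f : Cube n → ℝ} {ω : ℕ → Bool} {m : ℕ → ℕ} {r : ℕ → ℝ} {c q : ℕ}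
  {o : List (Finset (Fin n) × ℝ)} {T A N a k k₂ : ℕ}

theorem prod_sgn_eq_parity (C : Finset (Fin n)) (x : Cube n) :
    ∏ i ∈ Finset.range n, (if h : i < n then sgn (x ⟨i, h⟩ && decide (⟨i, h⟩ ∈ C)) else 1)
      = parity C x := by
  rw [Finset.prod_range, parity_eq_prod, ← Finset.prod_subset (Finset.subset_univ C)]
  · refine Finset.prod_congr rfl fun i hi => ?_
    simp [hi]
  · intro i _ hi
    simp [hi]

theorem runs_parityRow (hW : n + 1 ≤ W) {S P : ℕ} (h0 : m 0 = n) (h1 : m 1 = 1) (h20 : m 20 = 0)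
    (h24 : m 24 = S) (h35 : m 35 = P) (hS : 64 ≤ S) (hP : 64 ≤ P) (hr2 : r 2 = 1) (hr6 : r 6 = 1)
    {C : Finset (Fin n)} {x : Cube n} (hC : ∀ i : Fin n, m (S + i) = (decide (i ∈ C)).toNat)
    (hx : ∀ i : Fin n, m (P + i) = (x i).toNat) :
    Runs W f ω parityRow ⟨m, r, c, q, o⟩ fun s => ∃ m' r', s = ⟨m', r', c, q, o⟩ ∧
      m' 35 = P + n ∧ r' 6 = parity C x ∧
      (∀ b, (b < 20 ∨ 29 < b) → b ≠ 35 → m' b = m b) ∧ ∀ b, (b < 6 ∨ 7 < b) → r' b = r b := by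
  refine (Runs.loop hW (show n ≤ W by omega) (fun j s => ∃ m' r', s = ⟨m', r', c, q, o⟩ ∧
      m' 20 = j ∧ m' 24 = S + j ∧ m' 35 = P + j ∧
      r' 6 = ∏ i ∈ Finset.range j,
        (if h : i < n then sgn (x ⟨i, h⟩ && decide (⟨i, h⟩ ∈ C)) else 1) ∧
      (∀ b, (b < 20 ∨ 29 < b) → b ≠ 35 → m' b = m b) ∧ ∀ b, (b < 6 ∨ 7 < b) → r' b = r b)
      ?_ ?_ ?_).post ?_
  · exact ⟨m, r, rfl, h20, h24, h35, by simpa using hr6, fun _ _ _ => rfl, fun _ _ => rfl⟩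
  · rintro j hj _ ⟨m1, r1, rfl, i1, i2, i3, i4, i5, i6⟩
    have e0 := i5 0 (by omega) (by omega)
    have e1 := i5 1 (by omega) (by omega)
    have eS := i5 (S + j) (by omega) (by omega)
    have eP := i5 (P + j) (by omega) (by omega)
    rw [h1] at e1
    rw [hC ⟨j, hj⟩] at eS
    rw [hx ⟨j, hj⟩] at eP
    refine ⟨by simp only [Test.on]; omega, Runs.block hW ⟨_, _, rfl, ?_, ?_, ?_, ?_,
      fun b hb hc => ?_, fun b hb => ?_⟩⟩ <;>
      simp (disch := omega) only [Instr.step, Function.update_self, Function.update_of_ne, i1, i2, i3,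
        i4, i6, eS, eP, e1, hr2, toNat_and, one_sub_toNat_add, Finset.prod_range_succ, dif_pos hj]
    · omega
    · omega
    · exact i5 b hb hc
  · rintro _ ⟨m1, r1, rfl, i1, i2, i3, i4, i5, i6⟩
    have e0 := i5 0 (by omega) (by omega)
    simp only [Test.on]; omega
  · rintro _ ⟨m1, r1, rfl, i1, i2, i3, i4, i5, i6⟩
    exact ⟨m1, r1, rfl, i3, i4.trans (prod_sgn_eq_parity C x), i5, i6⟩

theorem runs_correlate (hW : n + 1 ≤ W) (hk₂W : 2 ^ k₂ ≤ W) (hL : Layout n T A N a k k₂ m)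
    (hr1 : r 1 = 0) (hr2 : r 2 = 1) {C : Finset (Fin n)} {X : ℕ → Cube n} {v : ℕ → ℝ}
    (hC : ∀ i : Fin n, m (65 + n + i) = (decide (i ∈ C)).toNat)
    (hX : ∀ p < 2 ^ k₂, ∀ i : Fin n, m (65 + 5 * n + p * (n + 1) + i) = (X p i).toNat)
    (hv : ∀ t < 2 ^ k₂, r (64 + t) = v t) :
    Runs W f ω correlate ⟨m, r, c, q, o⟩ fun s => ∃ m' r', s = ⟨m', r', c, q, o⟩ ∧
      r' 5 = ∑ t ∈ Finset.range (2 ^ k₂), v t * parity C (X t) ∧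
      (∀ t < 2 ^ k₂, r' (64 + 2 ^ k₂ + t) = parity C (X t)) ∧
      (∀ b, (b < 20 ∨ 36 < b) → m' b = m b) ∧
      ∀ b, (b < 4 ∨ 7 < b) → (b < 64 + 2 ^ k₂) → r' b = r b := by
  refine Runs.blockSeq hW ((Runs.loop hW hk₂W (fun j s => ∃ m' r', s = ⟨m', r', c, q, o⟩ ∧
      m' 32 = j ∧ m' 33 = 64 + j ∧ m' 34 = 64 + 2 ^ k₂ + j ∧ m' 35 = 65 + 5 * n + j * (n + 1) ∧
      r' 5 = ∑ t ∈ Finset.range j, v t * parity C (X t) ∧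
      (∀ t < j, r' (64 + 2 ^ k₂ + t) = parity C (X t)) ∧
      (∀ b, (b < 20 ∨ 36 < b) → m' b = m b) ∧
      ∀ b, (b < 4 ∨ 7 < b) → (b < 64 + 2 ^ k₂) → r' b = r b) ?_ ?_ ?_).post ?_)
  · refine ⟨_, _, rfl, ?_, ?_, ?_, ?_, ?_, fun t ht => by omega, fun b hb => ?_, fun b hb hc => ?_⟩ <;>
      simp (disch := omega) only [Instr.step, Function.update_self, Function.update_of_ne, hL.m14,
        hL.m16, hL.m18, sub_self, Finset.range_zero, Finset.sum_empty, zero_mul, zero_add, add_comm]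
  · rintro j hj _ ⟨m1, r1, rfl, i1, i2, i3, i4, i5, i6, i7, i8⟩
    have hL1 := hL.congr fun b hb => i7 b (by omega)
    have l0 := hL1.m0
    have l1 := hL1.m1
    have l10 := hL1.m10
    have l16 := hL1.m16
    have l18 := hL1.m18
    have e1 := i8 1 (by omega) (by omega)
    have e2 := i8 2 (by omega) (by omega)
    rw [hr1] at e1
    rw [hr2] at e2
    refine ⟨by simp only [Test.on]; omega, Runs.blockSeq hW (Runs.seq hW (runs_parityRow hW
      (S := 65 + n) (P := 65 + 5 * n + j * (n + 1)) (C := C) (x := X j) ?_ ?_ ?_ ?_ ?_ (by omega)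
      (by omega) ?_ ?_ (fun i => ?_) fun i => ?_) ?_)⟩
    all_goals try simp (disch := omega) only [Instr.step, Function.update_self,
      Function.update_of_ne]
    all_goals try omega
    · rw [e1, e2, add_zero]
    · rw [i7 _ (by omega), hC]
    · rw [i7 _ (by omega), hX j hj]
    rintro _ ⟨m2, r2, rfl, k1, k2, k3, k4⟩
    have g1 := k3 1 (by omega) (by omega)
    have g32 := k3 32 (by omega) (by omega)
    have g33 := k3 33 (by omega) (by omega)
    have g34 := k3 34 (by omega) (by omega)
    have p5 := k4 5 (by omega)
    have pj := k4 (64 + j) (by omega)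
    simp (disch := omega) only [Function.update_of_ne, l1, i1, i2, i3, i5, i8, hv j hj]
      at g1 g32 g33 g34 p5 pj
    refine Runs.block hW ⟨_, _, rfl, ?_, ?_, ?_, ?_, ?_, fun t ht => ?_, fun b hb => ?_,
      fun b hb hc => ?_⟩ <;>
      simp (disch := omega) only [Instr.step, Function.update_self, Function.update_of_ne, g1, g32,
        g33, g34, p5, pj, k1, k2, Finset.sum_range_succ]
    · omega
    · omega
    · ring
    · rcases Nat.lt_succ_iff_lt_or_eq.1 ht with h | rfl
      · simp (disch := omega) only [Function.update_of_ne, k4, i6]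
      · simp only [Function.update_self]
    · rw [k3 b (by omega) (by omega)]
      simp (disch := omega) only [Function.update_of_ne, i7]
    · rw [k4 b (by omega)]
      simp (disch := omega) only [Function.update_of_ne, i8]
  · rintro _ ⟨m1, r1, rfl, i1, i2, i3, i4, i5, i6, i7, i8⟩
    have e16 := i7 16 (by omega)
    rw [hL.m16] at e16
    simp only [Test.on]; omega
  · rintro _ ⟨m1, r1, rfl, i1, i2, i3, i4, i5, i6, i7, i8⟩
    exact ⟨m1, r1, rfl, i5, i6, i7, i8⟩

theorem runs_subtract (hW : n + 1 ≤ W) (hk₂W : 2 ^ k₂ ≤ W) (hL : Layout n T A N a k k₂ m)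
    {u v : ℕ → ℝ} {x : ℝ} (hx : r 5 = x) (hv : ∀ t < 2 ^ k₂, r (64 + t) = v t)
    (hu : ∀ t < 2 ^ k₂, r (64 + 2 ^ k₂ + t) = u t) :
    Runs W f ω subtract ⟨m, r, c, q, o⟩ fun s => ∃ m' r', s = ⟨m', r', c, q, o⟩ ∧
      r' 5 = x / (2 ^ k₂ : ℕ) ∧ (∀ t < 2 ^ k₂, r' (64 + t) = v t - x / (2 ^ k₂ : ℕ) * u t) ∧
      (∀ b, (b < 20 ∨ 36 < b) → m' b = m b) ∧ ∀ b < 4, r' b = r b := by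
  refine Runs.blockSeq hW ((Runs.loop hW hk₂W (fun j s => ∃ m' r', s = ⟨m', r', c, q, o⟩ ∧
      m' 32 = j ∧ m' 33 = 64 + j ∧ m' 34 = 64 + 2 ^ k₂ + j ∧ r' 5 = x / (2 ^ k₂ : ℕ) ∧
      (∀ t < j, r' (64 + t) = v t - x / (2 ^ k₂ : ℕ) * u t) ∧
      (∀ b, (b < 20 ∨ 36 < b) → m' b = m b) ∧
      ∀ b, (b < 4 ∨ 64 + j ≤ b) → r' b = r b) ?_ ?_ ?_).post ?_)
  · refine ⟨_, _, rfl, ?_, ?_, ?_, ?_, fun t ht => by omega, fun b hb => ?_, fun b hb => ?_⟩ <;>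
      simp (disch := omega) only [Instr.step, Function.update_self, Function.update_of_ne, hx,
        hL.m16, zero_add, add_comm]
  · rintro j hj _ ⟨m1, r1, rfl, i1, i2, i3, i5, i6, i7, i8⟩
    have hL1 := hL.congr fun b hb => i7 b (by omega)
    have l1 := hL1.m1
    have l16 := hL1.m16
    refine ⟨by simp only [Test.on]; omega, Runs.block hW ⟨_, _, rfl, ?_, ?_, ?_, ?_, fun t ht => ?_,
      fun b hb => ?_, fun b hb => ?_⟩⟩ <;>
      simp (disch := omega) only [Instr.step, Function.update_self, Function.update_of_ne, l1, i1,
        i2, i3, i5, i8, hv, hu, i7]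
    · omega
    · omega
    · rcases Nat.lt_succ_iff_lt_or_eq.1 ht with h | rfl
      · simp (disch := omega) only [Function.update_of_ne, i6]
      · simp only [Function.update_self]; ring
  · rintro _ ⟨m1, r1, rfl, i1, i2, i3, i5, i6, i7, i8⟩
    have e16 := i7 16 (by omega)
    rw [hL.m16] at e16
    simp only [Test.on]; omega
  · rintro _ ⟨m1, r1, rfl, i1, i2, i3, i5, i6, i7, i8⟩
    exact ⟨m1, r1, rfl, i5, i6, i7, fun b hb => i8 b (by omega)⟩

theorem pointAt_eq {B : ℕ} {x : Cube n} (h : ∀ i : Fin n, m (B + i) = (x i).toNat) :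
    pointAt m B = x := by
  funext i
  rw [pointAt, h i]
  cases x i <;> rfl

theorem runs_sample (hW : n + 1 ≤ W) (hk₂W : 2 ^ k₂ ≤ W) (hL : Layout n T A N a k k₂ m)
    {X : ℕ → Cube n}
    (hX : ∀ p < 2 ^ k₂, ∀ i : Fin n, m (65 + 5 * n + p * (n + 1) + i) = (X p i).toNat) :
    Runs W f ω sample ⟨m, r, c, q, o⟩ fun s => ∃ m' r', s = ⟨m', r', c, q + 2 ^ k₂, o⟩ ∧
      (∀ t < 2 ^ k₂, r' (64 + t) = f (X t)) ∧
      (∀ b, (b < 20 ∨ 36 < b) → m' b = m b) ∧ ∀ b < 4, r' b = r b := by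
  refine Runs.blockSeq hW ((Runs.loop hW hk₂W (fun j s => ∃ m' r', s = ⟨m', r', c, q + j, o⟩ ∧
      m' 22 = 65 + 5 * n + j * (n + 1) ∧ m' 23 = j ∧ m' 24 = 64 + j ∧
      (∀ t < j, r' (64 + t) = f (X t)) ∧
      (∀ b, (b < 20 ∨ 36 < b) → m' b = m b) ∧ ∀ b < 4, r' b = r b) ?_ ?_ ?_).post ?_)
  · refine ⟨_, _, rfl, ?_, ?_, ?_, fun t ht => by omega, fun b hb => ?_, fun b hb => rfl⟩ <;>
      simp (disch := omega) only [Instr.step, Function.update_self, Function.update_of_ne,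
        hL.m14, hL.m18, add_zero, zero_mul]
  · rintro j hj _ ⟨m1, r1, rfl, i1, i2, i3, i5, i6, i7⟩
    have hL1 := hL.congr fun b hb => i6 b (by omega)
    have l1 := hL1.m1
    have l8 := hL1.m8
    have l16 := hL1.m16
    have hp : pointAt m1 (65 + 5 * n + j * (n + 1)) = X j :=
      pointAt_eq fun i => by rw [i6 _ (by omega), hX j hj]
    refine ⟨by simp only [Test.on]; omega, Runs.block hW ⟨_, _, rfl, ?_, ?_, ?_, fun t ht => ?_,
      fun b hb => ?_, fun b hb => ?_⟩⟩ <;>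
      simp (disch := omega) only [Instr.step, Function.update_self, Function.update_of_ne, l1, l8, i1,
        i2, i3, hp, i7, i6]
    · ring
    · omega
    · rcases Nat.lt_succ_iff_lt_or_eq.1 ht with h | rfl
      · simp (disch := omega) only [Function.update_of_ne, i5]
      · simp only [Function.update_self]
  · rintro _ ⟨m1, r1, rfl, i1, i2, i3, i5, i6, i7⟩
    have e16 := i6 16 (by omega)
    rw [hL.m16] at e16
    simp only [Test.on]; omega
  · rintro _ ⟨m1, r1, rfl, i1, i2, i3, i5, i6, i7⟩
    exact ⟨m1, r1, rfl, i5, i6, i7⟩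

end

/-! ### The learner -/

/-- Compute a candidate and its coefficient. -/
def trial : Prog :=
  .seq (genPoints 15 17) <| .seq colours <| .seq tests <| .seq correlate <| .seq subtract <|
  block [.emit 10 5, .add 40 40 1]

/-- The learner, once its constants are in memory. -/
def learn : Prog :=
  .seq (genPoints 14 16) <| .seq sample <| .seq (block [.const 40 0]) <| .loop (.lt 40 4) trial

section

variable {n W : ℕ} {f : Cube n → ℝ} {ω : ℕ → Bool} {m : ℕ → ℕ} {r : ℕ → ℝ} {c q : ℕ}
  {o : List (Finset (Fin n) × ℝ)} {T N a k k₂ : ℕ}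

theorem runs_trial (hW : n + 1 ≤ W) (hkW : 2 ^ k ≤ W) (hk₂W : 2 ^ k₂ ≤ W) (haW : 2 ^ a ≤ W)
    (hTW : T ≤ W) (hL : Layout n T (2 ^ a) N a k k₂ m) (hr1 : r 1 = 0) (hr2 : r 2 = 1)
    {X : ℕ → Cube n} {v : ℕ → ℝ}
    (hX : ∀ p < 2 ^ k₂, ∀ i : Fin n, m (65 + 5 * n + p * (n + 1) + i) = (X p i).toNat)
    (hv : ∀ t < 2 ^ k₂, r (64 + t) = v t) {C : Finset (Fin n)} {x : ℝ}
    (hC : C = coinCand f k a T fun p => ω (c + p))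
    (hx : x = (∑ t ∈ Finset.range (2 ^ k₂), v t * parity C (X t)) / (2 ^ k₂ : ℕ)) :
    Runs W f ω trial ⟨m, r, c, q, o⟩ fun s => ∃ m' r',
      s = ⟨m', r', c + trialLen n k a T, q + T * (2 ^ a * 2 ^ k), (C, x) :: o⟩ ∧
      m' 40 = m 40 + 1 ∧ (∀ t < 2 ^ k₂, r' (64 + t) = v t - x * parity C (X t)) ∧
      (∀ b, (b < 20 ∨ 65 + 5 * n ≤ b) → b < 65 + 5 * n + 2 ^ k₂ * (n + 1) → m' b = m b) ∧
      r' 1 = 0 ∧ r' 2 = 1 := by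
  refine Runs.seq hW (runs_genPoints hW (b := 65 + 5 * n + 2 ^ k₂ * (n + 1)) (by omega) (by omega)
    hL.m1 hL.m8 hL.m9 hL.m18 hW hkW hL.m15 hL.m17 (by omega) (by omega)) ?_
  rintro _ ⟨m1, rfl, a1, a2⟩
  have hL1 := hL.congr fun b hb => a2 b (by omega) (by omega) (by omega)
  have l1 := hL1.m1
  have hTab : Table k k₂ (coinRow n fun p => ω (c + p)) (coinLast n fun p => ω (c + p)) m1 :=
    fun p hp => ⟨fun i => by
      rw [a1 p hp i (by omega)]
      simp only [affPt, coinRow, add_assoc], by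
      rw [a1 p hp n (by omega)]
      simp only [add_assoc]
      rfl⟩
  refine Runs.seq hW (runs_colours hW (Nat.lt_two_pow_self.le.trans haW) hL1) ?_
  rintro _ ⟨m2, rfl, b1, b2, b3⟩
  have hL2 := hL1.congr fun b hb => b3 b (by omega) (by omega)
  refine Runs.seq hW (runs_tests hW hkW haW hTW hL2 hr1 hr2 (col := coinCol n k a fun p => ω (c + p))
    (fun i => ?_) (fun i => bitsNum_lt _ _)
    (hTab.congr fun b hb => b3 b (by omega) (by omega)) fun i => b1 i i.2) ?_
  · rw [b2 i i.2]
    simp only [coinCol, add_assoc]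
  rintro _ ⟨m3, r3, rfl, c1, c2, c3⟩
  have hL3 := hL2.congr fun b hb => c2 b (by omega) (by omega)
  have hC3 : ∀ i : Fin n, m3 (65 + n + i) = (decide (i ∈ C)).toNat := fun i => by
    rw [c1 i, hC, coinCand]
    congr! with t j
    simp only [coinTest, add_assoc]
  have g3 : ∀ b, (b < 20 ∨ 65 + 5 * n ≤ b) → b < 65 + 5 * n + 2 ^ k₂ * (n + 1) → m3 b = m b :=
    fun b hb hc => by
      rw [c2 b (by omega) (by omega), b3 b (by omega) (by omega), a2 b (by omega) hc (by omega)]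
  have g40 : m3 40 = m 40 := by
    rw [c2 40 (by omega) (by omega), b3 40 (by omega) (by omega),
      a2 40 (by omega) (by omega) (by omega)]
  refine Runs.seq hW (runs_correlate hW hk₂W hL3 (by rw [c3 1 (by omega), hr1])
    (by rw [c3 2 (by omega), hr2]) hC3 (X := X) (v := v) (fun p hp i => ?_)
    fun t ht => by rw [c3 _ (by omega), hv t ht]) ?_
  · have hp' := mul_add_lt hp (i.2.trans n.lt_succ_self)
    rw [Nat.succ_eq_add_one] at hp'
    rw [g3 _ (by omega) (by omega), hX p hp]
  rintro _ ⟨m4, r4, rfl, d1, d2, d3, d4⟩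
  have hL4 := hL3.congr fun b hb => d3 b (by omega)
  refine Runs.seq hW (runs_subtract hW hk₂W hL4 d1 (v := v)
    (fun t ht => by rw [d4 _ (by omega) (by omega), c3 _ (by omega), hv t ht]) d2) ?_
  rintro _ ⟨m5, r5, rfl, e1, e2, e3, e4⟩
  have hpos := Nat.two_pow_pos k₂
  rw [← hx] at e1
  rw [← hx] at e2
  have hL5 := hL4.congr fun b hb => e3 b (by omega)
  have hp : pointAt m5 (m5 10) = fun i => decide (i ∈ C) := by
    rw [hL5.m10]
    exact pointAt_eq fun i => by rw [e3 _ (by omega), d3 _ (by omega), hC3 i]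
  refine Runs.block hW ⟨Function.update m5 40 (m5 40 + m5 1), r5, ?_, ?_, e2, fun b hb hc => ?_, ?_, ?_⟩
  · simp only [steps, Instr.step, hp, e1, trialLen, decide_eq_true_eq, Finset.filter_univ_mem,
      add_assoc]
  · simp only [Function.update_self]
    rw [e3 40 (by omega), d3 40 (by omega), g40, hL5.m1]
  · simp (disch := omega) only [Function.update_of_ne]
    rw [e3 b (by omega), d3 b (by omega), g3 b hb hc]
  · rw [e4 1 (by omega), d4 1 (by omega) (by omega), c3 1 (by omega), hr1]
  · rw [e4 2 (by omega), d4 2 (by omega) (by omega), c3 2 (by omega), hr2]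

theorem runs_learn (hW : n + 1 ≤ W) (hkW : 2 ^ k ≤ W) (hk₂W : 2 ^ k₂ ≤ W) (haW : 2 ^ a ≤ W)
    (hTW : T ≤ W) (hNW : N ≤ W) (hL : Layout n T (2 ^ a) N a k k₂ m) (hr1 : r 1 = 0)
    (hr2 : r 2 = 1) :
    Runs W f ω learn ⟨m, r, 0, 0, []⟩ fun s =>
      s.queries = 2 ^ k₂ + N * (T * (2 ^ a * 2 ^ k)) ∧
      hypothesis s.out = coinHyp f k a T k₂ N ω := by
  set X : ℕ → Cube n := affPt (coinRow n ω) k₂ with hXdef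
  refine Runs.seq hW (runs_genPoints hW (b := 65 + 5 * n) (by omega) (by omega)
    hL.m1 hL.m8 hL.m9 hL.m18 hW hk₂W hL.m14 hL.m16 (by omega) (by omega)) ?_
  rintro _ ⟨m1, rfl, a1, a2⟩
  have hL1 := hL.congr fun b hb => a2 b (by omega) (by omega) (by omega)
  have hX : ∀ p < 2 ^ k₂, ∀ i : Fin n, m1 (65 + 5 * n + p * (n + 1) + i) = (X p i).toNat :=
    fun p hp i => by
      rw [a1 p hp i (by omega)]
      simp only [hXdef, affPt, coinRow, zero_add]
  refine Runs.seq hW (runs_sample hW hk₂W hL1 hX) ?_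
  rintro _ ⟨m2, r2, rfl, b1, b2, b3⟩
  have hL2 := hL1.congr fun b hb => b2 b (by omega)
  refine Runs.blockSeq hW ((Runs.loop hW hNW (fun j s => ∃ m' r' o',
    s = ⟨m', r', (k₂ + 1) * (n + 1) + j * trialLen n k a T,
      2 ^ k₂ + j * (T * (2 ^ a * 2 ^ k)), o'⟩ ∧
      m' 40 = j ∧
      (∀ t < 2 ^ k₂, r' (64 + t) = resid (2 ^ k₂) X f (coinCands f k a T k₂ ω) j t) ∧
      (∀ b, (b < 20 ∨ 65 + 5 * n ≤ b) → b < 65 + 5 * n + 2 ^ k₂ * (n + 1) → m' b = m2 b) ∧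
      r' 1 = 0 ∧ r' 2 = 1 ∧
      hypothesis o' = pursuit (2 ^ k₂) X f (coinCands f k a T k₂ ω) j) ?_ ?_ ?_).post ?_)
  · refine ⟨_, _, _, by simp only [steps, Instr.step, zero_mul, add_zero, zero_add]; rfl, ?_, b1,
      fun b hb hc => ?_, by rw [b3 1 (by omega), hr1], by rw [b3 2 (by omega), hr2], ?_⟩
    · simp only [Function.update_self]
    · simp (disch := omega) only [Function.update_of_ne]
    · funext x
      simp [hypothesis, pursuit]
  · rintro j hj _ ⟨m3, r3, o3, rfl, i1, i2, i3, i4, i5, i6⟩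
    have hL3 := hL2.congr fun b hb => i3 b (by omega) (by omega)
    refine ⟨by simp only [Test.on, i1, hL3.m4]; exact hj, (runs_trial hW hkW hk₂W haW hTW hL3 i4 i5 (X := X)
      (fun p hp i => ?_) i2 (C := coinCands f k a T k₂ ω j) rfl rfl).post ?_⟩
    · have hp' := mul_add_lt hp (i.2.trans n.lt_succ_self)
      rw [Nat.succ_eq_add_one] at hp'
      rw [i3 _ (by omega) (by omega), b2 _ (by omega), hX p hp]
    rintro _ ⟨m4, r4, rfl, k1, k2, k3, k4, k5⟩
    refine ⟨m4, r4, _, by simp only [add_mul, one_mul, add_assoc]; rfl, by rw [k1, i1], k2,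
      fun b hb hc => by rw [k3 b hb hc, i3 b hb hc], k4, k5, ?_⟩
    funext x
    rw [pursuit, Finset.sum_range_succ, add_comm]
    exact congrArg _ (congrFun i6 x)
  · rintro _ ⟨m3, r3, o3, rfl, i1, i2, i3, i4, i5, i6⟩
    have hL3 := hL2.congr fun b hb => i3 b (by omega) (by omega)
    simp only [Test.on, i1, hL3.m4, lt_irrefl, not_false_eq_true]
  · rintro _ ⟨m3, r3, o3, rfl, i1, i2, i3, i4, i5, i6⟩
    exact ⟨rfl, i6⟩

end

/-! ### The constants -/

/-- `M[d] := M[a] * M[b]`. -/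
def mul (d a b : ℕ) : Prog :=
  .seq (block [.const d 0, .const 25 0]) <| .loop (.lt 25 b) <| block [.add d d a, .add 25 25 1]

/-- `M[d]` becomes the least power of two which is not less than `M[a]`. -/
def ceilPow (d a : ℕ) : Prog :=
  .seq (block [.const d 1]) <| .loop (.lt d a) <| block [.add d d d]

/-- With `B = M[21]` and `T = M[2]`, compute `B ^ 8`, `B ^ 32 * T`, `B ^ 32 * T * B ^ 32` and the
eighth power of the latter. -/
def powers : Prog :=
  .seq (mul 26 21 21) <| .seq (mul 27 26 26) <| .seq (mul 5 27 27) <| .seq (mul 28 5 5) <|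
  .seq (mul 29 28 28) <| .seq (mul 3 29 2) <| .seq (mul 4 3 29) <| .seq (mul 30 4 4) <|
  .seq (mul 31 30 30) <| mul 32 31 31

/-- Compute the constants of the learner. -/
def setup : Prog :=
  .seq (block [.const 1 1, .add 8 0 1, .const 9 64, .add 10 9 8, .add 11 10 0, .add 12 11 0,
    .add 13 12 0, .add 14 13 0, .rcast 2 1, .rmul 3 0 0, .rmul 5 3 2, .const 20 8, .rcast 4 20,
    .const 21 2, .const 6 8]) <|
  .seq (.loop (.rlt 5 4) <| block [.radd 5 5 3, .add 21 21 21, .add 6 6 20]) <|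
  .seq (block [.const 22 2, .const 2 2, .add 23 0 0, .add 23 23 23]) <|
  .seq (.loop (.lt 22 23) <| block [.add 22 22 22, .add 2 2 1, .add 2 2 1]) <|
  .seq powers <| .seq (ceilPow 17 3) <| .seq (ceilPow 16 32) <| .seq (mul 33 16 8) <|
  block [.add 15 14 33]

/-- The number of doublings for the accuracy `ε`. -/
def accR (ε : ℝ) : ℕ := max 1 ⌈8 / ε ^ 2⌉₊

/-- The number of test vectors. -/
def numTests (n : ℕ) : ℕ := 2 * max 1 (Nat.clog 2 (4 * n))

section

variable {n W : ℕ} {f : Cube n → ℝ} {ω : ℕ → Bool} {m : ℕ → ℕ} {r : ℕ → ℝ} {c q : ℕ}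
  {o : List (Finset (Fin n) × ℝ)} {T N a k k₂ : ℕ}

theorem runs_mul (hW : n + 1 ≤ W) {d a b x y : ℕ} (hd1 : d ≠ 1) (hd : d ≠ 25) (ha : a ≠ 25)
    (hb : b ≠ 25) (hda : d ≠ a) (hdb : d ≠ b) (h1 : m 1 = 1) (hx : m a = x) (hy : m b = y)
    (hyW : y ≤ W) :
    Runs W f ω (mul d a b) ⟨m, r, c, q, o⟩ fun s => ∃ m', s = ⟨m', r, c, q, o⟩ ∧ m' d = x * y ∧
      ∀ i, i ≠ d → i ≠ 25 → m' i = m i := by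
  refine Runs.blockSeq hW ((Runs.loop hW hyW (fun j s => ∃ m', s = ⟨m', r, c, q, o⟩ ∧ m' 25 = j ∧
    m' d = x * j ∧ ∀ i, i ≠ d → i ≠ 25 → m' i = m i) ?_ ?_ ?_).post ?_)
  · refine ⟨_, rfl, ?_, ?_, fun i hi hi' => ?_⟩ <;>
      simp (disch := omega) only [Instr.step, Function.update_self, Function.update_of_ne, mul_zero]
  · rintro j hj _ ⟨m', rfl, i1, i2, i3⟩
    refine ⟨by simp (disch := omega) only [Test.on, i1, i3, hy, hj],
      Runs.block hW ⟨_, rfl, ?_, ?_, fun i hi hi' => ?_⟩⟩ <;>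
      simp (disch := omega) only [Instr.step, Function.update_self, Function.update_of_ne, i1, i2, i3,
        hx, h1]
    ring
  · rintro _ ⟨m', rfl, i1, i2, i3⟩
    simp (disch := omega) only [Test.on, i1, i3, hy, lt_irrefl, not_false_eq_true]
  · rintro _ ⟨m', rfl, i1, i2, i3⟩
    exact ⟨m', rfl, i2, i3⟩

theorem runs_ceilPow (hW : n + 1 ≤ W) {d a x : ℕ} (hda : d ≠ a) (hx : m a = x) (hxW : x ≤ W) :
    Runs W f ω (ceilPow d a) ⟨m, r, c, q, o⟩ fun s => ∃ m', s = ⟨m', r, c, q, o⟩ ∧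
      m' d = 2 ^ Nat.clog 2 x ∧ ∀ i, i ≠ d → m' i = m i := by
  have hc : Nat.clog 2 x ≤ W := by
    refine (Nat.clog_le_of_le_pow ?_).trans hxW
    exact Nat.lt_two_pow_self.le
  refine Runs.blockSeq hW (Runs.loop hW hc (fun j s => ∃ m', s = ⟨m', r, c, q, o⟩ ∧
    m' d = 2 ^ j ∧ ∀ i, i ≠ d → m' i = m i) ?_ ?_ ?_)
  · refine ⟨_, rfl, ?_, fun i hi => ?_⟩ <;>
      simp (disch := omega) only [Function.update_self, Function.update_of_ne, pow_zero]
  · rintro j hj _ ⟨m', rfl, i2, i3⟩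
    refine ⟨?_, Runs.block hW ⟨_, rfl, ?_, fun i hi => ?_⟩⟩
    · simp (disch := omega) only [Test.on, i2, i3, hx]
      exact (Nat.lt_clog_iff_pow_lt one_lt_two).1 hj
    · simp only [Function.update_self, i2]
      ring
    · simp (disch := omega) only [Function.update_of_ne, i3]
  · rintro _ ⟨m', rfl, i2, i3⟩
    simp (disch := omega) only [Test.on, i2, i3, hx, not_lt]
    exact Nat.le_pow_clog one_lt_two x

theorem runs_powers (hW : n + 1 ≤ W) {B : ℕ} (h1 : m 1 = 1) (hB : m 21 = B) (hT : m 2 = T)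
    (hB0 : 1 ≤ B) (hT0 : 1 ≤ T) (hNW : (B ^ 32 * T * B ^ 32) ^ 8 ≤ W) :
    Runs W f ω powers ⟨m, r, c, q, o⟩ fun s => ∃ m', s = ⟨m', r, c, q, o⟩ ∧ m' 5 = B ^ 8 ∧
      m' 3 = B ^ 32 * T ∧ m' 4 = B ^ 32 * T * B ^ 32 ∧ m' 32 = (B ^ 32 * T * B ^ 32) ^ 8 ∧
      ∀ i, i ≠ 3 → i ≠ 4 → i ≠ 5 → (i < 25 ∨ 32 < i) → m' i = m i := by
  obtain ⟨N, hN⟩ : ∃ N, N = B ^ 32 * T * B ^ 32 := ⟨_, rfl⟩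
  rw [← hN] at hNW ⊢
  have hN0 : 1 ≤ N := by rw [hN]; exact Nat.succ_le_of_lt (by positivity)
  have hle : ∀ i ≤ 8, N ^ i ≤ W := fun i hi => (Nat.pow_le_pow_right hN0 hi).trans hNW
  have hBN : B ^ 32 ≤ N := by
    rw [hN]; exact Nat.le_mul_of_pos_left _ (by positivity)
  have hTN : T ≤ N := by
    rw [hN, mul_assoc, mul_comm T, ← mul_assoc]; exact Nat.le_mul_of_pos_left _ (by positivity)
  have hNW1 : N ≤ W := by simpa using hle 1 (by omega)
  have hBW : ∀ i ≤ 32, B ^ i ≤ W := fun i hi =>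
    ((Nat.pow_le_pow_right hB0 hi).trans hBN).trans hNW1
  refine Runs.seq hW (runs_mul hW (by omega) (by omega) (by omega) (by omega) (by omega) (by omega)
    h1 hB hB (by simpa using hBW 1 (by omega))) ?_
  rintro _ ⟨m1, rfl, a1, b1⟩
  rw [show B * B = B ^ 2 by ring] at a1
  refine Runs.seq hW (runs_mul hW (by omega) (by omega) (by omega) (by omega) (by omega) (by omega)
    (by simp (disch := omega) only [b1, h1]) a1 a1 (hBW 2 (by omega))) ?_
  rintro _ ⟨m2, rfl, a2, b2⟩
  rw [show B ^ 2 * B ^ 2 = B ^ 4 by ring] at a2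
  refine Runs.seq hW (runs_mul hW (by omega) (by omega) (by omega) (by omega) (by omega) (by omega)
    (by simp (disch := omega) only [b1, b2, h1]) a2 a2 (hBW 4 (by omega))) ?_
  rintro _ ⟨m3, rfl, a3, b3⟩
  rw [show B ^ 4 * B ^ 4 = B ^ 8 by ring] at a3
  refine Runs.seq hW (runs_mul hW (by omega) (by omega) (by omega) (by omega) (by omega) (by omega)
    (by simp (disch := omega) only [b1, b2, b3, h1]) a3 a3 (hBW 8 (by omega))) ?_
  rintro _ ⟨m4, rfl, a4, b4⟩
  rw [show B ^ 8 * B ^ 8 = B ^ 16 by ring] at a4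
  refine Runs.seq hW (runs_mul hW (by omega) (by omega) (by omega) (by omega) (by omega) (by omega)
    (by simp (disch := omega) only [b1, b2, b3, b4, h1]) a4 a4 (hBW 16 (by omega))) ?_
  rintro _ ⟨m5, rfl, a5, b5⟩
  rw [show B ^ 16 * B ^ 16 = B ^ 32 by ring] at a5
  refine Runs.seq hW (runs_mul hW (by omega) (by omega) (by omega) (by omega) (by omega) (by omega)
    (by simp (disch := omega) only [b1, b2, b3, b4, b5, h1]) a5
    (by simp (disch := omega) only [b1, b2, b3, b4, b5]; exact hT) (hTN.trans hNW1)) ?_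
  rintro _ ⟨m6, rfl, a6, b6⟩
  have a5' : m6 29 = B ^ 32 := by rw [b6 29 (by omega) (by omega), a5]
  refine Runs.seq hW (runs_mul hW (by omega) (by omega) (by omega) (by omega) (by omega) (by omega)
    (by simp (disch := omega) only [b1, b2, b3, b4, b5, b6, h1]) a6 a5' (hBN.trans hNW1)) ?_
  rintro _ ⟨m7, rfl, a7, b7⟩
  rw [← hN] at a7
  refine Runs.seq hW (runs_mul hW (by omega) (by omega) (by omega) (by omega) (by omega) (by omega)
    (by simp (disch := omega) only [b1, b2, b3, b4, b5, b6, b7, h1]) a7 a7 hNW1) ?_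
  rintro _ ⟨m8, rfl, a8, b8⟩
  rw [show N * N = N ^ 2 by ring] at a8
  refine Runs.seq hW (runs_mul hW (by omega) (by omega) (by omega) (by omega) (by omega) (by omega)
    (by simp (disch := omega) only [b1, b2, b3, b4, b5, b6, b7, b8, h1]) a8 a8
    (hle 2 (by omega))) ?_
  rintro _ ⟨m9, rfl, a9, b9⟩
  rw [show N ^ 2 * N ^ 2 = N ^ 4 by ring] at a9
  refine (runs_mul hW (by omega) (by omega) (by omega) (by omega) (by omega) (by omega)
    (by simp (disch := omega) only [b1, b2, b3, b4, b5, b6, b7, b8, b9, h1]) a9 a9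
    (hle 4 (by omega))).post ?_
  rintro _ ⟨m', rfl, a10, b10⟩
  rw [show N ^ 4 * N ^ 4 = N ^ 8 by ring] at a10
  refine ⟨m', rfl, ?_, ?_, ?_, a10, fun i h3 h4 h5 hi => ?_⟩
  · simp (disch := omega) only [b4, b5, b6, b7, b8, b9, b10, a3]
  · simp (disch := omega) only [b7, b8, b9, b10, a6]
  · simp (disch := omega) only [b8, b9, b10, a7]
  · simp (disch := omega) only [b1, b2, b3, b4, b5, b6, b7, b8, b9, b10]

theorem one_le_numTests (n : ℕ) : 1 ≤ numTests n := by
  have := le_max_left 1 (Nat.clog 2 (4 * n))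
  rw [numTests]; omega

theorem accR_le_two_pow (ε : ℝ) : accR ε ≤ 2 ^ accR ε := Nat.lt_two_pow_self.le

theorem runs_setup (hW : n + 1 ≤ W) {ε : ℝ} (hε : 0 < ε) (hT : T = numTests n)
    (hN : N = (2 ^ accR ε) ^ 32 * T * (2 ^ accR ε) ^ 32) (hNW : N ^ 8 ≤ W) {s : Core n}
    (hs : s = (State.init n ε).core) :
    Runs W f ω setup s fun s' => ∃ m' r', s' = ⟨m', r', 0, 0, []⟩ ∧
      Layout n T (2 ^ (8 * accR ε)) N (8 * accR ε) (Nat.clog 2 ((2 ^ accR ε) ^ 32 * T))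
        (Nat.clog 2 (N ^ 8)) m' ∧ r' 1 = 0 ∧ r' 2 = 1 := by
  subst hs
  have hT1 := hT ▸ one_le_numTests n
  have hN1 : 1 ≤ N := by rw [hN]; exact Nat.succ_le_of_lt (by positivity)
  have hNW1 : N ≤ W := (Nat.le_self_pow (by norm_num) N).trans hNW
  have hBN : (2 ^ accR ε) ^ 32 ≤ N := by
    rw [hN]; exact Nat.le_mul_of_pos_left _ (by positivity)
  have hMN : (2 ^ accR ε) ^ 32 * T ≤ N := by
    rw [hN]; exact Nat.le_mul_of_pos_right _ (by positivity)
  have hTN : T ≤ N := (Nat.le_mul_of_pos_left _ (by positivity)).trans hMN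
  have hRW : accR ε ≤ W := by
    have := Nat.le_self_pow (show (32 : ℕ) ≠ 0 by norm_num) (2 ^ accR ε)
    have := accR_le_two_pow ε
    omega
  have hε2 : 0 < ε ^ 2 := by positivity
  refine Runs.seq hW (Runs.block hW (Q := fun s => ∃ m r, s = ⟨m, r, 0, 0, []⟩ ∧
    m 0 = n ∧ m 1 = 1 ∧ m 8 = n + 1 ∧ m 9 = 64 ∧ m 10 = 65 + n ∧ m 11 = 65 + 2 * n ∧
    m 12 = 65 + 3 * n ∧ m 13 = 65 + 4 * n ∧ m 14 = 65 + 5 * n ∧ m 18 = 0 ∧ m 20 = 8 ∧ m 21 = 2 ∧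
    m 6 = 8 ∧ r 1 = 0 ∧ r 2 = 1 ∧ r 3 = ε ^ 2 ∧ r 4 = 8 ∧ r 5 = ε ^ 2) ?_) ?_
  · refine ⟨_, _, rfl, ?_, ?_, ?_, ?_, ?_, ?_, ?_, ?_, ?_, ?_, ?_, ?_, ?_, ?_, ?_, ?_, ?_, ?_⟩ <;>
      simp (disch := omega) only [Instr.step, Function.update_self, Function.update_of_ne, State.core,
        State.init, Nat.cast_one, mul_one, Nat.cast_ofNat]
    all_goals ring
  rintro _ ⟨m, r, rfl, p0, p1, p8, p9, p10, p11, p12, p13, p14, p18, p20, p21, p6, q1, q2, q3, q4, q5⟩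
  refine Runs.seq hW (Runs.loop hW (N := accR ε - 1) (by omega) (fun j s => ∃ m' r',
    s = ⟨m', r', 0, 0, []⟩ ∧ r' 5 = (j + 1) * ε ^ 2 ∧ m' 21 = 2 ^ (j + 1) ∧ m' 6 = 8 * (j + 1) ∧
    (∀ i, i ≠ 21 → i ≠ 6 → m' i = m i) ∧ ∀ i, i ≠ 5 → r' i = r i) ?_ ?_ ?_) ?_
  · exact ⟨m, r, rfl, by simpa using q5, by simpa using p21, by simpa using p6, fun _ _ _ => rfl,
      fun _ _ => rfl⟩
  · rintro j hj _ ⟨m1, r1, rfl, i1, i2, i3, i4, i5⟩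
    refine ⟨?_, Runs.block hW ⟨_, _, rfl, ?_, ?_, ?_, fun i hi hi' => ?_, fun i hi => ?_⟩⟩
    · simp (disch := omega) only [Test.on, i1, i5, q4]
      have : j + 1 < ⌈8 / ε ^ 2⌉₊ := by
        rw [accR] at hj; omega
      have := Nat.lt_ceil.1 this
      rw [lt_div_iff₀ hε2] at this
      exact_mod_cast this
    all_goals simp (disch := omega) only [Instr.step, Function.update_self, Function.update_of_ne, i1,
      i2, i3, i4, i5, q3, p20]
    · push_cast; ring
    · ring
    · ring
  · rintro _ ⟨m1, r1, rfl, i1, i2, i3, i4, i5⟩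
    simp (disch := omega) only [Test.on, i1, i5, q4, not_lt]
    have h1 : 1 ≤ accR ε := le_max_left _ _
    have h2 : (⌈8 / ε ^ 2⌉₊ : ℝ) ≤ accR ε := by exact_mod_cast le_max_right _ _
    have h3 := (Nat.le_ceil (8 / ε ^ 2)).trans h2
    rw [div_le_iff₀ hε2] at h3
    push_cast [Nat.cast_sub h1]
    linarith
  rintro _ ⟨m1, r1, rfl, -, i2, i3, i4, i5⟩
  have h1 : accR ε - 1 + 1 = accR ε := Nat.sub_add_cancel (le_max_left _ _)
  rw [h1] at i2 i3
  obtain ⟨J, hJ⟩ : ∃ J, J = max 1 (Nat.clog 2 (4 * n)) := ⟨_, rfl⟩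
  rw [numTests, ← hJ] at hT
  refine Runs.blockSeq hW (Runs.seq hW (Runs.loop hW (N := J - 1) (by omega) (fun j s => ∃ m',
    s = ⟨m', r1, 0, 0, []⟩ ∧ m' 22 = 2 ^ (j + 1) ∧ m' 2 = 2 * (j + 1) ∧ m' 23 = 4 * n ∧
    (∀ i, i ≠ 2 → i ≠ 22 → i ≠ 23 → m' i = m1 i)) ?_ ?_ ?_) ?_)
  · refine ⟨_, rfl, ?_, ?_, ?_, fun i hi hi' hi'' => ?_⟩ <;>
      simp (disch := omega) only [Instr.step, Function.update_self, Function.update_of_ne, i4, p0]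
    · ring
    · ring
  · rintro j hj _ ⟨m2, rfl, j1, j2, j3, j4⟩
    refine ⟨?_, Runs.block hW ⟨_, rfl, ?_, ?_, ?_, fun i hi hi' hi'' => ?_⟩⟩
    · simp only [Test.on, j1, j3]
      exact (Nat.lt_clog_iff_pow_lt one_lt_two).1 (by omega)
    all_goals simp (disch := omega) only [Instr.step, Function.update_self, Function.update_of_ne, j1,
      j2, j3, j4, i4, p1]
    · ring
    · ring
  · rintro _ ⟨m2, rfl, j1, j2, j3, j4⟩
    simp only [Test.on, j1, j3, not_lt]
    rw [show J - 1 + 1 = J by omega, hJ]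
    exact (Nat.le_pow_clog one_lt_two _).trans (Nat.pow_le_pow_right two_pos (le_max_right _ _))
  rintro _ ⟨m2, rfl, -, j2, -, j4⟩
  rw [show J - 1 + 1 = J by omega, ← hT] at j2
  refine Runs.seq hW (runs_powers hW (B := 2 ^ accR ε) (T := T)
    (by simp (disch := omega) only [j4, i4, p1]) (by simp (disch := omega) only [j4, i2]) j2
    Nat.one_le_two_pow hT1 (hN ▸ hNW)) ?_
  rw [← hN]
  rintro _ ⟨m3, rfl, a5, a3, a4, a32, b3⟩
  refine Runs.seq hW (runs_ceilPow hW (by omega) a3 (hMN.trans hNW1)) ?_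
  rintro _ ⟨m4, rfl, c1, c2⟩
  refine Runs.seq hW (runs_ceilPow hW (by omega) (by rw [c2 32 (by omega), a32]) hNW) ?_
  rintro _ ⟨m5, rfl, d1, d2⟩
  have g : ∀ i, i ≠ 2 → i ≠ 3 → i ≠ 4 → i ≠ 5 → i ≠ 6 → i ≠ 16 → i ≠ 17 → i < 20 → m5 i = m i :=
    fun i _ _ _ _ _ _ _ _ => by simp (disch := omega) only [d2, c2, b3, j4, i4]
  refine Runs.seq hW (runs_mul hW (y := n + 1) (by omega) (by omega) (by omega) (by omega) (by omega)
    (by omega) (by simp (disch := omega) only [g, p1]) d1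
    (by simp (disch := omega) only [g, p8]) hW) ?_
  rintro _ ⟨m6, rfl, e1, e2⟩
  refine Runs.block hW ⟨_, _, rfl, ?_, ?_, ?_⟩
  · constructor <;>
      simp (disch := omega) only [Function.update_self, Function.update_of_ne, e1, e2, g,
        p0, p1, p8, p9, p10, p11, p12, p13, p14, p18, d1, d2, c1, c2, b3, a4, a5, j4, j2, i3]
    rw [← pow_mul, mul_comm]
  · exact (i5 1 (by omega)).trans q1
  · exact (i5 2 (by omega)).trans q2

end

/-! ### The main result -/

/-- The learning algorithm. -/
def learner : Prog := .seq setup learn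

/-- The number of candidates of the learner. -/
def numCands (n : ℕ) (ε : ℝ) : ℕ := (2 ^ accR ε) ^ 32 * numTests n * (2 ^ accR ε) ^ 32

theorem params_learner (n : ℕ) (ε : ℝ) : Params n (accR ε)
    (Nat.clog 2 ((2 ^ accR ε) ^ 32 * numTests n)) (Nat.clog 2 (numCands n ε ^ 8)) (numTests n)
    (numCands n ε) where
  R_pos := le_max_left _ _
  T_pos := one_le_numTests n
  test := by
    rcases Nat.eq_zero_or_pos n with rfl | hn
    · simp
    · have h : 4 * n ≤ 2 ^ max 1 (Nat.clog 2 (4 * n)) := (Nat.le_pow_clog one_lt_two _).trans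
        (Nat.pow_le_pow_right two_pos (le_max_right _ _))
      rw [numTests, mul_comm 2, pow_mul]
      nlinarith
  le_k := Nat.le_pow_clog one_lt_two _
  k_lt := by
    have hM : 1 < (2 ^ accR ε) ^ 32 * numTests n := by
      have h1 : 2 ^ 1 ≤ 2 ^ accR ε := Nat.pow_le_pow_right two_pos (le_max_left _ _)
      have h2 := Nat.le_self_pow (show (32 : ℕ) ≠ 0 by norm_num) (2 ^ accR ε)
      have h3 := Nat.le_mul_of_pos_right ((2 ^ accR ε) ^ 32) (one_le_numTests n)
      omega
    have h := Nat.pow_pred_clog_lt_self one_lt_two hM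
    have h' := Nat.clog_pos one_lt_two hM
    obtain ⟨j, hj⟩ : ∃ j, Nat.clog 2 ((2 ^ accR ε) ^ 32 * numTests n) = j + 1 :=
      ⟨_, (Nat.succ_pred_eq_of_pos h').symm⟩
    rw [hj] at h ⊢
    rw [Nat.pred_succ] at h
    rw [pow_succ]; omega
  N_eq := rfl
  le_k₂ := Nat.le_pow_clog one_lt_two _

theorem eight_le_accR_mul {ε : ℝ} (hε : 0 < ε) : 8 ≤ accR ε * ε ^ 2 := by
  have h2 : (⌈8 / ε ^ 2⌉₊ : ℝ) ≤ accR ε := by exact_mod_cast le_max_right _ _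
  have h3 := (Nat.le_ceil (8 / ε ^ 2)).trans h2
  rwa [div_le_iff₀ (by positivity)] at h3

theorem one_le_two_rpow (ε : ℝ) : (1 : ℝ) ≤ 2 ^ (1 / ε ^ 2) :=
  Real.one_le_rpow one_le_two (by positivity)

theorem two_pow_accR_le {ε : ℝ} (hε : 0 < ε) :
    (2 : ℝ) ^ accR ε ≤ 2 * ((2 : ℝ) ^ (1 / ε ^ 2)) ^ 8 := by
  have h : (accR ε : ℝ) ≤ 1 / ε ^ 2 * (8 : ℕ) + 1 := by
    rw [accR, Nat.cast_max]
    refine max_le ?_ ?_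
    · have : 0 ≤ 1 / ε ^ 2 := by positivity
      push_cast; linarith
    · refine (Nat.ceil_lt_add_one (by positivity)).le.trans (le_of_eq ?_)
      push_cast; ring
  rw [← Real.rpow_natCast]
  refine (Real.rpow_le_rpow_of_exponent_le one_le_two h).trans (le_of_eq ?_)
  rw [Real.rpow_add two_pos, Real.rpow_mul_natCast two_pos.le, Real.rpow_one, mul_comm]

theorem numTests_le (n : ℕ) (ε : ℝ) :
    (numTests n : ℝ) ≤ 8 * (Real.log n + (2 : ℝ) ^ (1 / ε ^ 2)) := by
  have hE := one_le_two_rpow ε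
  have hlog : 0 ≤ Real.log n := Real.log_natCast_nonneg n
  have hc : (Nat.clog 2 (4 * n) : ℝ) ≤ 3 + 2 * Real.log n := by
    rcases Nat.eq_zero_or_pos n with rfl | hn
    · simp
    · have h := Nat.pow_pred_clog_lt_self one_lt_two (show 1 < 4 * n by omega)
      have h' := Nat.clog_pos one_lt_two (show 1 < 4 * n by omega)
      obtain ⟨j, hj⟩ : ∃ j, Nat.clog 2 (4 * n) = j + 1 :=
        ⟨_, (Nat.succ_pred_eq_of_pos h').symm⟩
      rw [hj] at h ⊢
      rw [Nat.pred_succ] at h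
      have h2 : (2 : ℝ) ^ j ≤ 4 * n := by exact_mod_cast h.le
      have h3 := Real.log_le_log (by positivity) h2
      have hn' : (n : ℝ) ≠ 0 := by positivity
      rw [Real.log_pow, Real.log_mul (by norm_num) hn', show (4 : ℝ) = 2 ^ 2 by norm_num,
        Real.log_pow] at h3
      have h4 := Real.log_two_gt_d9
      push_cast at h3 ⊢
      nlinarith
  rw [numTests]
  push_cast
  rcases max_cases (1 : ℝ) (Nat.clog 2 (4 * n) : ℝ) with ⟨h, -⟩ | ⟨h, -⟩ <;> rw [h] <;> linarith

theorem numCands_pow_le : ∃ c e : ℕ, ∀ (n : ℕ) (ε : ℝ), 0 < ε →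
    ((numCands n ε ^ 8 : ℕ) : ℝ) ≤ c * (Real.log n + (2 : ℝ) ^ (1 / ε ^ 2)) ^ e := by
  obtain ⟨K, hK⟩ : ∃ K : ℕ, (K : ℝ) = 2 ^ 64 * 8 := ⟨2 ^ 64 * 8, by norm_num⟩
  refine ⟨K ^ 8, 513 * 8, fun n ε hε => ?_⟩
  have hE := one_le_two_rpow ε
  have hlog : 0 ≤ Real.log n := Real.log_natCast_nonneg n
  have hB := two_pow_accR_le hε
  have hT := numTests_le n ε
  set L := Real.log n + (2 : ℝ) ^ (1 / ε ^ 2) with hL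
  have hB' : (2 : ℝ) ^ accR ε ≤ 2 * L ^ 8 := hB.trans (by gcongr; linarith)
  have hN : (numCands n ε : ℝ) ≤ K * L ^ 513 := by
    calc (numCands n ε : ℝ) = (2 ^ accR ε) ^ 64 * numTests n := by
          rw [numCands, Nat.cast_mul, Nat.cast_mul, Nat.cast_pow, Nat.cast_pow, Nat.cast_ofNat,
            mul_right_comm, ← pow_add]
      _ ≤ (2 * L ^ 8) ^ 64 * (8 * L) := by gcongr
      _ = K * L ^ 513 := by
          rw [hK, mul_pow, ← pow_mul, mul_mul_mul_comm, ← pow_succ]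
  rw [Nat.cast_pow, Nat.cast_pow, pow_mul, ← mul_pow]
  gcongr

theorem exists_isLeast {n : ℕ} (f : Cube n → ℝ) : ∃ g ∈ submodularClass n,
    IsLeast {r : ℝ | ∃ g ∈ submodularClass n, r = l2norm (fun x => f x - g x)}
      (l2norm fun x => f x - g x) := by
  have hcl : IsClosed (submodularClass n) := by
    have h : submodularClass n = (⋂ x, {g | g x ∈ Set.Icc (0 : ℝ) 1}) ∩
        ⋂ x, ⋂ y, {g | g (x ⊔ y) + g (x ⊓ y) ≤ g x + g y} := by
      ext g
      simp [submodularClass]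
    rw [h]
    refine (isClosed_iInter fun x => isClosed_Icc.preimage (continuous_apply x)).inter
      (isClosed_iInter fun x => isClosed_iInter fun y => isClosed_le ?_ ?_) <;> fun_prop
  have hco : IsCompact (submodularClass n) :=
    (isCompact_univ_pi fun _ => isCompact_Icc (a := (0 : ℝ)) (b := 1)).of_isClosed_subset hcl
      fun g hg x _ => hg.1 x
  have hne : (submodularClass n).Nonempty := ⟨fun _ => 0, by simp [submodularClass]⟩
  have hcont : Continuous fun g : Cube n → ℝ => l2norm fun x => f x - g x := by
    unfold l2norm
    fun_prop
  obtain ⟨g, hg, hmin⟩ := hco.exists_isMinOn hne hcont.continuousOn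
  refine ⟨g, hg, ⟨g, hg, rfl⟩, ?_⟩
  rintro _ ⟨g', hg', rfl⟩
  exact hmin hg'

/-- The learner computes `coinHyp`, within its resources. -/
theorem exec_learner {n : ℕ} (f : Cube n → ℝ) {ε : ℝ} (hε : 0 < ε) (ω : ℕ → Bool) :
    ∃ s : State n, Exec f ω learner (State.init n ε) s ∧
      s.time ≤ learner.coef * (2 * numCands n ε ^ 8 + n + 1) ^ learner.depth ∧
      s.queries ≤ 3 * numCands n ε ^ 8 ∧
      hypothesis s.out = coinHyp f (Nat.clog 2 ((2 ^ accR ε) ^ 32 * numTests n)) (8 * accR ε)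
        (numTests n) (Nat.clog 2 (numCands n ε ^ 8)) (numCands n ε) ω := by
  have hp := params_learner n ε
  obtain ⟨N, hN⟩ : ∃ N, N = numCands n ε := ⟨_, rfl⟩
  obtain ⟨T, hT⟩ : ∃ T, T = numTests n := ⟨_, rfl⟩
  rw [← hN, ← hT] at hp ⊢
  set B := 2 ^ accR ε with hB
  set k := Nat.clog 2 (B ^ 32 * T)
  set k₂ := Nat.clog 2 (N ^ 8)
  have hB1 : 1 ≤ B := Nat.one_le_two_pow
  have hB2 : 2 ^ 1 ≤ B := Nat.pow_le_pow_right two_pos hp.R_pos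
  have hB8 : 2 ^ (8 * accR ε) ≤ B ^ 32 := by
    rw [mul_comm, pow_mul]; exact Nat.pow_le_pow_right hB1 (by norm_num)
  have hB32 : 2 ≤ B ^ 32 := (Nat.le_self_pow (by norm_num) B).trans' hB2
  have hT1 := hp.T_pos
  have hNe : N = B ^ 32 * T * B ^ 32 := hp.N_eq
  have hMN : 2 * (B ^ 32 * T) ≤ N := by
    rw [hNe, mul_comm 2]; exact Nat.mul_le_mul_left _ hB32
  have hkN : 2 ^ k ≤ N := hp.k_lt.le.trans hMN
  have hTM : T ≤ B ^ 32 * T := Nat.le_mul_of_pos_left _ (by positivity)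
  have hBM : B ^ 32 ≤ B ^ 32 * T := Nat.le_mul_of_pos_right _ hT1
  have hN2 : 1 < N := by omega
  have hN8 : N ≤ N ^ 8 := Nat.le_self_pow (by norm_num) N
  have hk₂ : 2 ^ k₂ ≤ 2 * N ^ 8 := by
    have h := Nat.pow_pred_clog_lt_self one_lt_two (hN2.trans_le hN8)
    have h' := Nat.clog_pos one_lt_two (hN2.trans_le hN8)
    obtain ⟨j, hj⟩ : ∃ j, k₂ = j + 1 := ⟨_, (Nat.succ_pred_eq_of_pos h').symm⟩
    change 2 ^ Nat.pred k₂ < _ at h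
    rw [hj] at h ⊢
    rw [Nat.pred_succ] at h
    rw [pow_succ]; omega
  have hW : n + 1 ≤ 2 * N ^ 8 + n + 1 := by omega
  have hrun : Runs (2 * N ^ 8 + n + 1) f ω learner (State.init n ε).core fun s =>
      s.queries = 2 ^ k₂ + N * (T * (2 ^ (8 * accR ε) * 2 ^ k)) ∧
      hypothesis s.out = coinHyp f k (8 * accR ε) T k₂ N ω := by
    refine Runs.seq hW (runs_setup hW hε hT hNe (by omega) rfl) ?_
    rintro _ ⟨m, r, rfl, hL, h1, h2⟩
    exact runs_learn hW (by omega) (by omega) (by omega) (by omega) (by omega) hL h1 h2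
  obtain ⟨s, h1, h2, h3, h4⟩ := hrun _ rfl
  refine ⟨s, h1, by simpa [State.init] using h2, ?_, h4⟩
  have h5 : s.queries = _ := h3
  rw [h5]
  have h6 : N * (T * (2 ^ (8 * accR ε) * 2 ^ k)) ≤ N * (N * (N * N)) := by
    gcongr <;> omega
  have h7 : N * (N * (N * N)) ≤ N ^ 8 := by
    calc N * (N * (N * N)) = N ^ 4 := by ring
      _ ≤ N ^ 8 := Nat.pow_le_pow_right (by omega) (by norm_num)
  omega

theorem le_of_le_of_le {a V : ℝ} {c e C : ℕ} (hV : 1 ≤ V) (h : a ≤ c * V ^ e) (hc : c ≤ C)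
    (he : e ≤ C) : a ≤ C * V ^ C := by
  refine h.trans ?_
  have : (c : ℝ) ≤ C := by exact_mod_cast hc
  gcongr

end

end SubmodLearn

open SubmodLearn in
theorem theorem6 :
    ∃ (A : Prog) (C : ℕ), ∀ (n : ℕ) (f : Cube n → ℝ), (∀ x, f x ∈ Set.Icc (0 : ℝ) 1) →
      ∃ Δ : ℝ, IsLeast {r : ℝ | ∃ g ∈ submodularClass n, r = l2norm (fun x => f x - g x)} Δ ∧
        ∀ ε : ℝ, 0 < ε →
          (∀ ω : ℕ → Bool, ∃ s : State n, Exec f ω A (State.init n ε) s ∧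
            (s.time : ℝ) ≤ C * ((n : ℝ) + (2 : ℝ) ^ (1 / ε ^ 2)) ^ C ∧
            (s.queries : ℝ) ≤ C * (Real.log n + (2 : ℝ) ^ (1 / ε ^ 2)) ^ C) ∧
          (2 / 3 : ENNReal) ≤ fairCoins {ω | ∃ s : State n, Exec f ω A (State.init n ε) s ∧
            l2norm (fun x => f x - hypothesis s.out x) ≤ Δ + ε} := by
  obtain ⟨c, e, hce⟩ := numCands_pow_le
  obtain ⟨d, hd⟩ : ∃ d, d = learner.depth := ⟨_, rfl⟩
  obtain ⟨c₁, hc₁⟩ : ∃ c₁, c₁ = learner.coef * (2 * c + 2) ^ d := ⟨_, rfl⟩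
  refine ⟨learner, c₁ + (e + 1) * d + 3 * c + e, fun n f h01 => ?_⟩
  obtain ⟨g, hg, hleast⟩ := exists_isLeast f
  refine ⟨_, hleast, fun ε hε => ⟨fun ω => ?_, ?_⟩⟩
  · obtain ⟨s, h1, h2, h3, -⟩ := exec_learner f hε ω
    have hE := one_le_two_rpow ε
    have hlog : 0 ≤ Real.log n := Real.log_natCast_nonneg n
    have hlogn : Real.log n ≤ n := Real.log_le_self (Nat.cast_nonneg n)
    have hN := hce n ε hε
    have h3' : (s.queries : ℝ) ≤ 3 * ((numCands n ε ^ 8 : ℕ) : ℝ) := by exact_mod_cast h3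
    have h2' : (s.time : ℝ)
        ≤ learner.coef * (2 * ((numCands n ε ^ 8 : ℕ) : ℝ) + n + 1) ^ learner.depth := by
      exact_mod_cast h2
    refine ⟨s, h1, ?_, ?_⟩
    · set V := (n : ℝ) + (2 : ℝ) ^ (1 / ε ^ 2) with hV
      have hn : (0 : ℝ) ≤ n := Nat.cast_nonneg n
      have hV1 : 1 ≤ V := by linarith
      refine le_of_le_of_le (c := c₁) (e := (e + 1) * d) hV1 (h2'.trans ?_) (by omega) (by omega)
      have hNV : ((numCands n ε ^ 8 : ℕ) : ℝ) ≤ c * V ^ (e + 1) := hN.trans <| by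
        gcongr ?_ * ?_
        calc _ ≤ V ^ e := by gcongr; rw [hV]; linarith
          _ ≤ V ^ (e + 1) := pow_le_pow_right₀ hV1 (by omega)
      have hVe : V ≤ V ^ (e + 1) := le_self_pow₀ hV1 (by omega)
      calc (learner.coef : ℝ) * (2 * ((numCands n ε ^ 8 : ℕ) : ℝ) + n + 1) ^ learner.depth
          ≤ learner.coef * ((2 * c + 2) * V ^ (e + 1)) ^ learner.depth := by
            gcongr
            linarith
        _ = c₁ * V ^ ((e + 1) * d) := by
            rw [hc₁, hd, mul_pow, ← pow_mul]; push_cast; ring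
    · refine le_of_le_of_le (c := 3 * c) (e := e) (by linarith) (h3'.trans ?_) (by omega) (by omega)
      push_cast at hN ⊢
      linarith
  · have hpr := (params_learner n ε).le_pr_hyp h01 hg hε (eight_le_accR_mul hε)
    have h23 : (2 / 3 : ENNReal) = ENNReal.ofReal (2 / 3) := by
      rw [ENNReal.ofReal_div_of_pos (by norm_num)]
      norm_num
    rw [h23]
    refine (ENNReal.ofReal_le_ofReal hpr).trans ?_
    rw [← fairCoins_readCoins]
    refine MeasureTheory.measure_mono fun ω hω => ?_
    obtain ⟨s, h1, -, -, h4⟩ := exec_learner f hε ω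
    refine ⟨s, h1, ?_⟩
    rw [h4, coinHyp_eq]
    exact hω
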